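/- **Theorem 2.1 (Integral representation).** Let $T>0$ and let $g_0,g_1:\mathbb R\to\mathbb C$ be compactly supported in $(0,T)$. Let $y$ solve $$y_t-i(\partial_x^4+\partial_x^2)y=0\ \text{ in }(0,\infty)\times(0,T),\qquad y(x,0)=0,\qquad y(0,t)=g_0(t),\quad \partial_xy(0,t)=g_1(t)\quad(0<t<T).$$ Assume that $y$ is of class $C^4$ on $[0,\infty)\times[0,T]$ and that, for $0\le j\le4$, $\partial_x^jy(x,t)=O((1+x)^{-2})$ as $x\to\infty$, uniformly in $t\in[0,T]$. Put $w(k)=-i(k^4-k^2)$, $D^+=\{k\in\mathbb C:\operatorname{Re}w(k)<0,\ \operatorname{Im}k>0\}$, $E(k;x,t)=-\frac1{2\pi}e^{ikx-w(k)t}$, $\tilde g_j(\kappa,t)=\int_0^te^{\kappa s}g_j(s)\,ds$, and $$G(k;t)=-2ik\,(k+\nu(k))\,\tilde g_1(w(k),t)-2k\,\nu(k)\,(k+\nu(k))\,\tilde g_0(w(k),t).$$ Here $\nu$ is the invariance map $\nu(k)=\sqrt{1-k^2}$ with rotated branch cut: for a fixed $\varepsilon\in(0,\pi/2)$, $\nu(k)=|z|^{1/2}e^{i\arg(z)/2}$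 with $z=1-k^2$, where $\arg z\in[\varepsilon,2\pi+\varepsilon)$ if $\operatorname{Re}k\ge0$ and $\arg z\in[-\varepsilon,2\pi-\varepsilon)$ if $\operatorname{Re}k<0$. (On $\overline{D^+}$ this is the continuous branch of $\sqrt{1-k^2}$ with $\operatorname{Im}\nu\ge0$; it is holomorphic in $D^+$ and does not depend on $\varepsilon$ there.) Then, for all $x>0$ and $0<t<T$, $$y(x,t)=W_b[g_0,g_1](x,t)=\int_{\partial D^+}E(k;x,t)\,G(k;T)\,dk,$$ where the integral converges absolutely and $\partial D^+$ is oriented so that $D^+$ lies on its left. -/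

import Mathlib

open Set Filter Topology MeasureTheory

noncomputable section

namespace HalfLine

/-! ### The initial-boundary value problem -/

/-- `y` solves `y_t - i (∂_x⁴ + ∂_x²) y = 0` on `(0,∞) × (0,T)`, with `y(x,0) = 0`,
`y(0,t) = g₀(t)` and `∂_x y(0,t) = g₁(t)` (one-sided derivative at the boundary). -/
structure IsSolution (T : ℝ) (g₀ g₁ : ℝ → ℂ) (y : ℝ → ℝ → ℂ) : Prop where
  pde : ∀ x t : ℝ, 0 < x → 0 < t → t < T →
    deriv (fun τ => y x τ) t
      - Complex.I * (iteratedDeriv 4 (fun ξ => y ξ t) x + iteratedDeriv 2 (fun ξ => y ξ t) x) = 0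
  initial : ∀ x : ℝ, 0 < x → y x 0 = 0
  dirichlet : ∀ t : ℝ, 0 < t → t < T → y 0 t = g₀ t
  neumann : ∀ t : ℝ, 0 < t → t < T → derivWithin (fun ξ => y ξ t) (Ici 0) 0 = g₁ t

/-- `y` is of class `C⁴` (jointly in `x` and `t`) on the closed half strip `[0,∞) × [0,T]`. -/
def SmoothUpToBoundary (T : ℝ) (y : ℝ → ℝ → ℂ) : Prop :=
  ContDiffOn ℝ 4 (fun p : ℝ × ℝ => y p.1 p.2) (Ici 0 ×ˢ Icc 0 T)

/-- `y` and its `x`-derivatives up to order four are `O((1+x)⁻²)` as `x → ∞`,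
uniformly in `t ∈ [0,T]`. -/
def DecaysAtInfinity (T : ℝ) (y : ℝ → ℝ → ℂ) : Prop :=
  ∃ C : ℝ, ∀ j : ℕ, j ≤ 4 → ∀ x t : ℝ, 0 < x → 0 ≤ t → t ≤ T →
    ‖iteratedDeriv j (fun ξ => y ξ t) x‖ ≤ C / (1 + x) ^ 2

/-! ### The spectral functions -/

/-- The spectral input `w(k) = -i (k⁴ - k²)`. -/
def w (k : ℂ) : ℂ := -Complex.I * (k ^ 4 - k ^ 2)

/-- The region `D⁺ = {Re w < 0} ∩ {Im k > 0}`. -/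
def Dplus : Set ℂ := {k | (w k).re < 0} ∩ {k | 0 < k.im}

/-- The `t`-transform `g̃(κ,t) = ∫₀ᵗ e^{κ s} g(s) ds`. -/
def tTransform (g : ℝ → ℂ) (κ : ℂ) (t : ℝ) : ℂ :=
  ∫ s in (0 : ℝ)..t, Complex.exp (κ * s) * g s

/-- The square root `|z|^{1/2} e^{i arg z / 2}` with `arg z ∈ [θ, θ + 2π)`: its branch cut is the
ray of argument `θ`. -/
def sqrtCut (θ : ℝ) (z : ℂ) : ℂ :=
  (Real.sqrt ‖z‖ : ℂ) *
    Complex.exp (Complex.I * ((toIcoMod Real.two_pi_pos θ (Complex.arg z) / 2 : ℝ) : ℂ))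

/-- The invariance map `ν(k) = √(1 - k²)` with rotated branch cut: the cut of the square root is the
ray of argument `ε` for `Re k ≥ 0` and the ray of argument `-ε` for `Re k < 0`. In the `k`-plane the
two cuts then leave the branch points `1` and `-1` into the lower half plane, so they do not meet
`closure D⁺ \ {-1}`; the two components of `D⁺` lie in `Re k > 0` and `Re k < 0`. The lemmas `nu_sq`, `nu_im_nonneg`, `continuousOn_nu`, `differentiableOn_nu`
below say that this is the continuous branch of the root with `Im ν ≥ 0` on `closure D⁺`. -/
def nu (ε : ℝ) (k : ℂ) : ℂ :=
  if 0 ≤ k.re then sqrtCut ε (1 - k ^ 2) else sqrtCut (-ε) (1 - k ^ 2)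

/-- `E(k;x,t) = -(1/2π) e^{ikx - w(k)t}`. -/
def E (k : ℂ) (x t : ℝ) : ℂ :=
  -(1 / (2 * (Real.pi : ℂ))) * Complex.exp (Complex.I * k * x - w k * t)

/-- `G(k;t) = -2ik(k+ν(k)) g̃₁(w(k),t) - 2kν(k)(k+ν(k)) g̃₀(w(k),t)`. -/
def G (ε : ℝ) (g₀ g₁ : ℝ → ℂ) (k : ℂ) (t : ℝ) : ℂ :=
  -2 * Complex.I * k * (k + nu ε k) * tTransform g₁ (w k) t
    - 2 * k * nu ε k * (k + nu ε k) * tTransform g₀ (w k) t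

/-! ### The oriented boundary of `D⁺`

Each path below is traversed in the direction of increasing parameter; `D⁺` lies on its left
(lemma `left_mem_Dplus`), and together they make up `∂D⁺` (lemma `frontier_Dplus`). -/

/-- In this order: the positive imaginary axis downwards, the segment `[0, 1/√2]`, the right branch
of the hyperbola `(Re k)² - (Im k)² = 1/2` in the upper half plane (upwards), its left branch
(upwards), and the ray `(-∞, -1/√2]`. -/
def bdryPath : Fin 5 → ℝ → ℂ :=
  ![fun s => -Complex.I * s,
    fun s => (s : ℂ),
    fun s => (Real.sqrt (s ^ 2 + 1 / 2) : ℂ) + Complex.I * s,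
    fun s => -(Real.sqrt (s ^ 2 + 1 / 2) : ℂ) + Complex.I * s,
    fun s => (s : ℂ)]

/-- The parameter intervals of the paths `bdryPath`. -/
def bdryInterval : Fin 5 → Set ℝ :=
  ![Iio 0, Ioo 0 (1 / Real.sqrt 2), Ioi 0, Ioi 0, Iio (-(1 / Real.sqrt 2))]

/-- `f(k) dk` pulled back to the `j`-th path. -/
def bdryIntegrand (f : ℂ → ℂ) (j : Fin 5) (s : ℝ) : ℂ :=
  f (bdryPath j s) * deriv (bdryPath j) s

/-- `f` is absolutely integrable along `∂D⁺`. -/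
def BdryIntegrable (f : ℂ → ℂ) : Prop :=
  ∀ j : Fin 5, IntegrableOn (bdryIntegrand f j) (bdryInterval j)

/-- The contour integral `∫_{∂D⁺} f(k) dk`. -/
def bdryIntegral (f : ℂ → ℂ) : ℂ :=
  ∑ j : Fin 5, ∫ s in bdryInterval j, bdryIntegrand f j s

/-- The boundary integral operator `W_b[g₀,g₁](x,t) = ∫_{∂D⁺} E(k;x,t) G(k;T) dk`. -/
def Wb (ε T : ℝ) (g₀ g₁ : ℝ → ℂ) (x t : ℝ) : ℂ :=
  bdryIntegral (fun k => E k x t * G ε g₀ g₁ k T)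

/-! ### Checks on the definitions -/

lemma w_re (k : ℂ) : (w k).re = 2 * k.re * k.im * (2 * (k.re ^ 2 - k.im ^ 2) - 1) := by
  have h : k ^ 4 - k ^ 2 = k * k * (k * k) - k * k := by ring
  rw [w, h]
  simp only [Complex.mul_re, Complex.mul_im, Complex.sub_re, Complex.sub_im, Complex.neg_re,
    Complex.neg_im, Complex.I_re, Complex.I_im]
  ring

lemma mem_Dplus_iff (k : ℂ) : k ∈ Dplus ↔ 0 < k.im ∧
    ((0 < k.re ∧ k.re ^ 2 - k.im ^ 2 < 1 / 2) ∨ (k.re < 0 ∧ 1 / 2 < k.re ^ 2 - k.im ^ 2)) := by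
  have e : (k ∈ Dplus) ↔ (w k).re < 0 ∧ 0 < k.im := Iff.rfl
  rw [e, w_re]
  constructor
  · rintro ⟨h, hi⟩
    refine ⟨hi, ?_⟩
    rcases lt_trichotomy k.re 0 with hr | hr | hr
    · refine Or.inr ⟨hr, ?_⟩
      by_contra hc
      have := mul_nonneg (mul_nonneg (neg_nonneg.2 hr.le) hi.le)
        (by linarith : (0 : ℝ) ≤ 1 - 2 * (k.re ^ 2 - k.im ^ 2))
      nlinarith
    · simp [hr] at h
    · refine Or.inl ⟨hr, ?_⟩
      by_contra hc
      have := mul_nonneg (mul_nonneg hr.le hi.le)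
        (by linarith : (0 : ℝ) ≤ 2 * (k.re ^ 2 - k.im ^ 2) - 1)
      nlinarith
  · rintro ⟨hi, ⟨hr, h⟩ | ⟨hr, h⟩⟩
    · refine ⟨?_, hi⟩
      have := mul_pos (mul_pos hr hi) (by linarith : (0 : ℝ) < 1 - 2 * (k.re ^ 2 - k.im ^ 2))
      nlinarith
    · refine ⟨?_, hi⟩
      have := mul_pos (mul_pos (neg_pos.2 hr) hi)
        (by linarith : (0 : ℝ) < 2 * (k.re ^ 2 - k.im ^ 2) - 1)
      nlinarith

lemma isOpen_Dplus : IsOpen Dplus := by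
  have hw : Continuous w := by unfold w; fun_prop
  exact (isOpen_lt (Complex.continuous_re.comp hw) continuous_const).inter
    (isOpen_lt continuous_const Complex.continuous_im)

/-- The closures of the two components of `D⁺`. -/
def clRight : Set ℂ := {k | 0 ≤ k.im ∧ 0 ≤ k.re ∧ k.re ^ 2 - k.im ^ 2 ≤ 1 / 2}

def clLeft : Set ℂ := {k | 0 ≤ k.im ∧ k.re ≤ 0 ∧ 1 / 2 ≤ k.re ^ 2 - k.im ^ 2}

lemma isClosed_clRight : IsClosed clRight := by
  have h1 := Complex.continuous_re
  have h2 := Complex.continuous_im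
  exact (isClosed_le continuous_const h2).inter ((isClosed_le continuous_const h1).inter
    (isClosed_le ((h1.pow 2).sub (h2.pow 2)) continuous_const))

lemma isClosed_clLeft : IsClosed clLeft := by
  have h1 := Complex.continuous_re
  have h2 := Complex.continuous_im
  exact (isClosed_le continuous_const h2).inter ((isClosed_le h1 continuous_const).inter
    (isClosed_le continuous_const ((h1.pow 2).sub (h2.pow 2))))

lemma closure_Dplus_subset : closure Dplus ⊆ clRight ∪ clLeft := by
  refine closure_minimal ?_ (isClosed_clRight.union isClosed_clLeft)
  intro k hk
  obtain ⟨hi, ⟨hr, h⟩ | ⟨hr, h⟩⟩ := (mem_Dplus_iff k).1 hk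
  · exact Or.inl ⟨hi.le, hr.le, h.le⟩
  · exact Or.inr ⟨hi.le, hr.le, h.le⟩

lemma re_neg_of_mem_clLeft {k : ℂ} (hk : k ∈ clLeft) : k.re < 0 := by
  obtain ⟨_, h2, h3⟩ := hk
  rcases h2.lt_or_eq with h | h
  · exact h
  · rw [h] at h3; nlinarith [sq_nonneg k.im]

lemma sqrtCut_sq (θ : ℝ) (z : ℂ) : sqrtCut θ z ^ 2 = z := by
  have h1 : toIcoMod Real.two_pi_pos θ z.arg
      = z.arg - toIcoDiv Real.two_pi_pos θ z.arg • (2 * Real.pi) := rfl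
  rw [sqrtCut, mul_pow, ← Complex.exp_nat_mul, h1, ← Complex.ofReal_pow,
    Real.sq_sqrt (norm_nonneg z)]
  have h2 : ((2 : ℕ) : ℂ) * (Complex.I *
      (((z.arg - toIcoDiv Real.two_pi_pos θ z.arg • (2 * Real.pi)) / 2 : ℝ) : ℂ))
      = (z.arg : ℂ) * Complex.I
        + ((-toIcoDiv Real.two_pi_pos θ z.arg : ℤ) : ℂ) * (2 * Real.pi * Complex.I) := by
    push_cast [zsmul_eq_mul]; ring
  rw [h2, Complex.exp_add, Complex.exp_int_mul_two_pi_mul_I, mul_one,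
    Complex.norm_mul_exp_arg_mul_I]

/-- The invariance property `ν² = 1 - k²`. -/
lemma nu_sq (ε : ℝ) (k : ℂ) : nu ε k ^ 2 = 1 - k ^ 2 := by
  unfold nu; split_ifs <;> exact sqrtCut_sq _ _

lemma w_nu (ε : ℝ) (k : ℂ) : w (nu ε k) = w k := by
  have h : nu ε k ^ 4 = (nu ε k ^ 2) ^ 2 := by ring
  rw [w, w, h, nu_sq]; ring

lemma sqrtCut_eq_exp {θ a : ℝ} {z : ℂ} {m : ℤ} (ha : a = z.arg + m * (2 * Real.pi))
    (h1 : θ ≤ a) (h2 : a < θ + 2 * Real.pi) :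
    sqrtCut θ z = (Real.sqrt ‖z‖ : ℂ) * Complex.exp (Complex.I * ((a / 2 : ℝ) : ℂ)) := by
  have : toIcoMod Real.two_pi_pos θ z.arg = a := by
    rw [toIcoMod_eq_iff]
    refine ⟨⟨h1, h2⟩, -m, ?_⟩
    rw [ha, zsmul_eq_mul]; push_cast; ring
  rw [sqrtCut, this]

lemma cpow_half_eq (z : ℂ) : z ^ (1 / 2 : ℂ)
    = (Real.sqrt ‖z‖ : ℂ) * Complex.exp (Complex.I * ((z.arg / 2 : ℝ) : ℂ)) := by
  rcases eq_or_ne z 0 with rfl | hz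
  · simp
  · have hn : (0 : ℝ) < ‖z‖ := norm_pos_iff.2 hz
    have hs : (Real.sqrt ‖z‖ : ℂ) = Complex.exp ((Real.log ‖z‖ / 2 : ℝ) : ℂ) := by
      rw [← Complex.ofReal_exp, Real.sqrt_eq_rpow, Real.rpow_def_of_pos hn]
      congr 2; ring
    rw [Complex.cpow_def_of_ne_zero hz, hs, ← Complex.exp_add, Complex.log]
    congr 1; push_cast; ring

/-- On the left component of `closure D⁺`, `ν` is the principal root of `1 - k²`. -/
lemma nu_eq_of_mem_clLeft {ε : ℝ} (h0 : 0 < ε) (h1 : ε < Real.pi / 2) {k : ℂ} (hk : k ∈ clLeft) :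
    nu ε k = (1 - k ^ 2) ^ (1 / 2 : ℂ) := by
  have hr := re_neg_of_mem_clLeft hk
  have hz : 0 ≤ (1 - k ^ 2).im := by
    simp only [sq, Complex.sub_im, Complex.one_im, Complex.mul_im]
    nlinarith [mul_nonneg (neg_nonneg.2 hr.le) hk.1]
  have ha := Complex.arg_nonneg_iff.2 hz
  have ha' := Complex.arg_le_pi (1 - k ^ 2)
  rw [nu, if_neg (not_le.2 hr), cpow_half_eq]
  exact sqrtCut_eq_exp (m := 0) (by simp) (by linarith) (by linarith)

/-- On the right component of `closure D⁺`, `ν` is minus the principal root of `1 - k²`. -/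
lemma nu_eq_of_mem_clRight {ε : ℝ} (h0 : 0 < ε) (h1 : ε < Real.pi / 2) {k : ℂ}
    (hk : k ∈ clRight) : nu ε k = -(1 - k ^ 2) ^ (1 / 2 : ℂ) := by
  obtain ⟨hi, hr, h⟩ := hk
  have hz : (1 - k ^ 2).im ≤ 0 := by
    simp only [sq, Complex.sub_im, Complex.one_im, Complex.mul_im]
    nlinarith [mul_nonneg hr hi]
  have hz' : 0 < (1 - k ^ 2).re := by
    simp only [sq, Complex.sub_re, Complex.one_re, Complex.mul_re]
    nlinarith
  have ha : (1 - k ^ 2).arg ≤ 0 := by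
    rcases hz.lt_or_eq with h | h
    · exact (Complex.arg_neg_iff.2 h).le
    · exact (Complex.arg_eq_zero_iff.2 ⟨hz'.le, h⟩).le
  have ha' : -(Real.pi / 2) ≤ (1 - k ^ 2).arg :=
    (abs_le.1 (Complex.abs_arg_le_pi_div_two_iff.2 hz'.le)).1
  have hpi := Real.pi_pos
  rw [nu, if_pos hr, cpow_half_eq,
    sqrtCut_eq_exp (m := 1) (a := (1 - k ^ 2).arg + 2 * Real.pi) (by simp) (by linarith)
      (by linarith)]
  have : Complex.I * ((((1 - k ^ 2).arg + 2 * Real.pi) / 2 : ℝ) : ℂ)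
      = Complex.I * (((1 - k ^ 2).arg / 2 : ℝ) : ℂ) + Real.pi * Complex.I := by
    push_cast; ring
  rw [this, Complex.exp_add, Complex.exp_pi_mul_I]; ring

lemma nu_im_nonneg {ε : ℝ} (h0 : 0 < ε) (h1 : ε < Real.pi / 2) {k : ℂ} (hk : k ∈ closure Dplus) :
    0 ≤ (nu ε k).im := by
  have key : ∀ z : ℂ, (z ^ (1 / 2 : ℂ)).im = Real.sqrt ‖z‖ * Real.sin (z.arg / 2) := by
    intro z
    rw [cpow_half_eq, mul_comm Complex.I, Complex.im_ofReal_mul, Complex.exp_ofReal_mul_I_im]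
  have hpi := Real.pi_pos
  rcases closure_Dplus_subset hk with hk | hk
  · rw [nu_eq_of_mem_clRight h0 h1 hk, Complex.neg_im, key]
    obtain ⟨hi, hr, h⟩ := hk
    have hz : (1 - k ^ 2).im ≤ 0 := by
      simp only [sq, Complex.sub_im, Complex.one_im, Complex.mul_im]
      nlinarith [mul_nonneg hr hi]
    have hz' : 0 < (1 - k ^ 2).re := by
      simp only [sq, Complex.sub_re, Complex.one_re, Complex.mul_re]
      nlinarith
    have ha : (1 - k ^ 2).arg ≤ 0 := by
      rcases hz.lt_or_eq with h | h
      · exact (Complex.arg_neg_iff.2 h).le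
      · exact (Complex.arg_eq_zero_iff.2 ⟨hz'.le, h⟩).le
    have := Real.sin_nonpos_of_nonpos_of_neg_pi_le (x := (1 - k ^ 2).arg / 2) (by linarith)
      (by linarith [Complex.neg_pi_lt_arg (1 - k ^ 2)])
    nlinarith [Real.sqrt_nonneg ‖1 - k ^ 2‖]
  · rw [nu_eq_of_mem_clLeft h0 h1 hk, key]
    have hz : 0 ≤ (1 - k ^ 2).im := by
      simp only [sq, Complex.sub_im, Complex.one_im, Complex.mul_im]
      nlinarith [mul_nonneg (neg_nonneg.2 (re_neg_of_mem_clLeft hk).le) hk.1]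
    have := Real.sin_nonneg_of_nonneg_of_le_pi (x := (1 - k ^ 2).arg / 2)
      (by linarith [Complex.arg_nonneg_iff.2 hz]) (by linarith [Complex.arg_le_pi (1 - k ^ 2)])
    exact mul_nonneg (Real.sqrt_nonneg _) this

lemma differentiableOn_nu {ε : ℝ} (h0 : 0 < ε) (h1 : ε < Real.pi / 2) :
    DifferentiableOn ℂ (nu ε) Dplus := by
  intro k hk
  apply DifferentiableAt.differentiableWithinAt
  have hev : ∀ᶠ z in 𝓝 k, z ∈ Dplus := isOpen_Dplus.mem_nhds hk
  have hd : 1 - k ^ 2 ∈ Complex.slitPlane → DifferentiableAt ℂ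
      (fun z : ℂ => (1 - z ^ 2) ^ (1 / 2 : ℂ)) k := fun h =>
    ((differentiableAt_const _).sub (differentiableAt_id.pow 2)).cpow_const h
  have him : (1 - k ^ 2).im = -(2 * k.re * k.im) := by
    simp only [sq, Complex.sub_im, Complex.one_im, Complex.mul_im]; ring
  obtain ⟨hi, ⟨hr, h⟩ | ⟨hr, h⟩⟩ := (mem_Dplus_iff k).1 hk
  · have hs : 1 - k ^ 2 ∈ Complex.slitPlane :=
      Or.inr (by rw [him]; have := mul_pos hr hi; intro h; nlinarith)
    refine (hd hs).neg.congr_of_eventuallyEq ?_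
    have hev2 : ∀ᶠ z : ℂ in 𝓝 k, 0 < z.re :=
      (isOpen_lt continuous_const Complex.continuous_re).mem_nhds hr
    filter_upwards [hev, hev2] with z hz hz2
    rcases closure_Dplus_subset (subset_closure hz) with h | h
    · exact nu_eq_of_mem_clRight h0 h1 h
    · exact absurd (re_neg_of_mem_clLeft h) (not_lt.2 hz2.le)
  · have hs : 1 - k ^ 2 ∈ Complex.slitPlane :=
      Or.inr (by rw [him]; have := mul_pos (neg_pos.2 hr) hi; intro h; nlinarith)
    refine (hd hs).congr_of_eventuallyEq ?_
    have hev2 : ∀ᶠ z : ℂ in 𝓝 k, z.re < 0 :=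
      (isOpen_lt Complex.continuous_re continuous_const).mem_nhds hr
    filter_upwards [hev, hev2] with z hz hz2
    rcases closure_Dplus_subset (subset_closure hz) with h | h
    · exact absurd h.2.1 (not_le.2 hz2)
    · exact nu_eq_of_mem_clLeft h0 h1 h

lemma continuousOn_nu {ε : ℝ} (h0 : 0 < ε) (h1 : ε < Real.pi / 2) :
    ContinuousOn (nu ε) (closure Dplus) := by
  have hsq : ContinuousOn (fun z : ℂ => z ^ (1 / 2 : ℂ)) {z : ℂ | 0 ≤ z.im} := by
    intro z hz
    rcases eq_or_ne z 0 with rfl | hz0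
    · apply ContinuousAt.continuousWithinAt
      have h2 : Tendsto (fun z : ℂ => Real.sqrt ‖z‖) (𝓝 0) (𝓝 0) := by
        have : Continuous (fun z : ℂ => Real.sqrt ‖z‖) := by fun_prop
        simpa using this.tendsto 0
      have : ContinuousAt (fun z : ℂ => z ^ (1 / 2 : ℂ)) 0 := by
        rw [ContinuousAt, show (0 : ℂ) ^ (1 / 2 : ℂ) = 0 by simp]
        refine squeeze_zero_norm (fun z => ?_) h2
        rw [cpow_half_eq, norm_mul, mul_comm Complex.I, Complex.norm_exp_ofReal_mul_I, mul_one,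
          Complex.norm_real, Real.norm_of_nonneg (Real.sqrt_nonneg _)]
      exact this
    · have harg : ContinuousWithinAt Complex.arg {z : ℂ | 0 ≤ z.im} z := by
        by_cases hs : z ∈ Complex.slitPlane
        · exact (Complex.continuousAt_arg hs).continuousWithinAt
        · have h3 := Complex.mem_slitPlane_iff.not.1 hs
          push Not at h3
          have hre : z.re < 0 := lt_of_le_of_ne h3.1 (fun h => hz0 (Complex.ext h h3.2))
          exact Complex.continuousWithinAt_arg_of_re_neg_of_im_zero hre h3.2
      have : (fun z : ℂ => z ^ (1 / 2 : ℂ)) = fun z : ℂ => (Real.sqrt ‖z‖ : ℂ) *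
          Complex.exp (Complex.I * ((z.arg / 2 : ℝ) : ℂ)) := funext cpow_half_eq
      rw [this]
      have hn : ContinuousWithinAt (fun z : ℂ => (Real.sqrt ‖z‖ : ℂ)) {z : ℂ | 0 ≤ z.im} z := by
        have : Continuous (fun z : ℂ => (Real.sqrt ‖z‖ : ℂ)) := by fun_prop
        exact this.continuousWithinAt
      have he : Continuous (fun a : ℝ => Complex.exp (Complex.I * ((a / 2 : ℝ) : ℂ))) := by
        fun_prop
      exact hn.mul (he.continuousAt.comp_continuousWithinAt harg)
  have hR : ContinuousOn (nu ε) clRight := by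
    have : ContinuousOn (fun k : ℂ => -(1 - k ^ 2) ^ (1 / 2 : ℂ)) clRight := by
      intro k hk
      have hs : 1 - k ^ 2 ∈ Complex.slitPlane := by
        refine Or.inl ?_
        obtain ⟨hi, hr, h⟩ := hk
        simp only [sq, Complex.sub_re, Complex.one_re, Complex.mul_re]
        nlinarith
      have hd : DifferentiableAt ℂ (fun z : ℂ => 1 - z ^ 2) k := by fun_prop
      exact (hd.cpow_const hs).neg.continuousAt.continuousWithinAt
    exact this.congr fun k hk => nu_eq_of_mem_clRight h0 h1 hk
  have hL : ContinuousOn (nu ε) clLeft := by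
    have : ContinuousOn (fun k : ℂ => (1 - k ^ 2) ^ (1 / 2 : ℂ)) clLeft := by
      refine hsq.comp (f := fun k : ℂ => 1 - k ^ 2) (by fun_prop) ?_
      intro k hk
      simp only [mem_ofPred_eq, sq, Complex.sub_im, Complex.one_im, Complex.mul_im]
      nlinarith [mul_nonneg (neg_nonneg.2 (re_neg_of_mem_clLeft hk).le) hk.1]
    exact this.congr fun k hk => nu_eq_of_mem_clLeft h0 h1 hk
  exact (hR.union_of_isClosed hL isClosed_clRight isClosed_clLeft).mono closure_Dplus_subset

lemma hasDerivAt_hyp (s : ℝ) : HasDerivAt (fun s : ℝ => (Real.sqrt (s ^ 2 + 1 / 2) : ℂ))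
    ((s / Real.sqrt (s ^ 2 + 1 / 2) : ℝ) : ℂ) s := by
  have hp : s ^ 2 + 1 / 2 ≠ 0 := by positivity
  have h := (((hasDerivAt_id s).pow 2).add_const (1 / 2 : ℝ)).sqrt (by simpa using hp)
  refine (h.congr_deriv ?_).ofReal_comp
  have hq : Real.sqrt (s ^ 2 + 1 / 2) ≠ 0 := (Real.sqrt_pos.2 (by positivity)).ne'
  simp only [id, Pi.pow_apply]
  field_simp
  try simp

lemma hasDerivAt_bdryPath (j : Fin 5) (s : ℝ) : HasDerivAt (bdryPath j)
    ((![-Complex.I, 1, ((s / Real.sqrt (s ^ 2 + 1 / 2) : ℝ) : ℂ) + Complex.I,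
      -((s / Real.sqrt (s ^ 2 + 1 / 2) : ℝ) : ℂ) + Complex.I, 1] : Fin 5 → ℂ) j) s := by
  have h1 : HasDerivAt (fun s : ℝ => (s : ℂ)) 1 s := by
    simpa using (hasDerivAt_id s).ofReal_comp
  fin_cases j
  · simpa [bdryPath] using h1.const_mul (-Complex.I)
  · exact h1
  · exact (hasDerivAt_hyp s).add (by simpa using h1.const_mul Complex.I)
  · exact (hasDerivAt_hyp s).neg.add (by simpa using h1.const_mul Complex.I)
  · exact h1

/-- Points slightly to the left of the oriented boundary paths lie in `D⁺`. -/
lemma left_mem_Dplus (j : Fin 5) (s : ℝ) (hs : s ∈ bdryInterval j) :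
    ∃ δ₀ > (0 : ℝ), ∀ δ : ℝ, 0 < δ → δ < δ₀ →
      bdryPath j s + δ * (Complex.I * deriv (bdryPath j) s) ∈ Dplus := by
  rw [(hasDerivAt_bdryPath j s).deriv]
  have h2 : (1 / Real.sqrt 2) ^ 2 = 1 / 2 := by
    rw [div_pow, Real.sq_sqrt (by norm_num)]; norm_num
  have h2p : 0 < 1 / Real.sqrt 2 := by positivity
  have hq : 0 < Real.sqrt (s ^ 2 + 1 / 2) := Real.sqrt_pos.2 (by positivity)
  have hqs : Real.sqrt (s ^ 2 + 1 / 2) ^ 2 = s ^ 2 + 1 / 2 := Real.sq_sqrt (by positivity)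
  set q := Real.sqrt (s ^ 2 + 1 / 2) with hqd
  fin_cases j
  · have hs : s < 0 := hs
    refine ⟨1 / Real.sqrt 2, h2p, fun δ hδ hδ' => (mem_Dplus_iff _).2 ?_⟩
    simp [bdryPath]
    refine ⟨hs, Or.inl ⟨hδ, ?_⟩⟩
    have : δ ^ 2 < (1 / Real.sqrt 2) ^ 2 := by gcongr
    nlinarith [sq_nonneg s]
  · have hs : s ∈ Ioo 0 (1 / Real.sqrt 2) := hs
    refine ⟨1, one_pos, fun δ hδ hδ' => (mem_Dplus_iff _).2 ?_⟩
    simp [bdryPath]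
    refine ⟨hδ, Or.inl ⟨hs.1, ?_⟩⟩
    have : s ^ 2 < (1 / Real.sqrt 2) ^ 2 := by have := hs.1; have := hs.2; gcongr
    nlinarith [sq_nonneg δ]
  · have hs : 0 < s := hs
    refine ⟨q, hq, fun δ hδ hδ' => (mem_Dplus_iff _).2 ?_⟩
    have e : bdryPath 2 s + δ * (Complex.I * (((s / q : ℝ) : ℂ) + Complex.I))
        = ⟨q - δ, s + δ * (s / q)⟩ := by
      have e0 : bdryPath 2 s = (q : ℂ) + Complex.I * s := rfl
      rw [e0]
      apply Complex.ext <;> simp <;> ring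
    change 0 < (bdryPath 2 s + δ * (Complex.I * (((s / q : ℝ) : ℂ) + Complex.I))).im ∧ _
    change _ ∧ ((0 < (bdryPath 2 s + δ * (Complex.I * (((s / q : ℝ) : ℂ) + Complex.I))).re ∧
      (bdryPath 2 s + δ * (Complex.I * (((s / q : ℝ) : ℂ) + Complex.I))).re ^ 2 -
      (bdryPath 2 s + δ * (Complex.I * (((s / q : ℝ) : ℂ) + Complex.I))).im ^ 2 < 1 / 2) ∨ _)
    rw [e]
    dsimp only
    have hsq : 0 < s / q := by positivity
    refine ⟨by positivity, Or.inl ⟨by linarith, ?_⟩⟩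
    have h3 : 0 < δ * (s / q) := by positivity
    have h4 : 0 < δ * (q - δ) := mul_pos hδ (by linarith)
    have h5 : 0 < δ * q := by positivity
    nlinarith [mul_pos hs h3, mul_pos h3 h3]
  · have hs : 0 < s := hs
    refine ⟨q, hq, fun δ hδ hδ' => (mem_Dplus_iff _).2 ?_⟩
    have e : bdryPath 3 s + δ * (Complex.I * (-((s / q : ℝ) : ℂ) + Complex.I))
        = ⟨-q - δ, s - δ * (s / q)⟩ := by
      have e0 : bdryPath 3 s = -(q : ℂ) + Complex.I * s := rfl
      rw [e0]
      apply Complex.ext <;> simp <;> ring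
    change 0 < (bdryPath 3 s + δ * (Complex.I * (-((s / q : ℝ) : ℂ) + Complex.I))).im ∧ (_ ∨
      ((bdryPath 3 s + δ * (Complex.I * (-((s / q : ℝ) : ℂ) + Complex.I))).re < 0 ∧
      1 / 2 < (bdryPath 3 s + δ * (Complex.I * (-((s / q : ℝ) : ℂ) + Complex.I))).re ^ 2 -
      (bdryPath 3 s + δ * (Complex.I * (-((s / q : ℝ) : ℂ) + Complex.I))).im ^ 2))
    rw [e]
    dsimp only
    have h6 : δ * (s / q) < s := by
      rw [mul_div_assoc', div_lt_iff₀ hq]; nlinarith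
    have h3 : 0 < δ * (s / q) := by positivity
    have h5 : 0 < δ * q := by positivity
    refine ⟨by linarith, Or.inr ⟨by linarith, ?_⟩⟩
    nlinarith [mul_pos h3 (sub_pos.2 h6)]
  · have hs : s < -(1 / Real.sqrt 2) := hs
    have hs2 : 1 / 2 < s ^ 2 := by nlinarith
    refine ⟨Real.sqrt (s ^ 2 - 1 / 2), Real.sqrt_pos.2 (by linarith),
      fun δ hδ hδ' => (mem_Dplus_iff _).2 ?_⟩
    have h7 : δ ^ 2 < s ^ 2 - 1 / 2 := (Real.lt_sqrt hδ.le).1 hδ'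
    simp [bdryPath]
    exact ⟨hδ, Or.inr ⟨by linarith, by linarith⟩⟩

/-- The boundary paths trace out `∂D⁺`. -/
lemma frontier_Dplus : frontier Dplus = ⋃ j : Fin 5, bdryPath j '' closure (bdryInterval j) := by
  have h2 : (1 / Real.sqrt 2) ^ 2 = 1 / 2 := by
    rw [div_pow, Real.sq_sqrt (by norm_num)]; norm_num
  have h2p : 0 < 1 / Real.sqrt 2 := by positivity
  have hcont : ∀ j, Continuous (bdryPath j) := fun j =>
    continuous_iff_continuousAt.2 fun s => (hasDerivAt_bdryPath j s).continuousAt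
  rw [frontier, isOpen_Dplus.interior_eq]
  apply Subset.antisymm
  · rintro k ⟨hk, hk'⟩
    rw [mem_iUnion]
    rw [mem_Dplus_iff] at hk'
    rcases closure_Dplus_subset hk with ⟨hi, hr, h⟩ | hkl
    · rcases hr.eq_or_lt with hr0 | hr0
      · refine ⟨0, -k.im, ?_, ?_⟩
        · simpa [bdryInterval] using hi
        · apply Complex.ext <;> simp [bdryPath, ← hr0]
      rcases hi.eq_or_lt with hi0 | hi0
      · refine ⟨1, k.re, ?_, ?_⟩
        · change k.re ∈ closure (Ioo 0 (1 / Real.sqrt 2))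
          rw [closure_Ioo h2p.ne]
          rw [← hi0] at h
          exact ⟨hr, abs_le_of_sq_le_sq' (by linarith) h2p.le |>.2⟩
        · apply Complex.ext <;> simp [bdryPath, ← hi0]
      · have he : k.re ^ 2 = k.im ^ 2 + 1 / 2 := by
          by_contra hne
          exact hk' ⟨hi0, Or.inl ⟨hr0, lt_of_le_of_ne h fun hh => hne (by linarith)⟩⟩
        refine ⟨2, k.im, ?_, ?_⟩
        · simpa [bdryInterval] using hi
        · have : Real.sqrt (k.im ^ 2 + 1 / 2) = k.re := by rw [← he, Real.sqrt_sq hr]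
          apply Complex.ext <;> simp [bdryPath]
          simpa using this
    · have hr0 := re_neg_of_mem_clLeft hkl
      obtain ⟨hi, hr, h⟩ := hkl
      rcases hi.eq_or_lt with hi0 | hi0
      · refine ⟨4, k.re, ?_, ?_⟩
        · change k.re ∈ closure (Iio (-(1 / Real.sqrt 2)))
          rw [closure_Iio, mem_Iic]
          rw [← hi0] at h
          by_contra hc
          nlinarith
        · apply Complex.ext <;> simp [bdryPath, ← hi0]
      · have he : k.re ^ 2 = k.im ^ 2 + 1 / 2 := by
          by_contra hne
          exact hk' ⟨hi0, Or.inr ⟨hr0, lt_of_le_of_ne h fun hh => hne (by linarith)⟩⟩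
        refine ⟨3, k.im, ?_, ?_⟩
        · simpa [bdryInterval] using hi
        · have : Real.sqrt (k.im ^ 2 + 1 / 2) = -k.re := by
            rw [← he, Real.sqrt_sq_eq_abs, abs_of_neg hr0]
          apply Complex.ext <;> simp [bdryPath]
          have h8 : Real.sqrt (k.im ^ 2 + 2⁻¹) = -k.re := by simpa using this
          linarith
  · refine iUnion_subset fun j => ?_
    have hsub : bdryPath j '' bdryInterval j ⊆ closure Dplus := by
      rintro _ ⟨s, hs, rfl⟩
      obtain ⟨δ₀, hδ₀, h⟩ := left_mem_Dplus j s hs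
      have ht : Tendsto (fun δ : ℝ => bdryPath j s + δ * (Complex.I * deriv (bdryPath j) s))
          (𝓝[>] 0) (𝓝 (bdryPath j s)) := by
        have : Continuous
            (fun δ : ℝ => bdryPath j s + δ * (Complex.I * deriv (bdryPath j) s)) := by fun_prop
        have := this.tendsto 0
        simp only [Complex.ofReal_zero, zero_mul, add_zero] at this
        exact this.mono_left nhdsWithin_le_nhds
      refine mem_closure_of_tendsto ht ?_
      filter_upwards [Ioo_mem_nhdsGT hδ₀] with δ hδ using h δ hδ.1 hδ.2
    have hsub' : bdryPath j '' closure (bdryInterval j) ⊆ closure Dplus :=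
      (image_closure_subset_closure_image (hcont j)).trans (closure_minimal hsub isClosed_closure)
    rintro k hk
    refine ⟨hsub' hk, ?_⟩
    obtain ⟨s, -, rfl⟩ := hk
    rw [mem_Dplus_iff]
    have hqs : Real.sqrt (s ^ 2 + 1 / 2) ^ 2 = s ^ 2 + 1 / 2 := Real.sq_sqrt (by positivity)
    rintro ⟨hi, h⟩
    fin_cases j
    · simp [bdryPath] at h
    · simp [bdryPath] at hi
    · simp only [bdryPath] at h
      simp at h hqs
      rcases h with ⟨h, h'⟩ | ⟨h, h'⟩ <;> linarith
    · simp only [bdryPath] at h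
      simp at h hqs
      rcases h with ⟨h, h'⟩ | ⟨h, h'⟩ <;> linarith
    · simp [bdryPath] at hi

end HalfLine

end

/-! Let `ŷ(k,t) = ∫₀^∞ e^{-ikx} y(x,t) dx`, defined for `Im k ≤ 0`. Transforming the equation and
integrating by parts in `x` four times gives the global relation `e^{w(k)t} ŷ(k,t) = B(k,t)`
(`exp_mul_halfFourier_eq`). Here `B` is `boundaryTransform`, a combination of the `t`-transforms of
the four traces `∂_x^j y(0,·)`, `j ≤ 3`, with polynomial coefficients of degree at most 3. Fourier
inversion then gives `y = (1/2π) ∫_ℝ e^{ikx-wt} B dk`, which still contains the unknown traces `j =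
2, 3`.

Two facts remove them. First, `e^{-wt} B(k,t)` only involves `e^{-w(t-s)}` with `s ≤ t`, so it has
polynomial growth where `Re w ≥ 0`. Since the part of the upper half plane outside `D⁺` is of this
kind, Cauchy's theorem moves the real line to `∂D⁺`. Second, `w` is invariant under `k ↦ -k` and `k
↦ ν(k)`, and `-k`, `-ν(k)` lie in `Im ≤ 0` when `k` is in the closure of `D⁺`. The global relation
holds at both points with the same `t`-transforms, and eliminating the two unknown ones
(`boundaryTransform_eq_rootG`) writes `B` as `-G(k;t)` plus multiples of `e^{wt} ŷ(-k)` and `e^{wt}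
ŷ(-ν)`. The factor `e^{-wt}` cancels these exponentials. What is left is holomorphic in `D⁺` and its
contour integral vanishes. Replacing `G(·;t)` by `G(·;T)` costs integrals of `e^{w(s-t)} g_j(s)`
over `t ≤ s ≤ T`, which are bounded where `Re w ≤ 0` and vanish for the same reason
(`contourInt_inversionIntegrand_sub`).

The square root is uniformized by `k = cosh ζ`. The upper half plane becomes the half strip `Re ζ >
0`, `0 < Im ζ < π`, the root becomes `±i sinh ζ`, and `Re w = (1/8) sinh(4 Re ζ) sin(4 Im ζ)`. Hence
`D⁺` is the union of the half strips `π/4 < Im ζ < π/2` and `3π/4 < Im ζ < π`, and every deformation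
is Cauchy's theorem in a half strip (`rayInt_sub_rayInt`).

None of the deformed integrals need converge absolutely, so the factor `(1 - ik/r)^{-5}` is
inserted. It is holomorphic for `Im k ≥ 0`; its power 5 beats the cubic growth of the integrand and
the factor `sinh ζ` of `dk = sinh ζ dζ`, leaving `1 / cosh (Re ζ)`. In physical space it replaces
`y(x,t)` by an average of `y(·,t)` against a gamma density of width `1/r` based at `x`. This gives
an exact identity for each `r ≥ 1` (`integral_gammaDensity_mul_eq_contourInt`). As `r → ∞` the
average tends to `y(x,t)`, and the contour side converges by domination (`exists_integrand_bound`):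
`e^{ikx}` decays on the unbounded curves where `Im k → ∞`, while on the ray `(-∞,-1]` the decay
comes from integrating by parts in the `t`-transforms of `g₀` (twice) and `g₁` (once). -/

namespace HalfLine

/-! ### Derivatives up to the boundary -/

/-- The closed half strip `[0,∞) × [0,T]`. -/
def halfStrip (T : ℝ) : Set (ℝ × ℝ) := Ici 0 ×ˢ Icc 0 T

/-- The partial derivative in the first variable, relative to the closed half strip. -/
noncomputable def xDeriv (T : ℝ) (f : ℝ × ℝ → ℂ) (p : ℝ × ℝ) : ℂ :=
  fderivWithin ℝ f (halfStrip T) p (1, 0)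

lemma uniqueDiffOn_halfStrip {T : ℝ} (hT : 0 < T) : UniqueDiffOn ℝ (halfStrip T) :=
  (uniqueDiffOn_Ici 0).prod (uniqueDiffOn_Icc hT)

lemma contDiffOn_xDeriv {T : ℝ} (hT : 0 < T) {f : ℝ × ℝ → ℂ} {n m : WithTop ℕ∞}
    (hf : ContDiffOn ℝ n f (halfStrip T)) (hm : m + 1 ≤ n) :
    ContDiffOn ℝ m (xDeriv T f) (halfStrip T) :=
  (hf.fderivWithin (uniqueDiffOn_halfStrip hT) hm).clm_apply contDiffOn_const

lemma hasDerivWithinAt_xDeriv {T : ℝ} {f : ℝ × ℝ → ℂ}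
    (hf : DifferentiableOn ℝ f (halfStrip T)) {x t : ℝ} (hx : 0 ≤ x) (ht : t ∈ Icc 0 T) :
    HasDerivWithinAt (fun ξ => f (ξ, t)) (xDeriv T f (x, t)) (Ici 0) x := by
  have h1 : HasFDerivWithinAt f (fderivWithin ℝ f (halfStrip T) (x, t)) (halfStrip T) (x, t) :=
    (hf (x, t) ⟨hx, ht⟩).hasFDerivWithinAt
  have h2 : HasDerivWithinAt (fun ξ : ℝ => (ξ, t)) ((1 : ℝ), (0 : ℝ)) (Ici 0) x :=
    (hasDerivWithinAt_id x _).prodMk (hasDerivWithinAt_const x _ t)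
  have h3 : MapsTo (fun ξ : ℝ => (ξ, t)) (Ici 0) (halfStrip T) := fun ξ hξ => ⟨hξ, ht⟩
  exact h1.comp_hasDerivWithinAt x h2 h3

/-- The `j`-th `x`-derivative of `y` on the closed half strip. -/
noncomputable def jet (T : ℝ) (y : ℝ → ℝ → ℂ) (j : ℕ) : ℝ × ℝ → ℂ :=
  (xDeriv T)^[j] fun p => y p.1 p.2

lemma jet_succ (T : ℝ) (y : ℝ → ℝ → ℂ) (j : ℕ) : jet T y (j + 1) = xDeriv T (jet T y j) :=
  Function.iterate_succ_apply' _ _ _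

lemma contDiffOn_jet {T : ℝ} (hT : 0 < T) {y : ℝ → ℝ → ℂ} (hy : SmoothUpToBoundary T y)
    (j m : ℕ) (h : m + j ≤ 4) : ContDiffOn ℝ m (jet T y j) (halfStrip T) := by
  induction j generalizing m with
  | zero => exact ContDiffOn.of_le hy (by exact_mod_cast h)
  | succ j ih =>
    rw [jet_succ]
    exact contDiffOn_xDeriv hT (ih (m + 1) (by omega)) (by push_cast; rfl)

lemma hasDerivWithinAt_jet {T : ℝ} (hT : 0 < T) {y : ℝ → ℝ → ℂ} (hy : SmoothUpToBoundary T y)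
    {j : ℕ} (hj : j < 4) {x t : ℝ} (hx : 0 ≤ x) (ht : t ∈ Icc 0 T) :
    HasDerivWithinAt (fun ξ => jet T y j (ξ, t)) (jet T y (j + 1) (x, t)) (Ici 0) x := by
  rw [jet_succ]
  exact hasDerivWithinAt_xDeriv
    ((contDiffOn_jet hT hy j 1 (by omega)).differentiableOn (by simp)) hx ht

/-- The equation and the decay are stated with interior derivatives, the boundary traces with
one-sided ones. For `x > 0` only a neighbourhood in the `x` direction matters, so the endpoints `t =
0` and `t = T` are allowed. -/
lemma iteratedDeriv_eq_jet {T : ℝ} (hT : 0 < T) {y : ℝ → ℝ → ℂ} (hy : SmoothUpToBoundary T y)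
    {j : ℕ} (hj : j ≤ 4) {x t : ℝ} (hx : 0 < x) (ht : t ∈ Icc 0 T) :
    iteratedDeriv j (fun ξ => y ξ t) x = jet T y j (x, t) := by
  induction j generalizing x with
  | zero => simp [jet]
  | succ j ih =>
    rw [iteratedDeriv_succ]
    have hev : iteratedDeriv j (fun ξ => y ξ t) =ᶠ[𝓝 x] fun ξ => jet T y j (ξ, t) := by
      filter_upwards [Ioi_mem_nhds hx] with ξ hξ using ih (by omega) hξ
    rw [hev.deriv_eq]
    exact ((hasDerivWithinAt_jet hT hy (by omega) hx.le ht).hasDerivAt (Ici_mem_nhds hx)).deriv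

lemma continuousOn_jet {T : ℝ} (hT : 0 < T) {y : ℝ → ℝ → ℂ} (hy : SmoothUpToBoundary T y)
    {j : ℕ} (hj : j ≤ 4) : ContinuousOn (jet T y j) (halfStrip T) :=
  (contDiffOn_jet hT hy j 0 (by omega)).continuousOn

lemma continuousOn_jet_left {T : ℝ} (hT : 0 < T) {y : ℝ → ℝ → ℂ} (hy : SmoothUpToBoundary T y)
    {j : ℕ} (hj : j ≤ 4) {t : ℝ} (ht : t ∈ Icc 0 T) :
    ContinuousOn (fun x => jet T y j (x, t)) (Ici 0) :=
  (continuousOn_jet hT hy hj).comp (by fun_prop) fun _ hx => ⟨hx, ht⟩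

lemma continuousOn_jet_right {T : ℝ} (hT : 0 < T) {y : ℝ → ℝ → ℂ} (hy : SmoothUpToBoundary T y)
    {j : ℕ} (hj : j ≤ 4) {x : ℝ} (hx : 0 ≤ x) :
    ContinuousOn (fun t => jet T y j (x, t)) (Icc 0 T) :=
  (continuousOn_jet hT hy hj).comp (by fun_prop) fun _ ht => ⟨hx, ht⟩

/-- Continuity of the jet carries the decay bound from `x > 0` to `x = 0`, which in particular
bounds all traces by `C`. -/
lemma norm_jet_le {T : ℝ} (hT : 0 < T) {y : ℝ → ℝ → ℂ} (hy : SmoothUpToBoundary T y) {C : ℝ}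
    (hC : ∀ j : ℕ, j ≤ 4 → ∀ x t : ℝ, 0 < x → 0 ≤ t → t ≤ T →
      ‖iteratedDeriv j (fun ξ => y ξ t) x‖ ≤ C / (1 + x) ^ 2)
    {j : ℕ} (hj : j ≤ 4) {x t : ℝ} (hx : 0 ≤ x) (ht : t ∈ Icc 0 T) :
    ‖jet T y j (x, t)‖ ≤ C / (1 + x) ^ 2 := by
  have hcl : x ∈ closure (Ioi (0 : ℝ)) := by rwa [closure_Ioi]
  have hc1 : ContinuousOn (fun x => ‖jet T y j (x, t)‖) (closure (Ioi 0)) := by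
    rw [closure_Ioi]; exact (continuousOn_jet_left hT hy hj ht).norm
  have hc2 : ContinuousOn (fun x : ℝ => C / (1 + x) ^ 2) (closure (Ioi 0)) := by
    rw [closure_Ioi]
    refine continuousOn_const.div (by fun_prop) fun x hx => ?_
    have : (0 : ℝ) ≤ x := hx
    positivity
  refine le_on_closure (fun ξ hξ => ?_) hc1 hc2 hcl
  rw [← iteratedDeriv_eq_jet hT hy hj hξ ht]
  exact hC j hj ξ t hξ ht.1 ht.2

/-- The equation constrains only the value of `deriv`, which is `0` by default; the joint smoothness
at interior points supplies the differentiability. -/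
lemma hasDerivAt_time {T : ℝ} (hT : 0 < T) {g₀ g₁ : ℝ → ℂ} {y : ℝ → ℝ → ℂ}
    (hsol : IsSolution T g₀ g₁ y) (hy : SmoothUpToBoundary T y) {x t : ℝ} (hx : 0 < x)
    (ht : t ∈ Ioo 0 T) :
    HasDerivAt (fun τ => y x τ) (Complex.I * (jet T y 4 (x, t) + jet T y 2 (x, t))) t := by
  have hS : halfStrip T ∈ 𝓝 (x, t) :=
    prod_mem_nhds (Ici_mem_nhds hx) (Icc_mem_nhds ht.1 ht.2)
  have hd : DifferentiableAt ℝ (fun p : ℝ × ℝ => y p.1 p.2) (x, t) :=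
    ((ContDiffOn.differentiableOn hy (by simp)) (x, t)
      ⟨hx.le, ht.1.le, ht.2.le⟩).differentiableAt hS
  have hd' : DifferentiableAt ℝ (fun τ => y x τ) t :=
    DifferentiableAt.comp (f := fun τ : ℝ => (x, τ)) (g := fun p : ℝ × ℝ => y p.1 p.2) t hd
      (by fun_prop)
  have htc : t ∈ Icc 0 T := Ioo_subset_Icc_self ht
  have := hsol.pde x t hx ht.1 ht.2
  rw [iteratedDeriv_eq_jet hT hy le_rfl hx htc, iteratedDeriv_eq_jet hT hy (by omega) hx htc,
    sub_eq_zero] at this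
  exact this ▸ hd'.hasDerivAt

lemma jet_zero_boundary {T : ℝ} {g₀ g₁ : ℝ → ℂ} {y : ℝ → ℝ → ℂ}
    (hsol : IsSolution T g₀ g₁ y) {t : ℝ} (ht : t ∈ Ioo 0 T) : jet T y 0 (0, t) = g₀ t :=
  hsol.dirichlet t ht.1 ht.2

lemma jet_one_boundary {T : ℝ} (hT : 0 < T) {g₀ g₁ : ℝ → ℂ} {y : ℝ → ℝ → ℂ}
    (hsol : IsSolution T g₀ g₁ y) (hy : SmoothUpToBoundary T y) {t : ℝ} (ht : t ∈ Ioo 0 T) :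
    jet T y 1 (0, t) = g₁ t := by
  rw [← hsol.neumann t ht.1 ht.2]
  exact ((hasDerivWithinAt_jet hT hy (j := 0) (by omega) le_rfl
    (Ioo_subset_Icc_self ht)).derivWithin (uniqueDiffOn_Ici 0 0 self_mem_Ici)).symm

/-- A function supported in `(0,T)` is smooth if it agrees there with a smooth function. -/
lemma contDiff_of_eqOn_Ioo {T : ℝ} {g h : ℝ → ℂ} {n : WithTop ℕ∞} (hg : tsupport g ⊆ Ioo 0 T)
    (hh : ContDiffOn ℝ n h (Icc 0 T)) (he : ∀ t ∈ Ioo 0 T, h t = g t) : ContDiff ℝ n g := by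
  rw [contDiff_iff_contDiffAt]
  intro t
  by_cases ht : t ∈ Ioo 0 T
  · refine (hh.contDiffAt (Icc_mem_nhds ht.1 ht.2)).congr_of_eventuallyEq ?_
    filter_upwards [Ioo_mem_nhds ht.1 ht.2] with s hs using (he s hs).symm
  · have h0 : g =ᶠ[𝓝 t] fun _ => 0 :=
      notMem_tsupport_iff_eventuallyEq.1 fun h => ht (hg h)
    exact contDiffAt_const.congr_of_eventuallyEq h0

lemma contDiffOn_jet_boundary {T : ℝ} (hT : 0 < T) {y : ℝ → ℝ → ℂ} (hy : SmoothUpToBoundary T y)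
    (j m : ℕ) (h : m + j ≤ 4) : ContDiffOn ℝ m (fun t => jet T y j (0, t)) (Icc 0 T) :=
  (contDiffOn_jet hT hy j m h).comp (by fun_prop) fun _ ht => ⟨self_mem_Ici, ht⟩

/-! ### The half-line Fourier transform and the global relation -/

/-- The Fourier transform of `f` on `(0,∞)`. -/
noncomputable def halfFourier (f : ℝ → ℂ) (k : ℂ) : ℂ :=
  ∫ x in Ioi (0 : ℝ), Complex.exp (-Complex.I * k * x) * f x

lemma norm_exp_neg_I_mul (k : ℂ) (x : ℝ) :
    ‖Complex.exp (-Complex.I * k * x)‖ = Real.exp (k.im * x) := by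
  rw [Complex.norm_exp]; simp

lemma norm_exp_neg_I_mul_le {k : ℂ} (hk : k.im ≤ 0) {x : ℝ} (hx : 0 ≤ x) :
    ‖Complex.exp (-Complex.I * k * x)‖ ≤ 1 := by
  rw [norm_exp_neg_I_mul]
  exact Real.exp_le_one_iff.2 (mul_nonpos_of_nonpos_of_nonneg hk hx)

lemma hasDerivAt_neg_inv_one_add {x : ℝ} (hx : 0 ≤ x) :
    HasDerivAt (fun x : ℝ => -(1 + x)⁻¹) (1 / (1 + x) ^ 2) x := by
  have h : (1 + x) ≠ 0 := by positivity
  have := (((hasDerivAt_id x).const_add 1).inv h).neg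
  refine this.congr_deriv ?_
  simp [neg_div]

lemma tendsto_neg_inv_one_add :
    Tendsto (fun x : ℝ => -(1 + x)⁻¹) atTop (𝓝 0) := by
  have := (tendsto_inv_atTop_zero.comp (tendsto_atTop_add_const_left atTop (1 : ℝ) tendsto_id)).neg
  simpa using this

lemma integrableOn_decay (C : ℝ) : IntegrableOn (fun x : ℝ => C / (1 + x) ^ 2) (Ioi 0) := by
  have h := integrableOn_Ioi_deriv_of_nonneg' (a := (0 : ℝ)) (l := 0)
    (g := fun x : ℝ => -(1 + x)⁻¹) (g' := fun x => 1 / (1 + x) ^ 2)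
    (fun x hx => hasDerivAt_neg_inv_one_add hx)
    (fun x hx => by positivity) tendsto_neg_inv_one_add
  exact (h.const_mul C).congr (Eventually.of_forall fun x => by simp only; ring)

/-- Exact mass `C`, so that `C` itself bounds the half-line transform. -/
lemma integral_decay (C : ℝ) : ∫ x in Ioi (0 : ℝ), C / (1 + x) ^ 2 = C := by
  have h := integral_Ioi_of_hasDerivAt_of_nonneg' (a := (0 : ℝ)) (l := 0)
    (g := fun x : ℝ => -(1 + x)⁻¹) (g' := fun x => 1 / (1 + x) ^ 2)
    (fun x hx => hasDerivAt_neg_inv_one_add hx)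
    (fun x hx => by positivity) tendsto_neg_inv_one_add
  have h2 : ∀ x : ℝ, C / (1 + x) ^ 2 = C * (1 / (1 + x) ^ 2) := fun x => by ring
  simp_rw [h2]
  rw [integral_const_mul, h]; simp

lemma tendsto_decay (C : ℝ) : Tendsto (fun x : ℝ => C / (1 + x) ^ 2) atTop (𝓝 0) := by
  have := ((tendsto_inv_atTop_zero.comp
    (tendsto_atTop_add_const_left atTop (1 : ℝ) tendsto_id)).pow 2).const_mul C
  simpa [div_eq_mul_inv] using this

section
variable {f f' : ℝ → ℂ} {C : ℝ}

lemma integrableOn_of_decay (hf : ContinuousOn f (Ici 0))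
    (hC : ∀ x, 0 ≤ x → ‖f x‖ ≤ C / (1 + x) ^ 2) : IntegrableOn f (Ioi 0) := by
  refine (integrableOn_decay C).mono'
    ((hf.mono Ioi_subset_Ici_self).aestronglyMeasurable measurableSet_Ioi) ?_
  filter_upwards [ae_restrict_mem measurableSet_Ioi] with x hx using hC x (le_of_lt hx)

lemma integrableOn_halfFourier (hf : ContinuousOn f (Ici 0))
    (hC : ∀ x, 0 ≤ x → ‖f x‖ ≤ C / (1 + x) ^ 2) {k : ℂ} (hk : k.im ≤ 0) :
    IntegrableOn (fun x : ℝ => Complex.exp (-Complex.I * k * x) * f x) (Ioi 0) := by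
  refine (integrableOn_decay C).mono'
    ((ContinuousOn.mul (by fun_prop)
      (hf.mono Ioi_subset_Ici_self)).aestronglyMeasurable measurableSet_Ioi) ?_
  filter_upwards [ae_restrict_mem measurableSet_Ioi] with x hx
  have hx : 0 ≤ x := le_of_lt hx
  rw [norm_mul]
  exact (mul_le_of_le_one_left (norm_nonneg _) (norm_exp_neg_I_mul_le hk hx)).trans (hC x hx)

lemma norm_halfFourier_le (hC : ∀ x, 0 ≤ x → ‖f x‖ ≤ C / (1 + x) ^ 2) {k : ℂ} (hk : k.im ≤ 0) :
    ‖halfFourier f k‖ ≤ C := by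
  rw [← integral_decay C]
  refine norm_integral_le_of_norm_le (integrableOn_decay C) ?_
  filter_upwards [ae_restrict_mem measurableSet_Ioi] with x hx
  have hx : 0 ≤ x := le_of_lt hx
  rw [norm_mul]
  exact (mul_le_of_le_one_left (norm_nonneg _) (norm_exp_neg_I_mul_le hk hx)).trans (hC x hx)

/-- Continuity up to the real axis is needed because parts of the contour are real, where the
transform need not be holomorphic. -/
lemma continuousOn_halfFourier (hf : ContinuousOn f (Ici 0))
    (hC : ∀ x, 0 ≤ x → ‖f x‖ ≤ C / (1 + x) ^ 2) :
    ContinuousOn (halfFourier f) {k | k.im ≤ 0} := by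
  intro k hk
  refine tendsto_integral_filter_of_dominated_convergence (fun x => C / (1 + x) ^ 2) ?_ ?_
    (integrableOn_decay C) ?_
  · exact Eventually.of_forall fun k => (ContinuousOn.mul (by fun_prop)
      (hf.mono Ioi_subset_Ici_self)).aestronglyMeasurable measurableSet_Ioi
  · filter_upwards [self_mem_nhdsWithin] with k hk
    filter_upwards [ae_restrict_mem measurableSet_Ioi] with x hx
    have hx : 0 ≤ x := le_of_lt hx
    rw [norm_mul]
    exact (mul_le_of_le_one_left (norm_nonneg _) (norm_exp_neg_I_mul_le hk hx)).trans (hC x hx)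
  · refine Eventually.of_forall fun x => Tendsto.mono_left ?_ nhdsWithin_le_nhds
    exact Continuous.tendsto (by fun_prop) k

lemma differentiableOn_halfFourier (hf : ContinuousOn f (Ici 0))
    (hC : ∀ x, 0 ≤ x → ‖f x‖ ≤ C / (1 + x) ^ 2) :
    DifferentiableOn ℂ (halfFourier f) {k | k.im < 0} := by
  intro k hk
  have hk : k.im < 0 := hk
  -- Half the distance from `k` to the real axis: near `k` one has `Im z < -c`, so the exponential
  -- decays uniformly.
  set c : ℝ := -k.im / 2 with hc
  have hcpos : 0 < c := by rw [hc]; linarith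
  have hs : {z : ℂ | z.im < -c} ∈ 𝓝 k :=
    (isOpen_lt Complex.continuous_im continuous_const).mem_nhds (by
      change k.im < -c; rw [hc]; linarith)
  have h := (hasDerivAt_integral_of_dominated_loc_of_deriv_le
    (μ := volume.restrict (Ioi (0 : ℝ)))
    (F := fun (z : ℂ) (x : ℝ) => Complex.exp (-Complex.I * z * x) * f x)
    (F' := fun (z : ℂ) (x : ℝ) => Complex.exp (-Complex.I * z * x) * (-Complex.I * x) * f x)
    (bound := fun x => c⁻¹ * (C / (1 + x) ^ 2)) hs ?_ ?_ ?_ ?_ ?_ ?_).2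
  · exact h.differentiableAt.differentiableWithinAt
  · exact Eventually.of_forall fun k => (ContinuousOn.mul (by fun_prop)
      (hf.mono Ioi_subset_Ici_self)).aestronglyMeasurable measurableSet_Ioi
  · exact integrableOn_halfFourier hf hC hk.le
  · exact (ContinuousOn.mul (by fun_prop)
      (hf.mono Ioi_subset_Ici_self)).aestronglyMeasurable measurableSet_Ioi
  · filter_upwards [ae_restrict_mem measurableSet_Ioi] with x hx z hz
    have hx : 0 ≤ x := le_of_lt hx
    have hz : z.im < -c := hz
    rw [norm_mul, norm_mul, norm_exp_neg_I_mul]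
    -- This is `x e^{-cx} ≤ 1/c`, from `cx ≤ e^{cx}`: the factor `x` produced by differentiation is
    -- absorbed.
    have h1 : Real.exp (z.im * x) * ‖-Complex.I * (x : ℂ)‖ ≤ c⁻¹ := by
      have h2 : Real.exp (z.im * x) ≤ Real.exp (-(c * x)) := by
        apply Real.exp_le_exp.2; nlinarith
      have h3 : c * x ≤ Real.exp (c * x) := by linarith [Real.add_one_le_exp (c * x)]
      have h4 : ‖-Complex.I * (x : ℂ)‖ = x := by simp [abs_of_nonneg hx]
      have h5 : Real.exp (c * x) * Real.exp (-(c * x)) = 1 := by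
        rw [← Real.exp_add, add_neg_cancel, Real.exp_zero]
      rw [h4, ← mul_one (c⁻¹), ← h5, ← mul_assoc]
      calc Real.exp (z.im * x) * x ≤ Real.exp (-(c * x)) * x := by gcongr
        _ = c⁻¹ * (c * x) * Real.exp (-(c * x)) := by field_simp
        _ ≤ _ := by gcongr
    exact mul_le_mul h1 (hC x hx) (norm_nonneg _) (by positivity)
  · exact (integrableOn_decay C).const_mul _
  · refine Eventually.of_forall fun x z _ => ?_
    have : HasDerivAt (fun z : ℂ => -Complex.I * z * x) (-Complex.I * x) z := by
      simpa using ((hasDerivAt_id z).const_mul (-Complex.I)).mul_const (x : ℂ)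
    exact this.cexp.mul_const _

/-- Integration by parts; the term at infinity vanishes because `|e^{-ikx}| ≤ 1` and `f` decays. -/
lemma halfFourier_deriv (hf : ContinuousOn f (Ici 0))
    (hC : ∀ x, 0 ≤ x → ‖f x‖ ≤ C / (1 + x) ^ 2) (hf' : ContinuousOn f' (Ici 0))
    (hC' : ∀ x, 0 ≤ x → ‖f' x‖ ≤ C / (1 + x) ^ 2)
    (hd : ∀ x, 0 ≤ x → HasDerivWithinAt f (f' x) (Ici 0) x) {k : ℂ} (hk : k.im ≤ 0) :
    halfFourier f' k = -f 0 + Complex.I * k * halfFourier f k := by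
  have hi := integrableOn_halfFourier hf hC hk
  have hi' := integrableOn_halfFourier hf' hC' hk
  have hF := integral_Ioi_of_hasDerivAt_of_tendsto (a := (0 : ℝ)) (m := (0 : ℂ))
    (f := fun x : ℝ => Complex.exp (-Complex.I * k * x) * f x)
    (f' := fun x : ℝ => (-Complex.I * k) * (Complex.exp (-Complex.I * k * x) * f x)
      + Complex.exp (-Complex.I * k * x) * f' x)
    ((ContinuousOn.mul (by fun_prop) hf) 0 self_mem_Ici) ?_ ?_ ?_
  · rw [integral_add (hi.const_mul _) hi', integral_const_mul] at hF
    simp only [Complex.ofReal_zero, mul_zero, Complex.exp_zero, one_mul, zero_sub] at hF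
    change -Complex.I * k * halfFourier f k + halfFourier f' k = _ at hF
    linear_combination hF
  · intro x hx
    have hx : 0 < x := hx
    have h1 : HasDerivAt (fun x : ℝ => -Complex.I * k * x) (-Complex.I * k) x := by
      simpa using (Complex.ofRealCLM.hasDerivAt (x := x)).const_mul (-Complex.I * k)
    refine (h1.cexp.mul ((hd x hx.le).hasDerivAt (Ici_mem_nhds hx))).congr_deriv ?_
    ring
  · exact (hi.const_mul _).add hi'
  · refine squeeze_zero_norm' ?_ (tendsto_decay C)
    filter_upwards [eventually_ge_atTop 0] with x hx
    rw [norm_mul]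
    exact (mul_le_of_le_one_left (norm_nonneg _) (norm_exp_neg_I_mul_le hk hx)).trans (hC x hx)

end

/-! ### Time evolution of the half-line transform -/

/-- The combination of boundary transforms in the global relation, with boundary values
`h j = ∂_x^j y(0,·)`. -/
noncomputable def boundaryTransform (h : ℕ → ℝ → ℂ) (k : ℂ) (t : ℝ) : ℂ :=
  Complex.I * (-tTransform (h 3) (w k) t - Complex.I * k * tTransform (h 2) (w k) t
    + (k ^ 2 - 1) * tTransform (h 1) (w k) t
    + Complex.I * k * (k ^ 2 - 1) * tTransform (h 0) (w k) t)

section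
variable {T : ℝ} {g₀ g₁ : ℝ → ℂ} {y : ℝ → ℝ → ℂ} {C : ℝ}

/-- Differentiation under the integral, with the equation trading `∂_t` for `x`-derivatives, whose
decay is uniform in `t` and provides the dominating function. -/
lemma hasDerivAt_halfFourier_time (hT : 0 < T) (hsol : IsSolution T g₀ g₁ y)
    (hy : SmoothUpToBoundary T y)
    (hC : ∀ j : ℕ, j ≤ 4 → ∀ x t : ℝ, 0 < x → 0 ≤ t → t ≤ T →
      ‖iteratedDeriv j (fun ξ => y ξ t) x‖ ≤ C / (1 + x) ^ 2)
    {k : ℂ} (hk : k.im ≤ 0) {t : ℝ} (ht : t ∈ Ioo 0 T) :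
    HasDerivAt (fun t => halfFourier (fun x => y x t) k)
      (Complex.I * (halfFourier (fun x => jet T y 4 (x, t)) k
        + halfFourier (fun x => jet T y 2 (x, t)) k)) t := by
  have htc := Ioo_subset_Icc_self ht
  have hcont := fun (j : ℕ) (hj : j ≤ 4) (t : ℝ) (ht : t ∈ Icc 0 T) =>
    continuousOn_jet_left hT hy hj ht
  have hdec := fun (j : ℕ) (hj : j ≤ 4) (t : ℝ) (ht : t ∈ Icc 0 T) (x : ℝ) (hx : 0 ≤ x) =>
    norm_jet_le hT hy hC hj hx ht
  have h := (hasDerivAt_integral_of_dominated_loc_of_deriv_le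
    (μ := volume.restrict (Ioi (0 : ℝ)))
    (F := fun (t : ℝ) (x : ℝ) => Complex.exp (-Complex.I * k * x) * y x t)
    (F' := fun (t : ℝ) (x : ℝ) => Complex.exp (-Complex.I * k * x) *
      (Complex.I * (jet T y 4 (x, t) + jet T y 2 (x, t))))
    (bound := fun x => C / (1 + x) ^ 2 + C / (1 + x) ^ 2)
    (Ioo_mem_nhds ht.1 ht.2) ?_ ?_ ?_ ?_ ?_ ?_).2
  · refine h.congr_deriv ?_
    unfold halfFourier
    rw [← integral_add (integrableOn_halfFourier (hcont 4 le_rfl t htc) (hdec 4 le_rfl t htc) hk)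
      (integrableOn_halfFourier (hcont 2 (by omega) t htc) (hdec 2 (by omega) t htc) hk),
      ← integral_const_mul]
    congr 1 with x
    ring
  · filter_upwards [Ioo_mem_nhds ht.1 ht.2] with s hs
    exact (integrableOn_halfFourier (hcont 0 (by omega) s (Ioo_subset_Icc_self hs))
      (hdec 0 (by omega) s (Ioo_subset_Icc_self hs)) hk).aestronglyMeasurable
  · exact integrableOn_halfFourier (hcont 0 (by omega) t htc) (hdec 0 (by omega) t htc) hk
  · exact (ContinuousOn.mul (by fun_prop) (continuousOn_const.mul
      (((hcont 4 le_rfl t htc).add (hcont 2 (by omega) t htc)).mono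
        Ioi_subset_Ici_self))).aestronglyMeasurable measurableSet_Ioi
  · filter_upwards [ae_restrict_mem measurableSet_Ioi] with x hx s hs
    have hx : 0 ≤ x := le_of_lt hx
    have hs := Ioo_subset_Icc_self hs
    rw [norm_mul, norm_mul, Complex.norm_I, one_mul]
    refine (mul_le_of_le_one_left (norm_nonneg _) (norm_exp_neg_I_mul_le hk hx)).trans ?_
    exact (norm_add_le _ _).trans (add_le_add (hdec 4 le_rfl s hs x hx)
      (hdec 2 (by omega) s hs x hx))
  · exact (integrableOn_decay C).add (integrableOn_decay C)
  · filter_upwards [ae_restrict_mem measurableSet_Ioi] with x hx s hs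
    exact (hasDerivAt_time hT hsol hy hx hs).const_mul _

/-- The equation holds only for `0 < t < T`; continuity on the closed interval lets the fundamental
theorem of calculus start from the zero initial data. -/
lemma continuousOn_halfFourier_time (hT : 0 < T) (hy : SmoothUpToBoundary T y)
    (hC : ∀ j : ℕ, j ≤ 4 → ∀ x t : ℝ, 0 < x → 0 ≤ t → t ≤ T →
      ‖iteratedDeriv j (fun ξ => y ξ t) x‖ ≤ C / (1 + x) ^ 2)
    {k : ℂ} (hk : k.im ≤ 0) :
    ContinuousOn (fun t => halfFourier (fun x => y x t) k) (Icc 0 T) := by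
  intro t ht
  refine tendsto_integral_filter_of_dominated_convergence (fun x => C / (1 + x) ^ 2) ?_ ?_
    (integrableOn_decay C) ?_
  · filter_upwards [self_mem_nhdsWithin] with s hs
    exact (integrableOn_halfFourier (continuousOn_jet_left hT hy (j := 0) (by omega) hs)
      (fun x hx => norm_jet_le hT hy hC (by omega) hx hs) hk).aestronglyMeasurable
  · filter_upwards [self_mem_nhdsWithin] with s hs
    filter_upwards [ae_restrict_mem measurableSet_Ioi] with x hx
    have hx : 0 ≤ x := le_of_lt hx
    rw [norm_mul]
    exact (mul_le_of_le_one_left (norm_nonneg _) (norm_exp_neg_I_mul_le hk hx)).trans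
      (norm_jet_le hT hy hC (j := 0) (by omega) hx hs)
  · filter_upwards [ae_restrict_mem measurableSet_Ioi] with x hx
    have hx : 0 ≤ x := le_of_lt hx
    exact (continuousOn_jet_right hT hy (j := 0) (by omega) hx t ht).const_mul _

lemma tTransform_add_mul {a b c d κ : ℂ} {h₀ h₁ h₂ h₃ : ℝ → ℂ} {t : ℝ} (ht : 0 ≤ t)
    (c₀ : ContinuousOn h₀ (Icc 0 t)) (c₁ : ContinuousOn h₁ (Icc 0 t))
    (c₂ : ContinuousOn h₂ (Icc 0 t)) (c₃ : ContinuousOn h₃ (Icc 0 t)) :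
    ∫ s in (0 : ℝ)..t, Complex.exp (κ * s) * (a * h₀ s + b * h₁ s + c * h₂ s + d * h₃ s)
      = a * tTransform h₀ κ t + b * tTransform h₁ κ t + c * tTransform h₂ κ t
        + d * tTransform h₃ κ t := by
  have hi : ∀ (e : ℂ) {h : ℝ → ℂ}, ContinuousOn h (Icc 0 t) →
      IntervalIntegrable (fun s : ℝ => e * (Complex.exp (κ * s) * h s)) volume 0 t := by
    intro e h hh
    rw [← uIcc_of_le ht] at hh
    exact (continuousOn_const.mul (ContinuousOn.mul (by fun_prop) hh)).intervalIntegrable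
  unfold tTransform
  simp only [← intervalIntegral.integral_const_mul]
  rw [← intervalIntegral.integral_add (hi a c₀) (hi b c₁),
    ← intervalIntegral.integral_add ((hi a c₀).add (hi b c₁)) (hi c c₂),
    ← intervalIntegral.integral_add (((hi a c₀).add (hi b c₁)).add (hi c c₂)) (hi d c₃)]
  congr 1 with s
  ring

/-- The global relation. -/
lemma exp_mul_halfFourier_eq (hT : 0 < T) (hsol : IsSolution T g₀ g₁ y)
    (hy : SmoothUpToBoundary T y)
    (hC : ∀ j : ℕ, j ≤ 4 → ∀ x t : ℝ, 0 < x → 0 ≤ t → t ≤ T →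
      ‖iteratedDeriv j (fun ξ => y ξ t) x‖ ≤ C / (1 + x) ^ 2)
    {k : ℂ} (hk : k.im ≤ 0) {t : ℝ} (ht : t ∈ Icc 0 T) :
    Complex.exp (w k * t) * halfFourier (fun x => y x t) k
      = boundaryTransform (fun j s => jet T y j (0, s)) k t := by
  have hsub : Icc 0 t ⊆ Icc 0 T := Icc_subset_Icc_right ht.2
  have hb : ∀ j ≤ 4, ContinuousOn (fun s => jet T y j (0, s)) (Icc 0 t) := fun j hj =>
    (continuousOn_jet_right hT hy hj le_rfl).mono hsub
  have h0 : halfFourier (fun x => y x 0) k = 0 := by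
    refine setIntegral_eq_zero_of_forall_eq_zero fun x hx => ?_
    simp only [hsol.initial x hx, mul_zero]
  have hftc := intervalIntegral.integral_eq_sub_of_hasDerivAt_of_le ht.1
    (f := fun t : ℝ => Complex.exp (w k * t) * halfFourier (fun x => y x t) k)
    (f' := fun s : ℝ => Complex.exp (w k * s) *
      ((-Complex.I) * jet T y 3 (0, s) + k * jet T y 2 (0, s)
        + Complex.I * (k ^ 2 - 1) * jet T y 1 (0, s) + (-k * (k ^ 2 - 1)) * jet T y 0 (0, s)))
    (ContinuousOn.mul (by fun_prop) ((continuousOn_halfFourier_time hT hy hC hk).mono hsub))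
    ?_ ?_
  · simp only [h0, mul_zero, sub_zero] at hftc
    rw [← hftc, tTransform_add_mul ht.1 (hb 3 (by omega)) (hb 2 (by omega)) (hb 1 (by omega))
      (hb 0 (by omega)), boundaryTransform]
    linear_combination (k * tTransform (fun s => jet T y 2 (0, s)) (w k) t
      - k * (k ^ 2 - 1) * tTransform (fun s => jet T y 0 (0, s)) (w k) t) * Complex.I_sq
  · intro s hs
    have hs' : s ∈ Ioo 0 T := ⟨hs.1, hs.2.trans_le ht.2⟩
    have hsc := Ioo_subset_Icc_self hs'
    have h1 : HasDerivAt (fun s : ℝ => w k * s) (w k) s := by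
      simpa using (Complex.ofRealCLM.hasDerivAt (x := s)).const_mul (w k)
    refine (h1.cexp.mul (hasDerivAt_halfFourier_time hT hsol hy hC hk hs')).congr_deriv ?_
    -- Applied four times this turns the right-hand side into `i(k⁴ - k²) ŷ = -w ŷ` plus boundary
    -- values. The integrating factor `e^{wt}` cancels the first term.
    have hstep : ∀ j < 4, halfFourier (fun x => jet T y (j + 1) (x, s)) k
        = -jet T y j (0, s) + Complex.I * k * halfFourier (fun x => jet T y j (x, s)) k :=
      fun j hj => halfFourier_deriv (C := C)
        (continuousOn_jet_left hT hy (by omega) hsc)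
        (fun x hx => norm_jet_le hT hy hC (by omega) hx hsc)
        (continuousOn_jet_left hT hy (by omega) hsc)
        (fun x hx => norm_jet_le hT hy hC (by omega) hx hsc)
        (fun x hx => hasDerivWithinAt_jet hT hy (by omega) hx hsc) hk
    have e0 : halfFourier (fun x => y x s) k = halfFourier (fun x => jet T y 0 (x, s)) k := rfl
    have hI3 : Complex.I ^ 3 = -Complex.I := by rw [pow_succ, Complex.I_sq]; ring
    have hI4 : Complex.I ^ 4 = 1 := Complex.I_pow_four
    have hI5 : Complex.I ^ 5 = Complex.I := by rw [pow_succ, hI4, one_mul]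
    rw [hstep 3 (by omega), hstep 2 (by omega), hstep 1 (by omega), hstep 0 (by omega), e0, w]
    ring_nf
    rw [hI5, hI4, hI3, Complex.I_sq]
    ring
  · refine ContinuousOn.intervalIntegrable ?_
    rw [uIcc_of_le ht.1]
    have := hb 0 (by omega)
    have := hb 1 (by omega)
    have := hb 2 (by omega)
    have := hb 3 (by omega)
    fun_prop

end

/-! ### Contours in the uniformizing variable `k = cosh ζ`

The lines `Im ζ = 0, π/4, π/2, 3π/4, π` are mapped to the ray `[1,∞)`, the right branch of the
hyperbola, the imaginary axis, the left branch of the hyperbola, and the ray `(-∞,-1]`. -/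

noncomputable def rayInt (H : ℂ → ℂ) (b : ℝ) : ℂ :=
  ∫ a in Ioi (0 : ℝ), H (a + b * Complex.I)

/-- The factor `i` of `dζ = i db` is left out here and appears explicitly wherever the side is used.
-/
noncomputable def sideInt (H : ℂ → ℂ) (b₁ b₂ : ℝ) : ℂ :=
  ∫ b in Ioo b₁ b₂, H (b * Complex.I)

/-- The closed half strip `Re ζ ≥ 0`, `b₁ ≤ Im ζ ≤ b₂`. -/
def strip (b₁ b₂ : ℝ) : Set ℂ := {ζ | 0 ≤ ζ.re ∧ ζ.im ∈ Icc b₁ b₂}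

lemma isClosed_strip (b₁ b₂ : ℝ) : IsClosed (strip b₁ b₂) :=
  (isClosed_le continuous_const Complex.continuous_re).inter
    (isClosed_Icc.preimage Complex.continuous_im)

/-- `C / cosh a` is the common majorant for all integrands on the rays; it is at most `2|C| e^{-a}`.
-/
lemma integrableOn_inv_cosh (C : ℝ) : IntegrableOn (fun a => C / Real.cosh a) (Ioi 0) := by
  have h : IntegrableOn (fun a : ℝ => |C| * 2 * Real.exp (-a)) (Ioi 0) :=
    (integrableOn_exp_neg_Ioi 0).const_mul (|C| * 2)
  refine h.mono' (Continuous.aestronglyMeasurable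
    (continuous_const.div Real.continuous_cosh fun a => (Real.cosh_pos a).ne')) ?_
  refine Eventually.of_forall fun a => ?_
  rw [norm_div, Real.norm_eq_abs, Real.norm_eq_abs, abs_of_pos (Real.cosh_pos a), div_le_iff₀ (Real.cosh_pos a),
    Real.cosh_eq]
  have h1 : Real.exp (-a) * Real.exp a = 1 := by rw [← Real.exp_add]; simp
  have h2 : 0 ≤ |C| * (Real.exp (-a) * Real.exp (-a)) := by positivity
  nlinarith [abs_nonneg C]

lemma tendsto_div_cosh (C : ℝ) : Tendsto (fun a => C / Real.cosh a) atTop (𝓝 0) := by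
  have : Tendsto Real.cosh atTop atTop := by
    refine tendsto_atTop_mono (fun a => ?_) (Real.tendsto_exp_atTop.atTop_div_const two_pos)
    rw [Real.cosh_eq]
    linarith [Real.exp_pos (-a)]
  simpa using this.const_div_atTop C

lemma integrableOn_ray {H : ℂ → ℂ} {b₁ b₂ C b : ℝ} (hc : ContinuousOn H (strip b₁ b₂))
    (hb : b ∈ Icc b₁ b₂) (hC : ∀ a : ℝ, 0 < a → ‖H (a + b * Complex.I)‖ ≤ C / Real.cosh a) :
    IntegrableOn (fun a : ℝ => H (a + b * Complex.I)) (Ioi 0) := by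
  refine (integrableOn_inv_cosh C).mono' ?_ ?_
  · refine ContinuousOn.aestronglyMeasurable (hc.comp (by fun_prop) ?_) measurableSet_Ioi
    intro a ha
    have ha : 0 < a := ha
    simpa [strip] using ⟨ha.le, hb⟩
  · filter_upwards [ae_restrict_mem measurableSet_Ioi] with a ha using hC a ha

lemma continuousOn_side {H : ℂ → ℂ} {b₁ b₂ : ℝ} (hc : ContinuousOn H (strip b₁ b₂)) :
    ContinuousOn (fun b : ℝ => H (b * Complex.I)) (Icc b₁ b₂) :=
  hc.comp (by fun_prop) fun b hb => by simpa [strip] using hb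

lemma sideInt_eq {H : ℂ → ℂ} {b₁ b₂ : ℝ} (hb : b₁ ≤ b₂) :
    sideInt H b₁ b₂ = ∫ b in b₁..b₂, H (b * Complex.I) := by
  rw [sideInt, intervalIntegral.integral_of_le hb, integral_Ioc_eq_integral_Ioo]

/-- Cauchy's theorem in a half strip. -/
lemma rayInt_sub_rayInt {H : ℂ → ℂ} {b₁ b₂ C : ℝ} (hb : b₁ ≤ b₂)
    (hc : ContinuousOn H (strip b₁ b₂))
    (hd : DifferentiableOn ℂ H {ζ | 0 < ζ.re ∧ ζ.im ∈ Ioo b₁ b₂})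
    (hC : ∀ a b : ℝ, 0 ≤ a → b ∈ Icc b₁ b₂ → ‖H (a + b * Complex.I)‖ ≤ C / Real.cosh a) :
    rayInt H b₁ - rayInt H b₂ - Complex.I * sideInt H b₁ b₂ = 0 := by
  have hray : ∀ b ∈ Icc b₁ b₂, Tendsto (fun R : ℝ => ∫ a in (0 : ℝ)..R, H (a + b * Complex.I))
      atTop (𝓝 (rayInt H b)) := fun b hb =>
    intervalIntegral_tendsto_integral_Ioi 0
      (integrableOn_ray hc hb fun a ha => hC a b ha.le hb) tendsto_id
  -- The far side of the rectangle has fixed length and an integrand of size `C / cosh R`.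
  have hfar : Tendsto (fun R : ℝ => ∫ b in b₁..b₂, H (R + b * Complex.I)) atTop (𝓝 0) := by
    have := (tendsto_div_cosh C).mul_const |b₂ - b₁|
    rw [zero_mul] at this
    refine squeeze_zero_norm' ?_ this
    filter_upwards [eventually_ge_atTop 0] with R hR
    refine intervalIntegral.norm_integral_le_of_norm_le_const fun b hb' => hC R b hR ?_
    rw [uIoc_of_le hb] at hb'
    exact Ioc_subset_Icc_self hb'
  have hlim := (((hray b₁ ⟨le_rfl, hb⟩).sub (hray b₂ ⟨hb, le_rfl⟩)).add
    (hfar.const_mul Complex.I)).sub_const (Complex.I * sideInt H b₁ b₂)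
  rw [mul_zero, add_zero] at hlim
  refine tendsto_nhds_unique hlim (tendsto_const_nhds.congr' ?_)
  filter_upwards [eventually_gt_atTop 0] with R hR
  have := Complex.integral_boundary_rect_eq_zero_of_continuousOn_of_differentiableOn H
    (b₁ * Complex.I) (R + b₂ * Complex.I) ?_ ?_
  · rw [sideInt_eq hb]
    simp at this
    exact this.symm
  · refine hc.mono ?_
    intro ζ hζ
    simp [Complex.mem_reProdIm, uIcc_of_le hR.le, uIcc_of_le hb] at hζ
    exact ⟨hζ.1.1, hζ.2⟩
  · refine hd.mono ?_
    intro ζ hζ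
    simp [Complex.mem_reProdIm, min_eq_left hR.le, max_eq_right hR.le, min_eq_left hb,
      max_eq_right hb] at hζ
    exact ⟨hζ.1.1, hζ.2⟩

lemma sideInt_add {H : ℂ → ℂ} {b₁ b₂ b₃ : ℝ} (h₁ : b₁ ≤ b₂) (h₂ : b₂ ≤ b₃)
    (hc : ContinuousOn H (strip b₁ b₃)) :
    sideInt H b₁ b₂ + sideInt H b₂ b₃ = sideInt H b₁ b₃ := by
  have hcs := continuousOn_side hc
  rw [sideInt_eq h₁, sideInt_eq h₂, sideInt_eq (h₁.trans h₂)]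
  refine intervalIntegral.integral_add_adjacent_intervals
    (ContinuousOn.intervalIntegrable ?_) (ContinuousOn.intervalIntegrable ?_)
  · rw [uIcc_of_le h₁]; exact hcs.mono (Icc_subset_Icc_right h₂)
  · rw [uIcc_of_le h₂]; exact hcs.mono (Icc_subset_Icc_left h₁)

/-! ### The contour `∂D⁺` -/

/-- Four rays and two vertical sides. The boundary ray `(-∞,-1/√2]` is cut at `-1 = cosh(iπ)`, a
corner of the half strip, which is why there are six pieces instead of five. -/
noncomputable def contourPath : Fin 6 → ℝ → ℂ :=
  ![fun a => a + (Real.pi / 4 : ℝ) * Complex.I,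
    fun a => a + (Real.pi / 2 : ℝ) * Complex.I,
    fun a => a + (3 * Real.pi / 4 : ℝ) * Complex.I,
    fun a => a + (Real.pi : ℝ) * Complex.I,
    fun b => b * Complex.I,
    fun b => b * Complex.I]

noncomputable def contourInterval : Fin 6 → Set ℝ :=
  ![Ioi 0, Ioi 0, Ioi 0, Ioi 0, Ioo (Real.pi / 4) (Real.pi / 2), Ioo (3 * Real.pi / 4) Real.pi]

/-- Orientation with `D⁺` on the left: outwards on the lower ray of each half strip, inwards on its
upper ray, downwards on the side. The last gives `-i` because `dζ = i db`. -/
noncomputable def contourWeight : Fin 6 → ℂ := ![1, -1, 1, -1, -Complex.I, -Complex.I]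

/-- The integral of `H(ζ) dζ` over the preimage of `∂D⁺` under `cosh`. -/
noncomputable def contourInt (H : ℂ → ℂ) : ℂ :=
  ∑ j, contourWeight j * ∫ s in contourInterval j, H (contourPath j s)

/-- The two half strips that `cosh` maps to the closure of `D⁺`. -/
noncomputable def dStrip : Set ℂ :=
  strip (Real.pi / 4) (Real.pi / 2) ∪ strip (3 * Real.pi / 4) Real.pi

/-- Grouped in this way, the contour is the boundary of two half strips, the form in which Cauchy's
theorem applies. -/
lemma contourInt_eq (H : ℂ → ℂ) : contourInt H =
    (rayInt H (Real.pi / 4) - rayInt H (Real.pi / 2)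
      - Complex.I * sideInt H (Real.pi / 4) (Real.pi / 2))
    + (rayInt H (3 * Real.pi / 4) - rayInt H Real.pi
      - Complex.I * sideInt H (3 * Real.pi / 4) Real.pi) := by
  simp only [contourInt, Fin.sum_univ_six, contourWeight, contourInterval, contourPath, rayInt,
    sideInt]
  simp
  ring

lemma measurableSet_contourInterval (j : Fin 6) : MeasurableSet (contourInterval j) := by
  fin_cases j <;> simp [contourInterval]

lemma continuous_contourPath (j : Fin 6) : Continuous (contourPath j) := by
  fin_cases j <;> simp only [contourPath] <;> simp <;> fun_prop

lemma contourPath_mem {j : Fin 6} {s : ℝ} (hs : s ∈ contourInterval j) :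
    contourPath j s ∈ dStrip := by
  have hpi := Real.pi_pos
  fin_cases j
  all_goals
    simp [contourInterval] at hs
    simp [contourPath, dStrip, strip]
  · exact Or.inl ⟨hs.le, by linarith⟩
  · exact Or.inl ⟨hs.le, by linarith⟩
  · exact Or.inr ⟨hs.le, by linarith⟩
  · exact Or.inr ⟨hs.le, by linarith⟩
  · exact Or.inl ⟨hs.1.le, hs.2.le⟩
  · exact Or.inr ⟨hs.1.le, hs.2.le⟩

lemma integrableOn_contour_bound (C : ℝ) (j : Fin 6) :
    IntegrableOn (fun s => C / Real.cosh (contourPath j s).re) (contourInterval j) := by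
  have h1 := integrableOn_inv_cosh C
  fin_cases j <;> simp [contourPath, contourInterval]
  all_goals exact h1

lemma aestronglyMeasurable_contour {H : ℂ → ℂ} (hc : ContinuousOn H dStrip) (j : Fin 6) :
    AEStronglyMeasurable (fun s => H (contourPath j s))
      (volume.restrict (contourInterval j)) :=
  (hc.comp (continuous_contourPath j).continuousOn
    fun _ hs => contourPath_mem hs).aestronglyMeasurable (measurableSet_contourInterval j)

lemma integrableOn_contour {H : ℂ → ℂ} {C : ℝ} (hc : ContinuousOn H dStrip)
    (hC : ∀ j, ∀ s ∈ contourInterval j,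
      ‖H (contourPath j s)‖ ≤ C / Real.cosh (contourPath j s).re) (j : Fin 6) :
    IntegrableOn (fun s => H (contourPath j s)) (contourInterval j) := by
  refine (integrableOn_contour_bound C j).mono' (aestronglyMeasurable_contour hc j) ?_
  filter_upwards [ae_restrict_mem (measurableSet_contourInterval j)] with s hs using hC j s hs

lemma contourInt_sub {H₁ H₂ : ℂ → ℂ}
    (h₁ : ∀ j, IntegrableOn (fun s => H₁ (contourPath j s)) (contourInterval j))
    (h₂ : ∀ j, IntegrableOn (fun s => H₂ (contourPath j s)) (contourInterval j)) :
    contourInt (fun ζ => H₁ ζ - H₂ ζ) = contourInt H₁ - contourInt H₂ := by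
  simp only [contourInt, ← Finset.sum_sub_distrib, ← mul_sub]
  refine Finset.sum_congr rfl fun j _ => ?_
  rw [integral_sub (h₁ j) (h₂ j)]

lemma contourInt_const_mul (c : ℂ) (H : ℂ → ℂ) :
    contourInt (fun ζ => c * H ζ) = c * contourInt H := by
  simp only [contourInt, Finset.mul_sum, integral_const_mul]
  exact Finset.sum_congr rfl fun j _ => by ring

lemma tendsto_contourInt {H : ℕ → ℂ → ℂ} {H' : ℂ → ℂ} {C : ℝ}
    (hc : ∀ n, ContinuousOn (H n) dStrip)
    (hC : ∀ n j, ∀ s ∈ contourInterval j,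
      ‖H n (contourPath j s)‖ ≤ C / Real.cosh (contourPath j s).re)
    (hlim : ∀ ζ, Tendsto (fun n => H n ζ) atTop (𝓝 (H' ζ))) :
    Tendsto (fun n => contourInt (H n)) atTop (𝓝 (contourInt H')) := by
  refine tendsto_finsetSum _ fun j _ => Tendsto.const_mul _ ?_
  refine tendsto_integral_of_dominated_convergence
    (fun s => C / Real.cosh (contourPath j s).re)
    (fun n => aestronglyMeasurable_contour (hc n) j) (integrableOn_contour_bound C j)
    (fun n => ?_) (Eventually.of_forall fun s => hlim _)
  filter_upwards [ae_restrict_mem (measurableSet_contourInterval j)] with s hs using hC n j s hs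

/-- Cauchy's theorem for `D⁺`. -/
lemma contourInt_eq_zero {H : ℂ → ℂ} {C : ℝ}
    (h : ∀ b₁ b₂ : ℝ, (b₁ = Real.pi / 4 ∧ b₂ = Real.pi / 2
        ∨ b₁ = 3 * Real.pi / 4 ∧ b₂ = Real.pi) →
      ContinuousOn H (strip b₁ b₂) ∧ DifferentiableOn ℂ H {ζ | 0 < ζ.re ∧ ζ.im ∈ Ioo b₁ b₂} ∧
      ∀ a b : ℝ, 0 ≤ a → b ∈ Icc b₁ b₂ → ‖H (a + b * Complex.I)‖ ≤ C / Real.cosh a) :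
    contourInt H = 0 := by
  have hpi := Real.pi_pos
  obtain ⟨c1, d1, e1⟩ := h _ _ (Or.inl ⟨rfl, rfl⟩)
  obtain ⟨c2, d2, e2⟩ := h _ _ (Or.inr ⟨rfl, rfl⟩)
  rw [contourInt_eq, rayInt_sub_rayInt (by linarith) c1 d1 e1,
    rayInt_sub_rayInt (by linarith) c2 d2 e2, add_zero]

/-- Deformation of the real line to `∂D⁺`. -/
lemma line_eq_contourInt {H : ℂ → ℂ} {C : ℝ}
    (hc : ContinuousOn H (strip 0 Real.pi))
    (hd : DifferentiableOn ℂ H {ζ | 0 < ζ.re ∧ ζ.im ∈ Ioo 0 Real.pi})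
    (hC : ∀ a b : ℝ, 0 ≤ a → (b ∈ Icc 0 (Real.pi / 4)
      ∨ b ∈ Icc (Real.pi / 2) (3 * Real.pi / 4)) → ‖H (a + b * Complex.I)‖ ≤ C / Real.cosh a) :
    rayInt H 0 - rayInt H Real.pi - Complex.I * sideInt H 0 Real.pi = contourInt H := by
  have hpi := Real.pi_pos
  have hmono : ∀ b₁ b₂ : ℝ, 0 ≤ b₁ → b₂ ≤ Real.pi → strip b₁ b₂ ⊆ strip 0 Real.pi :=
    fun b₁ b₂ h₁ h₂ ζ hζ => ⟨hζ.1, h₁.trans hζ.2.1, hζ.2.2.trans h₂⟩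
  -- The real line bounds all four half strips together. The two that do not belong to `D⁺`
  -- contribute zero, and the additivity of the sides leaves exactly the boundary of the other two.
  have hA := rayInt_sub_rayInt (b₁ := 0) (b₂ := Real.pi / 4) (by linarith)
    (hc.mono (hmono _ _ le_rfl (by linarith)))
    (hd.mono fun ζ hζ => ⟨hζ.1, hζ.2.1, hζ.2.2.trans (by linarith)⟩)
    fun a b ha hb => hC a b ha (Or.inl hb)
  have hB := rayInt_sub_rayInt (b₁ := Real.pi / 2) (b₂ := 3 * Real.pi / 4) (by linarith)
    (hc.mono (hmono _ _ (by linarith) (by linarith)))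
    (hd.mono fun ζ hζ => ⟨hζ.1, by linarith [hζ.2.1], hζ.2.2.trans (by linarith)⟩)
    fun a b ha hb => hC a b ha (Or.inr hb)
  have s1 := sideInt_add (b₁ := 0) (b₂ := Real.pi / 4) (b₃ := Real.pi) (by linarith)
    (by linarith) hc
  have s2 := sideInt_add (b₁ := Real.pi / 4) (b₂ := Real.pi / 2) (b₃ := Real.pi) (by linarith)
    (by linarith) (hc.mono (hmono _ _ (by linarith) le_rfl))
  have s3 := sideInt_add (b₁ := Real.pi / 2) (b₂ := 3 * Real.pi / 4) (b₃ := Real.pi)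
    (by linarith) (by linarith) (hc.mono (hmono _ _ (by linarith) le_rfl))
  rw [contourInt_eq]
  linear_combination hA + hB - Complex.I * (-s1 - s2 - s3)

/-! ### Change of variables -/

/-- One substitution rule for integrability and value; the Jacobian enters through its absolute
value, so orientation signs are absorbed into `G`. -/
lemma image_transfer {φ φ' : ℝ → ℝ} {s t : Set ℝ} (hs : MeasurableSet s)
    (hφ : ∀ a ∈ s, HasDerivAt φ (φ' a) a) (hinj : InjOn φ s) (him : φ '' s = t)
    {F G : ℝ → ℂ} (hG : ∀ a ∈ s, ((|φ' a| : ℝ) : ℂ) * F (φ a) = G a) :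
    (IntegrableOn F t ↔ IntegrableOn G s) ∧ ∫ u in t, F u = ∫ a in s, G a := by
  have hφ' := fun a ha => (hφ a ha).hasDerivWithinAt (s := s)
  have hG' : EqOn (fun a => |φ' a| • F (φ a)) G s := fun a ha => by
    simp only [Complex.real_smul, hG a ha]
  rw [← him]
  constructor
  · rw [integrableOn_image_iff_integrableOn_abs_deriv_smul hs hφ' hinj,
      integrableOn_congr_fun hG' hs]
  · rw [integral_image_eq_integral_abs_deriv_smul hs hφ' hinj, setIntegral_congr_fun hs hG']

lemma cosh_add_mul_I (a b : ℝ) : Complex.cosh (a + b * Complex.I)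
    = (Real.cosh a * Real.cos b : ℝ) + (Real.sinh a * Real.sin b : ℝ) * Complex.I := by
  rw [Complex.cosh_add, Complex.cosh_mul_I, Complex.sinh_mul_I]
  push_cast; ring

lemma sinh_add_mul_I (a b : ℝ) : Complex.sinh (a + b * Complex.I)
    = (Real.sinh a * Real.cos b : ℝ) + (Real.cosh a * Real.sin b : ℝ) * Complex.I := by
  rw [Complex.sinh_add, Complex.cosh_mul_I, Complex.sinh_mul_I]
  push_cast; ring

lemma image_sinh_div {c : ℝ} (hc : 0 < c) : (fun a => Real.sinh a / c) '' Ioi 0 = Ioi 0 := by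
  ext u
  constructor
  · rintro ⟨a, ha, rfl⟩
    exact div_pos (Real.sinh_pos_iff.2 ha) hc
  · intro hu
    have hu : 0 < u := hu
    refine ⟨Real.arsinh (u * c), Real.arsinh_pos_iff.2 (mul_pos hu hc), ?_⟩
    simp [Real.sinh_arsinh, hc.ne']

lemma image_cosh : Real.cosh '' Ioi 0 = Ioi 1 := by
  ext u
  constructor
  · rintro ⟨a, ha, rfl⟩
    exact Real.one_lt_cosh.2 (ne_of_gt ha)
  · intro hu
    have hu : 1 < u := hu
    exact ⟨Real.arcosh u, Real.arcosh_pos hu, Real.cosh_arcosh hu.le⟩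

lemma image_cos {b₁ b₂ : ℝ} (h₁ : 0 ≤ b₁) (h : b₁ ≤ b₂) (h₂ : b₂ ≤ Real.pi) :
    Real.cos '' Ioo b₁ b₂ = Ioo (Real.cos b₂) (Real.cos b₁) := by
  ext u
  constructor
  · rintro ⟨b, hb, rfl⟩
    exact ⟨Real.cos_lt_cos_of_nonneg_of_le_pi (h₁.trans hb.1.le) h₂ hb.2,
      Real.cos_lt_cos_of_nonneg_of_le_pi h₁ (hb.2.le.trans h₂) hb.1⟩
  · intro hu
    have hu1 : u ≤ 1 := hu.2.le.trans (Real.cos_le_one _)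
    have hu2 : -1 ≤ u := (Real.neg_one_le_cos _).trans hu.1.le
    have hcos := Real.cos_arccos hu2 hu1
    refine ⟨Real.arccos u, ⟨?_, ?_⟩, hcos⟩
    · by_contra hc
      have := Real.cos_le_cos_of_nonneg_of_le_pi (Real.arccos_nonneg u) (h.trans h₂) (not_lt.1 hc)
      linarith [hu.2]
    · by_contra hc
      have := Real.cos_le_cos_of_nonneg_of_le_pi (h₁.trans h) (Real.arccos_le_pi u) (not_lt.1 hc)
      linarith [hu.1]

/-- On the side `ζ = ib` one has `dk = -sin b db`, while `H` contains `sinh(ib) = i sin b`; the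
quotient of the two accounts for the `-i`. -/
lemma transfer_cos {b₁ b₂ : ℝ} (h₁ : 0 ≤ b₁) (h : b₁ ≤ b₂) (h₂ : b₂ ≤ Real.pi) {F : ℝ → ℂ}
    {H : ℂ → ℂ} (hH : ∀ b : ℝ, H (b * Complex.I) = F (Real.cos b) * (Real.sin b * Complex.I)) :
    (IntegrableOn F (Ioo (Real.cos b₂) (Real.cos b₁)) ↔
      IntegrableOn (fun b : ℝ => H (b * Complex.I)) (Ioo b₁ b₂)) ∧
    ∫ u in Ioo (Real.cos b₂) (Real.cos b₁), F u = -Complex.I * sideInt H b₁ b₂ := by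
  have key := image_transfer (φ := Real.cos) (φ' := fun b => -Real.sin b) (s := Ioo b₁ b₂)
    (F := F) (G := fun b => -Complex.I * H (b * Complex.I)) measurableSet_Ioo
    (fun b _ => Real.hasDerivAt_cos b)
    (Real.injOn_cos.mono
      ((Ioo_subset_Icc_self).trans (Icc_subset_Icc h₁ h₂))) (image_cos h₁ h h₂)
    (fun b hb => by
      rw [hH, abs_neg, abs_of_nonneg
        (Real.sin_nonneg_of_nonneg_of_le_pi (h₁.trans hb.1.le) (hb.2.le.trans h₂))]
      linear_combination F (Real.cos b) * Real.sin b * Complex.I_sq)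
  rw [key.1, key.2, integral_const_mul, sideInt]
  refine ⟨⟨fun hi => ?_, fun hi => hi.const_mul _⟩, rfl⟩
  refine (hi.const_mul Complex.I).congr (Eventually.of_forall fun b => ?_)
  simp only
  linear_combination -H (b * Complex.I) * Complex.I_sq

lemma transfer_neg_cosh {F : ℝ → ℂ} {H : ℂ → ℂ} (hH : ∀ a : ℝ,
      H (a + (Real.pi : ℝ) * Complex.I) = -(F (-Real.cosh a) * Real.sinh a)) :
    (IntegrableOn F (Iio (-1)) ↔
      IntegrableOn (fun a : ℝ => H (a + (Real.pi : ℝ) * Complex.I)) (Ioi 0)) ∧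
    ∫ u in Iio (-1), F u = -rayInt H Real.pi := by
  have key := image_transfer (φ := fun a => -Real.cosh a) (φ' := fun a => -Real.sinh a)
    (s := Ioi 0) (t := Iio (-1)) (F := F)
    (G := fun a => -H (a + (Real.pi : ℝ) * Complex.I)) measurableSet_Ioi
    (fun a _ => (Real.hasDerivAt_cosh a).neg)
    (fun a ha b hb hab => Real.cosh_strictMonoOn.injOn (Ioi_subset_Ici_self ha)
      (Ioi_subset_Ici_self hb) (neg_injective hab))
    (by
      have : (fun a => -Real.cosh a) '' Ioi 0 = Neg.neg '' (Real.cosh '' Ioi 0) := by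
        rw [image_image]
      rw [this, image_cosh, image_neg_eq_neg]; simp)
    (fun a ha => by
      rw [hH, abs_neg, abs_of_pos (Real.sinh_pos_iff.2 ha)]; ring)
  rw [key.1, key.2, integral_neg, rayInt]
  exact ⟨⟨fun hi => by simpa using hi.neg, fun hi => hi.neg⟩, rfl⟩

lemma transfer_cosh {F : ℝ → ℂ} {H : ℂ → ℂ} (hH : ∀ a : ℝ,
      H (a + (0 : ℝ) * Complex.I) = F (Real.cosh a) * Real.sinh a) :
    ∫ u in Ioi 1, F u = rayInt H 0 :=
  (image_transfer (φ := Real.cosh) (φ' := Real.sinh)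
    (s := Ioi 0) (F := F) measurableSet_Ioi (fun a _ => Real.hasDerivAt_cosh a)
    (Real.cosh_strictMonoOn.injOn.mono Ioi_subset_Ici_self) image_cosh
    (fun a ha => by rw [hH, abs_of_pos (Real.sinh_pos_iff.2 ha)]; ring)).2

/-- The integral over the real line in the uniformizing variable. -/
lemma integral_real_eq {f : ℂ → ℂ} (hf : Integrable fun k : ℝ => f k) :
    ∫ k : ℝ, f k = rayInt (fun ζ => f (Complex.cosh ζ) * Complex.sinh ζ) 0
      - rayInt (fun ζ => f (Complex.cosh ζ) * Complex.sinh ζ) Real.pi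
      - Complex.I * sideInt (fun ζ => f (Complex.cosh ζ) * Complex.sinh ζ) 0 Real.pi := by
  have e1 := (transfer_cos (F := fun k : ℝ => f k) (b₁ := 0) (b₂ := Real.pi)
    (H := fun ζ => f (Complex.cosh ζ) * Complex.sinh ζ) le_rfl Real.pi_pos.le
    le_rfl (fun b => by simp [Complex.cosh_mul_I, Complex.sinh_mul_I])).2
  have e2 := (transfer_neg_cosh (F := fun k : ℝ => f k)
    (H := fun ζ => f (Complex.cosh ζ) * Complex.sinh ζ)
    (fun a => by rw [cosh_add_mul_I, sinh_add_mul_I]; simp)).2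
  have e3 := transfer_cosh (F := fun k : ℝ => f k)
    (H := fun ζ => f (Complex.cosh ζ) * Complex.sinh ζ)
    (fun a => by rw [cosh_add_mul_I, sinh_add_mul_I]; simp)
  rw [Real.cos_pi, Real.cos_zero] at e1
  -- Cut at `-1` and `1`, the images of the corners `iπ` and `0`.
  have s1 := intervalIntegral.integral_Iic_add_Ioi (b := (-1 : ℝ)) (μ := volume)
    hf.integrableOn hf.integrableOn
  have s2 : ∫ k in Ioi (-1 : ℝ), f k = (∫ k in Ioc (-1 : ℝ) 1, f k) + ∫ k in Ioi (1 : ℝ), f k := by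
    rw [← setIntegral_union (by
      rw [Set.disjoint_left]; intro a ha hb; exact absurd ha.2 (not_le.2 hb)) measurableSet_Ioi
      hf.integrableOn hf.integrableOn, Ioc_union_Ioi_eq_Ioi (by norm_num)]
  rw [← s1, s2, integral_Iic_eq_integral_Iio, integral_Ioc_eq_integral_Ioo, e1, e2, e3]
  ring

lemma inv_sqrt_two_sq : (1 / Real.sqrt 2) ^ 2 = 1 / 2 := by
  rw [div_pow, Real.sq_sqrt (by norm_num)]; norm_num

lemma cos_pi_div_four_eq : Real.cos (Real.pi / 4) = 1 / Real.sqrt 2 := by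
  rw [Real.cos_pi_div_four, div_eq_div_iff (by norm_num) (by positivity)]
  norm_num

lemma sin_pi_div_four_eq : Real.sin (Real.pi / 4) = 1 / Real.sqrt 2 := by
  rw [Real.sin_pi_div_four, ← Real.cos_pi_div_four, cos_pi_div_four_eq]

lemma cos_three_pi_div_four : Real.cos (3 * Real.pi / 4) = -(1 / Real.sqrt 2) := by
  rw [show 3 * Real.pi / 4 = Real.pi - Real.pi / 4 by ring, Real.cos_pi_sub, cos_pi_div_four_eq]

lemma sin_three_pi_div_four : Real.sin (3 * Real.pi / 4) = 1 / Real.sqrt 2 := by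
  rw [show 3 * Real.pi / 4 = Real.pi - Real.pi / 4 by ring, Real.sin_pi_sub, sin_pi_div_four_eq]

/-- With height `s = sinh a / √2` the hyperbola has `|Re k| = cosh a / √2`, so its two branches are
the lines `Im ζ = π/4` and `Im ζ = 3π/4`. -/
lemma sqrt_sinh_div_sq (a : ℝ) :
    Real.sqrt ((Real.sinh a / Real.sqrt 2) ^ 2 + 1 / 2) = Real.cosh a / Real.sqrt 2 := by
  have h : (Real.sinh a / Real.sqrt 2) ^ 2 + 1 / 2 = (Real.cosh a / Real.sqrt 2) ^ 2 := by
    rw [div_pow, div_pow, Real.cosh_sq, Real.sq_sqrt (by norm_num)]; ring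
  rw [h, Real.sqrt_sq (div_nonneg (Real.cosh_pos a).le (by positivity))]

lemma transfer_sinh {c : ℝ} (hc : 0 < c) {F G : ℝ → ℂ}
    (hG : ∀ a, ((Real.cosh a / c : ℝ) : ℂ) * F (Real.sinh a / c) = G a) :
    (IntegrableOn F (Ioi 0) ↔ IntegrableOn G (Ioi 0)) ∧
      ∫ u in Ioi 0, F u = ∫ a in Ioi 0, G a :=
  image_transfer (φ := fun a => Real.sinh a / c) (φ' := fun a => Real.cosh a / c)
    measurableSet_Ioi (fun a _ => (Real.hasDerivAt_sinh a).div_const c)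
    (fun a _ b _ hab => Real.sinh_injective ((div_left_inj' hc.ne').1 hab)) (image_sinh_div hc)
    (fun a _ => by rw [abs_of_pos (div_pos (Real.cosh_pos a) hc), hG])

/-- The integral over `∂D⁺` in the uniformizing variable. -/
lemma bdryIntegral_eq_contourInt {f : ℂ → ℂ}
    (hi : ∀ j, IntegrableOn (fun s => f (Complex.cosh (contourPath j s)) *
      Complex.sinh (contourPath j s)) (contourInterval j)) :
    BdryIntegrable f ∧
      bdryIntegral f = contourInt (fun ζ => f (Complex.cosh ζ) * Complex.sinh ζ) := by
  have hpi := Real.pi_pos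
  have h2 : 0 < Real.sqrt 2 := by positivity
  set H : ℂ → ℂ := fun ζ => f (Complex.cosh ζ) * Complex.sinh ζ with hH
  have hd : ∀ j s, bdryIntegrand f j s = f (bdryPath j s) *
      ((![-Complex.I, 1, ((s / Real.sqrt (s ^ 2 + 1 / 2) : ℝ) : ℂ) + Complex.I,
      -((s / Real.sqrt (s ^ 2 + 1 / 2) : ℝ) : ℂ) + Complex.I, 1] : Fin 5 → ℂ) j) := fun j s => by
    rw [bdryIntegrand, (hasDerivAt_bdryPath j s).deriv]
  have d4 : bdryIntegrand f 4 = fun s : ℝ => f s := by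
    ext s; rw [hd]; simp [bdryPath]
  have d1 : bdryIntegrand f 1 = fun s : ℝ => f s := by
    ext s; rw [hd]; simp [bdryPath]
  have hside : ∀ b : ℝ, H (b * Complex.I) =
      f (Real.cos b : ℝ) * (Real.sin b * Complex.I) := fun b => by
    simp [hH, Complex.cosh_mul_I, Complex.sinh_mul_I]
  have k0 : (IntegrableOn (bdryIntegrand f 0) (Iio 0) ↔
      IntegrableOn (fun a : ℝ => -H (a + (Real.pi / 2 : ℝ) * Complex.I)) (Ioi 0)) ∧
      ∫ s in Iio 0, bdryIntegrand f 0 s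
        = ∫ a in Ioi (0 : ℝ), -H (a + (Real.pi / 2 : ℝ) * Complex.I) := by
    refine image_transfer (φ := fun a => -Real.sinh a) (φ' := fun a => -Real.cosh a)
      measurableSet_Ioi (fun a _ => (Real.hasDerivAt_sinh a).neg)
      (fun a _ b _ hab => Real.sinh_injective (neg_injective hab)) ?_ ?_
    · have : (fun a => -Real.sinh a) '' Ioi 0 = Neg.neg '' ((fun a => Real.sinh a / 1) '' Ioi 0) := by
        rw [image_image]; simp
      rw [this, image_sinh_div one_pos, image_neg_eq_neg]; simp
    · intro a _
      rw [hd, abs_neg, abs_of_pos (Real.cosh_pos a)]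
      simp only [hH]
      rw [cosh_add_mul_I, sinh_add_mul_I]
      simp [bdryPath]
      rw [mul_comm (Complex.I) (Complex.sinh a)]
      ring
  have k2 := transfer_sinh h2 (F := bdryIntegrand f 2)
    (G := fun a : ℝ => H (a + (Real.pi / 4 : ℝ) * Complex.I)) (fun a => by
      have hc : (Real.cosh a : ℂ) ≠ 0 := Complex.ofReal_ne_zero.2 (Real.cosh_pos a).ne'
      have hs2 : (Real.sqrt 2 : ℂ) ≠ 0 := Complex.ofReal_ne_zero.2 h2.ne'
      have hp : bdryPath 2 (Real.sinh a / Real.sqrt 2)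
          = Complex.cosh (a + (Real.pi / 4 : ℝ) * Complex.I) := by
        rw [cosh_add_mul_I, cos_pi_div_four_eq, sin_pi_div_four_eq]
        simp only [bdryPath, Matrix.cons_val]
        rw [sqrt_sinh_div_sq]
        push_cast; ring
      rw [hd, hp]
      simp only [hH, Matrix.cons_val]
      rw [sqrt_sinh_div_sq, sinh_add_mul_I, cos_pi_div_four_eq, sin_pi_div_four_eq]
      push_cast at hc ⊢
      field_simp)
  have k3 := transfer_sinh h2 (F := bdryIntegrand f 3)
    (G := fun a : ℝ => H (a + (3 * Real.pi / 4 : ℝ) * Complex.I)) (fun a => by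
      have hc : (Real.cosh a : ℂ) ≠ 0 := Complex.ofReal_ne_zero.2 (Real.cosh_pos a).ne'
      have hs2 : (Real.sqrt 2 : ℂ) ≠ 0 := Complex.ofReal_ne_zero.2 h2.ne'
      have hp : bdryPath 3 (Real.sinh a / Real.sqrt 2)
          = Complex.cosh (a + (3 * Real.pi / 4 : ℝ) * Complex.I) := by
        rw [cosh_add_mul_I, cos_three_pi_div_four, sin_three_pi_div_four]
        simp only [bdryPath, Matrix.cons_val]
        rw [sqrt_sinh_div_sq]
        push_cast; ring
      rw [hd, hp]
      simp only [hH, Matrix.cons_val]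
      rw [sqrt_sinh_div_sq, sinh_add_mul_I, cos_three_pi_div_four, sin_three_pi_div_four]
      push_cast at hc ⊢
      field_simp)
  have k1 := transfer_cos (F := fun k : ℝ => f k) (H := H) (b₁ := Real.pi / 4)
    (b₂ := Real.pi / 2) (by linarith) (by linarith) (by linarith) hside
  have k4 := transfer_cos (F := fun k : ℝ => f k) (H := H) (b₁ := 3 * Real.pi / 4)
    (b₂ := Real.pi) (by linarith) (by linarith) le_rfl hside
  have k5 := transfer_neg_cosh (F := fun k : ℝ => f k) (H := H)
    (fun a => by simp only [hH]; rw [cosh_add_mul_I, sinh_add_mul_I]; simp)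
  rw [Real.cos_pi_div_two, cos_pi_div_four_eq] at k1
  rw [Real.cos_pi, cos_three_pi_div_four] at k4
  -- The boundary paths `0, 1, 2, 3` correspond to the pieces `1, 4, 0, 2`; path `4` is made of the
  -- pieces `3` and `5`.
  have i0 := k0.1.2 (hi 1).neg
  have i1 := k1.1.2 (hi 4)
  have i2 := k2.1.2 (hi 0)
  have i3 := k3.1.2 (hi 2)
  have i4 := k4.1.2 (hi 5)
  have i5 := k5.1.2 (hi 3)
  -- Allows the last path to be cut at `-1`, between the ray `Im ζ = π` and the side `3π/4 < Im ζ <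
  -- π`.
  have hlt : (-1 : ℝ) < -(1 / Real.sqrt 2) := by
    have : 1 / Real.sqrt 2 < 1 := by nlinarith [inv_sqrt_two_sq, sq_nonneg (1 / Real.sqrt 2 - 1)]
    linarith
  have hun := Iic_union_Ioo_eq_Iio hlt
  have i5' := (integrableOn_Iic_iff_integrableOn_Iio (μ := volume)).2 i5
  constructor
  · intro j
    fin_cases j
    · exact i0
    · change IntegrableOn (bdryIntegrand f 1) _; rw [d1]; exact i1
    · exact i2
    · exact i3
    · change IntegrableOn (bdryIntegrand f 4) (Iio (-(1 / Real.sqrt 2)))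
      rw [d4, ← hun]; exact i5'.union i4
  · have e4 : ∫ s in Iio (-(1 / Real.sqrt 2)), bdryIntegrand f 4 s
        = -rayInt H Real.pi + -Complex.I * sideInt H (3 * Real.pi / 4) Real.pi := by
      rw [d4, ← hun, setIntegral_union _ measurableSet_Ioo i5' i4,
        integral_Iic_eq_integral_Iio, k5.2, k4.2]
      rw [Set.disjoint_left]; intro a ha hb; exact absurd hb.1 (not_lt.2 ha)
    rw [contourInt_eq, bdryIntegral, Fin.sum_univ_five]
    change (∫ s in Iio 0, bdryIntegrand f 0 s)
      + (∫ s in Ioo 0 (1 / Real.sqrt 2), bdryIntegrand f 1 s)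
      + (∫ s in Ioi 0, bdryIntegrand f 2 s) + (∫ s in Ioi 0, bdryIntegrand f 3 s)
      + (∫ s in Iio (-(1 / Real.sqrt 2)), bdryIntegrand f 4 s) = _
    rw [e4, k0.2, k2.2, k3.2, d1, k1.2, integral_neg]
    simp only [rayInt]
    ring

/-! ### A regularized Fourier inversion formula -/

/-- The density of the gamma distribution of shape `5` and rate `1`. -/
noncomputable def gammaDensity (u : ℝ) : ℝ := (max u 0) ^ 4 * Real.exp (-u) / 24

/-- The regularizing factor, the Fourier transform of a rescaled gamma density. -/
noncomputable def regularizer (r : ℝ) (k : ℂ) : ℂ := ((1 - Complex.I * k / r) ^ 5)⁻¹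

lemma continuous_gammaDensity : Continuous gammaDensity := by
  unfold gammaDensity; fun_prop

lemma gammaDensity_nonneg (u : ℝ) : 0 ≤ gammaDensity u := by
  unfold gammaDensity; positivity

lemma gammaDensity_of_nonpos {u : ℝ} (hu : u ≤ 0) : gammaDensity u = 0 := by
  simp [gammaDensity, max_eq_right hu]

lemma integrable_gammaDensity : Integrable gammaDensity := by
  have h1 : IntegrableOn gammaDensity (Ioi 0) := by
    have := (Real.GammaIntegral_convergent (s := 5) (by norm_num)).div_const 24
    refine (integrableOn_congr_fun (fun u hu => ?_) measurableSet_Ioi).1 this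
    have hu : 0 < u := hu
    simp only [gammaDensity, max_eq_left hu.le]
    rw [show (5 : ℝ) - 1 = (4 : ℕ) by norm_num, Real.rpow_natCast]
    ring
  have h2 : IntegrableOn gammaDensity (Iic 0) :=
    (integrableOn_zero (μ := volume) (s := Iic (0 : ℝ))).congr_fun
      (fun u hu => (gammaDensity_of_nonpos hu).symm) measurableSet_Iic
  have := h2.union h1
  rwa [Iic_union_Ioi, integrableOn_univ] at this

lemma one_sub_I_mul_ne_zero (τ : ℝ) : (1 - Complex.I * τ : ℂ) ≠ 0 := by
  intro h
  have := congrArg Complex.re h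
  simp at this

/-- For `u > 0` the integrand is `e^{-cu} u⁴/24` with `c = 1 - iτ`. Repeated integration by parts
gives the antiderivative used below, which vanishes at infinity because `Re c = 1`. -/
lemma integral_exp_mul_gammaDensity (τ : ℝ) :
    ∫ u : ℝ, Complex.exp (Complex.I * τ * u) * gammaDensity u
      = ((1 - Complex.I * τ) ^ 5)⁻¹ := by
  set c : ℂ := 1 - Complex.I * τ with hc
  have hc0 : c ≠ 0 := one_sub_I_mul_ne_zero τ
  have hn : ∀ u : ℝ, ‖Complex.exp (-(c * u))‖ = Real.exp (-u) := fun u => by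
    rw [Complex.norm_exp]; simp [hc]
  have hint : Integrable (fun u : ℝ => Complex.exp (Complex.I * τ * u) * gammaDensity u) := by
    refine integrable_gammaDensity.ofReal.bdd_mul (c := 1)
      (Continuous.aestronglyMeasurable (by fun_prop)) (Eventually.of_forall fun u => ?_)
    rw [Complex.norm_exp]; simp
  have e1 : ∀ u : ℝ, 0 < u → Complex.exp (Complex.I * τ * u) * gammaDensity u
      = Complex.exp (-(c * u)) * (u ^ 4 / 24) := fun u hu => by
    simp only [gammaDensity, max_eq_left hu.le]
    push_cast
    rw [show -(c * u) = Complex.I * τ * u + -u by rw [hc]; ring, Complex.exp_add]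
    ring
  have e2 : ∫ u : ℝ, Complex.exp (Complex.I * τ * u) * gammaDensity u
      = ∫ u in Ioi (0 : ℝ), Complex.exp (Complex.I * τ * u) * gammaDensity u := by
    refine (setIntegral_eq_integral_of_forall_compl_eq_zero fun u hu => ?_).symm
    rw [gammaDensity_of_nonpos (not_lt.1 hu)]; simp
  have hF := integral_Ioi_of_hasDerivAt_of_tendsto (a := (0 : ℝ)) (m := (0 : ℂ))
    (f := fun u : ℝ => -(Complex.exp (-(c * u)) *
      (u ^ 4 / (24 * c) + u ^ 3 / (6 * c ^ 2) + u ^ 2 / (2 * c ^ 3) + u / c ^ 4 + 1 / c ^ 5)))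
    (f' := fun u : ℝ => Complex.exp (Complex.I * τ * u) * gammaDensity u)
    (Continuous.continuousWithinAt (by fun_prop)) ?_ hint.integrableOn ?_
  · rw [e2, hF]
    simp
  · intro u hu
    rw [e1 u hu]
    have h1 : HasDerivAt (fun u : ℝ => (u : ℂ)) 1 u := by
      simpa using (hasDerivAt_id u).ofReal_comp
    have h2 := (h1.const_mul c).neg.cexp
    have h3 := (((((h1.pow 4).div_const (24 * c)).add ((h1.pow 3).div_const (6 * c ^ 2))).add
      ((h1.pow 2).div_const (2 * c ^ 3))).add (h1.div_const (c ^ 4))).add_const (1 / c ^ 5)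
    refine ((h2.mul h3).neg).congr_deriv ?_
    simp
    field_simp
    ring
  · have hp : ∀ n : ℕ, Tendsto (fun u : ℝ => Complex.exp (-(c * u)) * (u : ℂ) ^ n) atTop
        (𝓝 0) := fun n => by
      refine squeeze_zero_norm' ?_ (Real.tendsto_pow_mul_exp_neg_atTop_nhds_zero n)
      filter_upwards [eventually_ge_atTop 0] with u hu
      rw [norm_mul, hn, norm_pow, Complex.norm_real, Real.norm_of_nonneg hu, mul_comm]
    have := ((((((hp 4).div_const (24 * c)).add ((hp 3).div_const (6 * c ^ 2))).add
      ((hp 2).div_const (2 * c ^ 3))).add ((hp 1).div_const (c ^ 4))).add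
      ((hp 0).div_const (c ^ 5))).neg
    simp only [zero_div, add_zero, neg_zero] at this
    refine this.congr fun u => ?_
    ring

lemma norm_one_sub_I_mul_sq (τ : ℝ) : ‖(1 - Complex.I * τ : ℂ)‖ ^ 2 = 1 + τ ^ 2 := by
  rw [← Complex.normSq_eq_norm_sq, Complex.normSq_apply]; simp; ring

lemma integrable_inv_one_sub_pow :
    Integrable fun τ : ℝ => ((1 - Complex.I * τ : ℂ) ^ 5)⁻¹ := by
  refine integrable_inv_one_add_sq.mono' (Continuous.aestronglyMeasurable
    (Continuous.inv₀ (by fun_prop) fun τ => pow_ne_zero _ (one_sub_I_mul_ne_zero τ)))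
    (Eventually.of_forall fun τ => ?_)
  rw [norm_inv, norm_pow, ← norm_one_sub_I_mul_sq]
  have h1 : 1 ≤ ‖(1 - Complex.I * τ : ℂ)‖ := by
    nlinarith [norm_one_sub_I_mul_sq τ, norm_nonneg (1 - Complex.I * τ : ℂ), sq_nonneg τ]
  gcongr
  norm_num

lemma integrable_regularizer {r : ℝ} (hr : 0 < r) :
    Integrable fun k : ℝ => regularizer r k := by
  refine (integrable_inv_one_sub_pow.comp_div hr.ne').congr (Eventually.of_forall fun k => ?_)
  simp [regularizer, mul_div_assoc]

-- No residues are needed: the regularizer is by construction the transform of a rescaled gamma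
-- density, which is continuous and integrable with integrable transform, so Fourier inversion
-- applies.
open FourierTransform in
lemma integral_exp_mul_regularizer {r : ℝ} (hr : 0 < r) (v : ℝ) :
    ∫ k : ℝ, Complex.exp (-Complex.I * k * v) * regularizer r k
      = 2 * Real.pi * (r * gammaDensity (r * v) : ℝ) := by
  have hpi := Real.pi_pos
  have hF : ∀ ξ : ℝ, 𝓕 (fun u : ℝ => (gammaDensity u : ℂ)) ξ
      = ((1 - Complex.I * (-(2 * Real.pi) * ξ : ℝ)) ^ 5)⁻¹ := fun ξ => by
    rw [Real.fourier_real_eq_integral_exp_smul, ← integral_exp_mul_gammaDensity]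
    congr 1 with u
    rw [smul_eq_mul]
    congr 2
    push_cast; ring
  have hFi : Integrable (𝓕 (fun u : ℝ => (gammaDensity u : ℂ))) := by
    have := integrable_inv_one_sub_pow.comp_mul_left' (R := -(2 * Real.pi))
      (neg_ne_zero.2 (by positivity))
    exact this.congr (Eventually.of_forall fun ξ => (hF ξ).symm)
  have hinv := Continuous.fourierInv_fourier_eq (f := fun u : ℝ => (gammaDensity u : ℂ))
    (Complex.continuous_ofReal.comp continuous_gammaDensity) integrable_gammaDensity.ofReal hFi
  have h1 := congrFun hinv (r * v)
  rw [Real.fourierInv_eq'] at h1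
  -- The substitution `k = -2πrξ` matches the normalization of `𝓕` and the scale `r`.
  have h2 := Measure.integral_comp_mul_left
    (fun k : ℝ => Complex.exp (-Complex.I * k * v) * regularizer r k) (-(2 * Real.pi * r))
  have h3 : ∀ ξ : ℝ, Complex.exp (-Complex.I * (-(2 * Real.pi * r) * ξ : ℝ) * v)
      * regularizer r (-(2 * Real.pi * r) * ξ : ℝ)
      = Complex.exp (((2 * Real.pi * inner ℝ ξ (r * v) : ℝ) : ℂ) * Complex.I)
        • 𝓕 (fun u : ℝ => (gammaDensity u : ℂ)) ξ := fun ξ => by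
    rw [hF, smul_eq_mul, regularizer]
    have hr' : (r : ℂ) ≠ 0 := Complex.ofReal_ne_zero.2 hr.ne'
    congr 2
    · simp; ring
    · push_cast; field_simp
  simp only [h3] at h2
  rw [h1, abs_inv, abs_neg, abs_of_pos (by positivity : 0 < 2 * Real.pi * r),
    eq_inv_smul_iff₀ (by positivity)] at h2
  rw [← h2, Complex.real_smul]
  push_cast; ring

/-- Fubini, legitimate because the regularizer is integrable on the real line; the inner
`k`-integral is the gamma kernel. Thus regularized inversion is averaging. -/
lemma integral_regularizer_mul_halfFourier {r : ℝ} (hr : 0 < r) {f : ℝ → ℂ}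
    (hf : IntegrableOn f (Ioi 0)) (x : ℝ) :
    ∫ k : ℝ, Complex.exp (Complex.I * k * x) * regularizer r k * halfFourier f k
      = 2 * Real.pi * ∫ ξ in Ioi 0, ((r * gammaDensity (r * (ξ - x)) : ℝ) : ℂ) * f ξ := by
  have hprod : Integrable (fun p : ℝ × ℝ => Complex.exp (Complex.I * p.1 * (x - p.2)) *
      (regularizer r p.1 * f p.2)) (volume.prod (volume.restrict (Ioi 0))) := by
    refine ((integrable_regularizer hr).mul_prod hf).bdd_mul (c := 1)
      (Continuous.aestronglyMeasurable (by fun_prop)) (Eventually.of_forall fun p => ?_)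
    rw [Complex.norm_exp]; simp
  have hswap := integral_integral_swap (f := fun (k ξ : ℝ) =>
    Complex.exp (Complex.I * k * (x - ξ)) * (regularizer r k * f ξ)) hprod
  have hL : ∀ k : ℝ, Complex.exp (Complex.I * k * x) * regularizer r k * halfFourier f k
      = ∫ ξ in Ioi (0 : ℝ), Complex.exp (Complex.I * k * (x - ξ)) * (regularizer r k * f ξ) := by
    intro k
    rw [halfFourier, ← integral_const_mul]
    congr 1 with ξ
    rw [show Complex.I * k * (x - ξ) = Complex.I * k * x + -Complex.I * k * ξ by ring,
      Complex.exp_add]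
    ring
  simp_rw [hL]
  rw [hswap, ← integral_const_mul]
  congr 1 with ξ
  rw [← mul_assoc, ← integral_exp_mul_regularizer hr (ξ - x), ← integral_mul_const]
  congr 1 with k
  rw [show Complex.I * k * (x - ξ) = -Complex.I * k * ((ξ - x : ℝ) : ℂ) by push_cast; ring]
  ring

lemma integral_gammaDensity : ∫ u : ℝ, (gammaDensity u : ℂ) = 1 := by
  simpa using integral_exp_mul_gammaDensity 0

/-- An approximate identity: with `ξ = x + u/r` the integral becomes an average of `f` at points
tending to `x`, against the fixed density of total mass one. -/
lemma tendsto_integral_gammaDensity {f : ℝ → ℂ} {C : ℝ} (hf : ContinuousOn f (Ioi 0))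
    (hC : ∀ x, 0 < x → ‖f x‖ ≤ C) {x : ℝ} (hx : 0 < x) :
    Tendsto (fun n : ℕ => ∫ ξ in Ioi (0 : ℝ),
      ((((n + 1 : ℝ)) * gammaDensity ((n + 1 : ℝ) * (ξ - x)) : ℝ) : ℂ) * f ξ) atTop (𝓝 (f x)) := by
  have hC0 : 0 ≤ C := (norm_nonneg _).trans (hC x hx)
  -- The extension by zero stays bounded and is continuous at `x > 0`, and it turns the integral
  -- into one over the whole line.
  set F : ℝ → ℂ := indicator (Ioi 0) f with hF
  have hFm : AEStronglyMeasurable F volume :=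
    (aestronglyMeasurable_indicator_iff measurableSet_Ioi).2
      (hf.aestronglyMeasurable measurableSet_Ioi)
  have hFb : ∀ ξ, ‖F ξ‖ ≤ C := fun ξ => by
    by_cases h : ξ ∈ Ioi (0 : ℝ)
    · rw [hF, indicator_of_mem h]; exact hC ξ h
    · rw [hF, indicator_of_notMem h, norm_zero]; exact hC0
  have hFx : F x = f x := indicator_of_mem (s := Ioi (0 : ℝ)) hx f
  have hFc : ContinuousAt F x := by
    refine (hf.continuousAt (Ioi_mem_nhds hx)).congr ?_
    filter_upwards [Ioi_mem_nhds hx] with ξ hξ using (indicator_of_mem hξ f).symm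
  have key : ∀ n : ℕ, ∫ ξ in Ioi (0 : ℝ),
      ((((n + 1 : ℝ)) * gammaDensity ((n + 1 : ℝ) * (ξ - x)) : ℝ) : ℂ) * f ξ
      = ∫ u : ℝ, (gammaDensity u : ℂ) * F (x + u / (n + 1 : ℝ)) := fun n => by
    have hr : (0 : ℝ) < n + 1 := by positivity
    set r : ℝ := n + 1
    have h1 := Measure.integral_comp_mul_left
      (fun u : ℝ => (gammaDensity u : ℂ) * F (x + u / r)) r
    have h2 := integral_sub_right_eq_self
      (fun ξ : ℝ => (gammaDensity (r * ξ) : ℂ) * F (x + r * ξ / r)) x (μ := volume)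
    rw [abs_of_pos (inv_pos.2 hr), ← h2, eq_inv_smul_iff₀ hr.ne', Complex.real_smul,
      ← integral_const_mul] at h1
    rw [← h1, ← integral_indicator measurableSet_Ioi]
    congr 1 with ξ
    rw [mul_div_cancel_left₀ _ hr.ne', add_sub_cancel, hF]
    by_cases h : ξ ∈ Ioi (0 : ℝ)
    · rw [indicator_of_mem h, indicator_of_mem h]; push_cast; ring
    · rw [indicator_of_notMem h, indicator_of_notMem h]; simp
  simp_rw [key]
  have hlim : ∫ u : ℝ, (gammaDensity u : ℂ) * f x = f x := by
    rw [integral_mul_const, integral_gammaDensity, one_mul]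
  rw [← hlim]
  refine tendsto_integral_of_dominated_convergence (fun u => gammaDensity u * C)
    (fun n => ?_) (integrable_gammaDensity.mul_const C) (fun n => ?_) ?_
  · refine (Complex.continuous_ofReal.comp
      continuous_gammaDensity).aestronglyMeasurable.mul ?_
    have hr : (n + 1 : ℝ) ≠ 0 := by positivity
    refine hFm.comp_quasiMeasurePreserving ?_
    have h1 : Measure.QuasiMeasurePreserving (fun u : ℝ => u / (n + 1 : ℝ)) volume volume := by
      refine ⟨by fun_prop, ?_⟩
      simp_rw [div_eq_inv_mul]
      rw [Real.map_volume_mul_left (inv_ne_zero hr)]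
      exact Measure.smul_absolutelyContinuous
    exact (measurePreserving_add_left volume x).quasiMeasurePreserving.comp h1
  · refine Eventually.of_forall fun u => ?_
    rw [norm_mul, Complex.norm_real, Real.norm_of_nonneg (gammaDensity_nonneg u)]
    exact mul_le_mul_of_nonneg_left (hFb _) (gammaDensity_nonneg u)
  · refine Eventually.of_forall fun u => Tendsto.const_mul _ ?_
    rw [← hFx]
    refine hFc.tendsto.comp ?_
    have h0 : Tendsto (fun n : ℕ => u * (1 / ((n : ℝ) + 1))) atTop (𝓝 (u * 0)) :=
      tendsto_one_div_add_atTop_nhds_zero_nat.const_mul u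
    have := h0.const_add x
    simpa [div_eq_mul_inv] using this

/-! ### Estimates in the uniformizing variable -/

section
variable {a b : ℝ}

lemma cosh_re (a b : ℝ) :
    (Complex.cosh (a + b * Complex.I)).re = Real.cosh a * Real.cos b := by
  rw [cosh_add_mul_I, Complex.add_re, Complex.re_ofReal_mul, Complex.ofReal_re, Complex.I_re,
    mul_zero, add_zero]

lemma cosh_im (a b : ℝ) :
    (Complex.cosh (a + b * Complex.I)).im = Real.sinh a * Real.sin b := by
  rw [cosh_add_mul_I, Complex.add_im, Complex.im_ofReal_mul, Complex.ofReal_im, Complex.I_im,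
    mul_one, zero_add]

lemma sinh_re (a b : ℝ) :
    (Complex.sinh (a + b * Complex.I)).re = Real.sinh a * Real.cos b := by
  rw [sinh_add_mul_I, Complex.add_re, Complex.re_ofReal_mul, Complex.ofReal_re, Complex.I_re,
    mul_zero, add_zero]

lemma sinh_im (a b : ℝ) :
    (Complex.sinh (a + b * Complex.I)).im = Real.cosh a * Real.sin b := by
  rw [sinh_add_mul_I, Complex.add_im, Complex.im_ofReal_mul, Complex.ofReal_im, Complex.I_im,
    mul_one, zero_add]

lemma norm_cosh_sq (a b : ℝ) : ‖Complex.cosh (a + b * Complex.I)‖ ^ 2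
    = Real.sinh a ^ 2 + Real.cos b ^ 2 := by
  rw [← Complex.normSq_eq_norm_sq, Complex.normSq_apply, cosh_re, cosh_im]
  linear_combination Real.cos b ^ 2 * Real.cosh_sq a
    + Real.sinh a ^ 2 * Real.sin_sq_add_cos_sq b

lemma norm_sinh_sq (a b : ℝ) : ‖Complex.sinh (a + b * Complex.I)‖ ^ 2
    = Real.sinh a ^ 2 + Real.sin b ^ 2 := by
  rw [← Complex.normSq_eq_norm_sq, Complex.normSq_apply, sinh_re, sinh_im]
  linear_combination Real.sin b ^ 2 * Real.cosh_sq a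
    + Real.sinh a ^ 2 * Real.sin_sq_add_cos_sq b

lemma norm_cosh_le (a b : ℝ) : ‖Complex.cosh (a + b * Complex.I)‖ ≤ Real.cosh a := by
  refine abs_le_of_sq_le_sq' ?_ (Real.cosh_pos a).le |>.2
  rw [norm_cosh_sq, Real.cosh_sq]
  linarith [Real.cos_sq_le_one b]

lemma norm_sinh_le (a b : ℝ) : ‖Complex.sinh (a + b * Complex.I)‖ ≤ Real.cosh a := by
  refine abs_le_of_sq_le_sq' ?_ (Real.cosh_pos a).le |>.2
  rw [norm_sinh_sq, Real.cosh_sq]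
  linarith [Real.sin_sq_le_one b]

/-- Since `w(cosh ζ) = -i cosh² ζ sinh² ζ = -(i/8)(cosh 4ζ - 1)`, the right-hand side is `(1/8) sinh
4a sin 4b`. For `a ≥ 0` the sign of `Re w` is read off from `sin 4b`. -/
lemma w_cosh_re (a b : ℝ) : (w (Complex.cosh (a + b * Complex.I))).re
    = 2 * (Real.cosh a * Real.sinh a) * (Real.sin b * Real.cos b) * Real.cos (2 * b)
      * (Real.cosh a ^ 2 + Real.sinh a ^ 2) := by
  rw [w_re, cosh_re, cosh_im, Real.cos_two_mul]
  have h1 := Real.cosh_sq a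
  have h2 := Real.sin_sq b
  linear_combination (-4 * (Real.cosh a * Real.sinh a) * (Real.sin b * Real.cos b)
    * Real.sinh a ^ 2) * h2 + (2 * (Real.cosh a * Real.sinh a) * (Real.sin b * Real.cos b)) * h1

lemma w_cosh_re_nonneg (ha : 0 ≤ a) (h : 0 ≤ Real.sin b * Real.cos b * Real.cos (2 * b)) :
    0 ≤ (w (Complex.cosh (a + b * Complex.I))).re := by
  rw [w_cosh_re]
  have h1 : 0 ≤ Real.cosh a * Real.sinh a :=
    mul_nonneg (Real.cosh_pos a).le (Real.sinh_nonneg_iff.2 ha)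
  have := mul_nonneg (mul_nonneg h1 h) (by positivity : 0 ≤ Real.cosh a ^ 2 + Real.sinh a ^ 2)
  linarith

lemma w_cosh_re_nonpos (ha : 0 ≤ a) (h : Real.sin b * Real.cos b * Real.cos (2 * b) ≤ 0) :
    (w (Complex.cosh (a + b * Complex.I))).re ≤ 0 := by
  rw [w_cosh_re]
  have h1 : 0 ≤ Real.cosh a * Real.sinh a :=
    mul_nonneg (Real.cosh_pos a).le (Real.sinh_nonneg_iff.2 ha)
  have := mul_nonneg (mul_nonneg h1 (neg_nonneg.2 h))
    (by positivity : 0 ≤ Real.cosh a ^ 2 + Real.sinh a ^ 2)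
  linarith

/-- On the lines that are deformed away from `D⁺`, `Re w ≥ 0`. -/
lemma w_re_nonneg_of_mem (ha : 0 ≤ a)
    (hb : b ∈ Icc 0 (Real.pi / 4) ∨ b ∈ Icc (Real.pi / 2) (3 * Real.pi / 4)) :
    0 ≤ (w (Complex.cosh (a + b * Complex.I))).re := by
  have hpi := Real.pi_pos
  refine w_cosh_re_nonneg ha ?_
  rcases hb with ⟨h1, h2⟩ | ⟨h1, h2⟩
  · exact mul_nonneg (mul_nonneg (Real.sin_nonneg_of_nonneg_of_le_pi h1 (by linarith))
      (Real.cos_nonneg_of_mem_Icc ⟨by linarith, by linarith⟩))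
      (Real.cos_nonneg_of_mem_Icc ⟨by linarith, by linarith⟩)
  · exact mul_nonneg_of_nonpos_of_nonpos (mul_nonpos_of_nonneg_of_nonpos
      (Real.sin_nonneg_of_nonneg_of_le_pi (by linarith) (by linarith))
      (Real.cos_nonpos_of_pi_div_two_le_of_le h1 (by linarith)))
      (Real.cos_nonpos_of_pi_div_two_le_of_le (by linarith) (by linarith))

/-- The only zero is `k = -ir`, in the lower half plane. -/
lemma one_sub_I_mul_div_ne_zero {r : ℝ} (hr : 0 < r) {k : ℂ} (hk : 0 ≤ k.im) :
    1 - Complex.I * k / r ≠ 0 := by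
  intro h
  have h1 := congrArg Complex.re h
  have h2 : (Complex.I * k / r).re = -k.im / r := by
    rw [Complex.div_ofReal_re]; simp
  rw [Complex.sub_re, h2, Complex.one_re, Complex.zero_re] at h1
  have : 0 ≤ k.im / r := by positivity
  rw [neg_div] at h1
  linarith

lemma norm_one_sub_I_mul_div_sq {r : ℝ} (hr : 0 < r) (k : ℂ) :
    ‖1 - Complex.I * k / r‖ ^ 2 = 1 + 2 * (k.im / r) + ‖k‖ ^ 2 / r ^ 2 := by
  rw [← Complex.normSq_eq_norm_sq, ← Complex.normSq_eq_norm_sq, Complex.normSq_apply,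
    Complex.normSq_apply, Complex.sub_re, Complex.sub_im, Complex.div_ofReal_re,
    Complex.div_ofReal_im]
  simp
  field_simp
  ring

/-- Uniform in `r`: this is the bound for the limit `r → ∞`. -/
lemma norm_regularizer_le_one {r : ℝ} (hr : 0 < r) {k : ℂ} (hk : 0 ≤ k.im) :
    ‖regularizer r k‖ ≤ 1 := by
  rw [regularizer, norm_inv, norm_pow]
  have h1 : 1 ≤ ‖1 - Complex.I * k / r‖ := by
    refine (one_le_sq_iff₀ (norm_nonneg _)).1 ?_
    rw [norm_one_sub_I_mul_div_sq hr]
    have : 0 ≤ k.im / r := by positivity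
    have : 0 ≤ ‖k‖ ^ 2 / r ^ 2 := by positivity
    linarith
  exact inv_le_one_of_one_le₀ (one_le_pow₀ h1)

/-- Decay for fixed `r`, with a constant that blows up with `r`; it serves only the contour
deformations. -/
lemma norm_regularizer_cosh_le {r : ℝ} (hr : 1 ≤ r) (ha : 0 ≤ a) (hb : 0 ≤ Real.sin b) :
    ‖regularizer r (Complex.cosh (a + b * Complex.I))‖ ≤ r ^ 5 / Real.cosh a ^ 5 := by
  have hr0 : 0 < r := by linarith
  have hc := Real.cosh_pos a
  have h1 : Real.cosh a / r ≤ ‖1 - Complex.I * Complex.cosh (a + b * Complex.I) / r‖ := by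
    refine abs_le_of_sq_le_sq' ?_ (norm_nonneg _) |>.2
    rw [norm_one_sub_I_mul_div_sq hr0, norm_cosh_sq, cosh_im, div_pow, Real.cosh_sq, add_div,
      add_div]
    have e1 : 0 ≤ Real.sinh a * Real.sin b / r :=
      div_nonneg (mul_nonneg (Real.sinh_nonneg_iff.2 ha) hb) hr0.le
    have e2 : 0 ≤ Real.cos b ^ 2 / r ^ 2 := by positivity
    have e3 : 1 / r ^ 2 ≤ 1 := by
      rw [div_le_one (by positivity)]; exact one_le_pow₀ hr
    linarith
  rw [regularizer, norm_inv, norm_pow, ← div_pow,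
    show r / Real.cosh a = (Real.cosh a / r)⁻¹ by rw [inv_div], inv_pow]
  gcongr

lemma differentiableAt_regularizer {r : ℝ} (hr : 0 < r) {k : ℂ} (hk : 0 ≤ k.im) :
    DifferentiableAt ℂ (regularizer r) k := by
  unfold regularizer
  exact DifferentiableAt.inv (by fun_prop) (pow_ne_zero _ (one_sub_I_mul_div_ne_zero hr hk))

lemma norm_exp_I_mul_le_one {k : ℂ} (hk : 0 ≤ k.im) {x : ℝ} (hx : 0 ≤ x) :
    ‖Complex.exp (Complex.I * k * x)‖ ≤ 1 := by
  rw [Complex.norm_exp]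
  refine Real.exp_le_one_iff.2 ?_
  simp
  positivity

end

/-! ### The invariance map -/

lemma nuStrip_sq {σ : ℝ} (hσ : σ ^ 2 = 1) (ζ : ℂ) :
    (σ * Complex.I * Complex.sinh ζ) ^ 2 = 1 - Complex.cosh ζ ^ 2 := by
  have h : (σ : ℂ) ^ 2 = 1 := by exact_mod_cast hσ
  rw [mul_pow, mul_pow, h, Complex.I_sq, Complex.cosh_sq]; ring

/-- Already `|Re(ν - k)| = cosh a |σ sin b + cos b|` suffices, since `(σ sin b + cos b)² = 1 + 2σ
sin b cos b ≥ 1`. Hence the quotients arising in the elimination have no poles and are bounded. -/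
lemma cosh_le_norm_nu_sub {σ a b : ℝ} (hσ : σ ^ 2 = 1) (hb : 0 ≤ Real.sin b)
    (hb' : 0 ≤ σ * Real.cos b) :
    Real.cosh a ≤ ‖σ * Complex.I * Complex.sinh (a + b * Complex.I)
      - Complex.cosh (a + b * Complex.I)‖ := by
  refine le_trans ?_ (Complex.abs_re_le_norm _)
  have hre : (σ * Complex.I * Complex.sinh (a + b * Complex.I)
      - Complex.cosh (a + b * Complex.I)).re = -(Real.cosh a * (σ * Real.sin b + Real.cos b)) := by
    rw [Complex.sub_re, cosh_re, mul_assoc, Complex.re_ofReal_mul, Complex.I_mul_re, sinh_im]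
    ring
  rw [hre, abs_neg, abs_mul, abs_of_pos (Real.cosh_pos a)]
  refine le_mul_of_one_le_right (Real.cosh_pos a).le ?_
  rw [← one_le_sq_iff₀ (abs_nonneg _), sq_abs]
  nlinarith [Real.sin_sq_add_cos_sq b, mul_nonneg hb hb']

lemma nuStrip_im (σ a b : ℝ) : (σ * Complex.I * Complex.sinh (a + b * Complex.I)).im
    = Real.sinh a * (σ * Real.cos b) := by
  rw [mul_assoc, Complex.im_ofReal_mul, Complex.I_mul_im, sinh_re]
  ring

/-- The upper half of the imaginary axis must be included: it is reached on the ray `Im ζ = π`,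
where `1 - k² ≤ 0`. -/
lemma cpow_half_sq {z : ℂ} (hz : 0 < z.re ∨ z.re = 0 ∧ 0 ≤ z.im) : (z ^ 2) ^ (1 / 2 : ℂ) = z := by
  have hpi := Real.pi_pos
  rcases eq_or_ne z 0 with rfl | h0
  · simp
  have h : -(Real.pi / (2 : ℕ)) < z.arg ∧ z.arg ≤ Real.pi / (2 : ℕ) := by
    push_cast
    rcases hz with h | ⟨h, h'⟩
    · have := Complex.abs_arg_lt_pi_div_two_iff.2 (Or.inl h)
      exact ⟨(abs_lt.1 this).1, (abs_lt.1 this).2.le⟩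
    · have h1 := Complex.arg_nonneg_iff.2 h'
      exact ⟨by linarith, (abs_le.1 (Complex.abs_arg_le_pi_div_two_iff.2 h.ge)).2⟩
  have := Complex.pow_cpow_nat_inv (x := z) (n := 2) two_ne_zero h.1 h.2
  simpa using this

/-- Here `ν` is minus the principal root, and the principal root is `-i sinh ζ`, whose real part is
`cosh a sin b > 0`. -/
lemma nu_cosh_right {ε a b : ℝ} (h0 : 0 < ε) (h1 : ε < Real.pi / 2) (ha : 0 ≤ a)
    (hb : b ∈ Icc (Real.pi / 4) (Real.pi / 2)) :
    nu ε (Complex.cosh (a + b * Complex.I))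
      = ((1 : ℝ) : ℂ) * Complex.I * Complex.sinh (a + b * Complex.I) := by
  have hpi := Real.pi_pos
  have hs : 0 < Real.sin b := Real.sin_pos_of_pos_of_lt_pi (by linarith [hb.1]) (by linarith [hb.2])
  have hc : 0 ≤ Real.cos b := Real.cos_nonneg_of_mem_Icc ⟨by linarith [hb.1], hb.2⟩
  have h2 : Real.cos (2 * b) ≤ 0 :=
    Real.cos_nonpos_of_pi_div_two_le_of_le (by linarith [hb.1]) (by linarith [hb.2])
  have hsh := Real.sinh_nonneg_iff.2 ha
  have hmem : Complex.cosh (a + b * Complex.I) ∈ clRight := by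
    refine ⟨?_, ?_, ?_⟩
    · rw [cosh_im]; positivity
    · rw [cosh_re]; exact mul_nonneg (Real.cosh_pos a).le hc
    · rw [cosh_im, cosh_re, mul_pow, mul_pow, Real.cosh_sq, Real.sin_sq]
      rw [Real.cos_two_mul] at h2
      nlinarith [sq_nonneg (Real.sinh a)]
  rw [nu_eq_of_mem_clRight h0 h1 hmem, ← nuStrip_sq (σ := -1) (by norm_num), cpow_half_sq]
  · push_cast; ring
  · left
    rw [mul_assoc, Complex.re_ofReal_mul, Complex.I_mul_re, sinh_im]
    have := mul_pos (Real.cosh_pos a) hs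
    linarith

/-- Here `ν` is the principal root itself, and `-i sinh ζ` has real part `cosh a sin b ≥ 0`, with
nonnegative imaginary part when this is zero. -/
lemma nu_cosh_left {ε a b : ℝ} (h0 : 0 < ε) (h1 : ε < Real.pi / 2) (ha : 0 ≤ a)
    (hb : b ∈ Icc (3 * Real.pi / 4) Real.pi) :
    nu ε (Complex.cosh (a + b * Complex.I))
      = ((-1 : ℝ) : ℂ) * Complex.I * Complex.sinh (a + b * Complex.I) := by
  have hpi := Real.pi_pos
  have hs : 0 ≤ Real.sin b := Real.sin_nonneg_of_nonneg_of_le_pi (by linarith [hb.1]) hb.2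
  have hc : Real.cos b ≤ 0 := Real.cos_nonpos_of_pi_div_two_le_of_le
    (by linarith [hb.1]) (by linarith [hb.2])
  have h2 : 0 ≤ Real.cos (2 * b) := by
    rw [← Real.cos_sub_two_pi]
    exact Real.cos_nonneg_of_mem_Icc ⟨by linarith [hb.1], by linarith [hb.2]⟩
  have hsh := Real.sinh_nonneg_iff.2 ha
  have hmem : Complex.cosh (a + b * Complex.I) ∈ clLeft := by
    refine ⟨?_, ?_, ?_⟩
    · rw [cosh_im]; positivity
    · rw [cosh_re]; exact mul_nonpos_of_nonneg_of_nonpos (Real.cosh_pos a).le hc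
    · rw [cosh_im, cosh_re, mul_pow, mul_pow, Real.cosh_sq, Real.sin_sq]
      rw [Real.cos_two_mul] at h2
      nlinarith [sq_nonneg (Real.sinh a)]
  rw [nu_eq_of_mem_clLeft h0 h1 hmem, ← nuStrip_sq (σ := -1) (by norm_num), cpow_half_sq]
  have hre : (((-1 : ℝ) : ℂ) * Complex.I * Complex.sinh (a + b * Complex.I)).re
      = Real.cosh a * Real.sin b := by
    rw [mul_assoc, Complex.re_ofReal_mul, Complex.I_mul_re, sinh_im]; ring
  rw [hre, nuStrip_im]
  rcases (mul_nonneg (Real.cosh_pos a).le hs).eq_or_lt with h | h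
  · exact Or.inr ⟨h.symm, mul_nonneg hsh (by linarith)⟩
  · exact Or.inl h

/-! ### The `t`-transform -/

lemma differentiable_tTransform {g : ℝ → ℂ} {t : ℝ} (hg : IntervalIntegrable g volume 0 t) :
    Differentiable ℂ fun κ => tTransform g κ t := by
  intro κ
  have hm : AEStronglyMeasurable g (volume.restrict (uIoc 0 t)) := hg.def'.aestronglyMeasurable
  refine (intervalIntegral.hasDerivAt_integral_of_dominated_loc_of_deriv_le
    (F := fun κ (s : ℝ) => Complex.exp (κ * s) * g s)
    (F' := fun κ (s : ℝ) => Complex.exp (κ * s) * s * g s)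
    (bound := fun s => Real.exp ((‖κ‖ + 1) * |t|) * |t| * ‖g s‖)
    (Metric.ball_mem_nhds κ one_pos) ?_ ?_ ?_ ?_ ?_ ?_).2.differentiableAt
  · exact Eventually.of_forall fun κ =>
      (Continuous.aestronglyMeasurable (by fun_prop)).mul hm
  · exact hg.continuousOn_mul (by fun_prop)
  · exact (Continuous.aestronglyMeasurable (by fun_prop)).mul hm
  · refine Eventually.of_forall fun s hs z hz => ?_
    have hst : |s| ≤ |t| := by
      have := abs_sub_left_of_mem_uIcc (uIoc_subset_uIcc hs)
      simpa using this
    rw [norm_mul, norm_mul, Complex.norm_real, Real.norm_eq_abs]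
    gcongr
    refine (Complex.norm_exp_le_exp_norm _).trans (Real.exp_le_exp.2 ?_)
    rw [norm_mul, Complex.norm_real, Real.norm_eq_abs]
    have hz' : ‖z‖ ≤ ‖κ‖ + 1 := by
      have h1 := norm_add_le κ (z - κ)
      rw [Metric.mem_ball, dist_eq_norm] at hz
      rw [add_sub_cancel] at h1
      linarith
    gcongr
  · exact hg.norm.const_mul _
  · refine Eventually.of_forall fun s _ z _ => ?_
    have : HasDerivAt (fun z : ℂ => z * s) s z := by
      simpa using (hasDerivAt_id z).mul_const (s : ℂ)
    exact this.cexp.mul_const _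

/-- The exponent is `κ(s - t)` with `s ≤ t`: harmless for `Re κ ≥ 0`, outside `D⁺`. -/
lemma norm_exp_mul_tTransform_le {g : ℝ → ℂ} {κ : ℂ} {t M : ℝ} (ht : 0 ≤ t) (hκ : 0 ≤ κ.re)
    (hM : ∀ s ∈ Icc 0 t, ‖g s‖ ≤ M) :
    ‖Complex.exp (-κ * t) * tTransform g κ t‖ ≤ M * t := by
  rw [tTransform, ← intervalIntegral.integral_const_mul]
  have := intervalIntegral.norm_integral_le_of_norm_le_const (a := 0) (b := t) (C := M)
    (f := fun s : ℝ => Complex.exp (-κ * t) * (Complex.exp (κ * s) * g s)) ?_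
  · rwa [sub_zero, abs_of_nonneg ht] at this
  · intro s hs
    rw [uIoc_of_le ht] at hs
    rw [← mul_assoc, ← Complex.exp_add, norm_mul, Complex.norm_exp]
    refine (mul_le_of_le_one_left (norm_nonneg _) (Real.exp_le_one_iff.2 ?_)).trans
      (hM s ⟨hs.1.le, hs.2⟩)
    simp
    nlinarith [mul_le_mul_of_nonneg_left hs.2 hκ]

/-- Now `s ≥ t`, so the same exponent is harmless for `Re κ ≤ 0`. This is why `t` may be replaced by
`T` in the kernel on `D⁺`. -/
lemma norm_exp_mul_tTransform_sub_le {g : ℝ → ℂ} {κ : ℂ} {t T M : ℝ} (ht : 0 ≤ t) (htT : t ≤ T)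
    (hκ : κ.re ≤ 0) (hg : Continuous g) (hM : ∀ s, ‖g s‖ ≤ M) :
    ‖Complex.exp (-κ * t) * (tTransform g κ T - tTransform g κ t)‖ ≤ M * T := by
  have hM0 : 0 ≤ M := (norm_nonneg _).trans (hM 0)
  have hi : ∀ a b : ℝ, IntervalIntegrable (fun s : ℝ => Complex.exp (κ * s) * g s) volume a b :=
    fun a b => Continuous.intervalIntegrable (by fun_prop) a b
  rw [tTransform, tTransform, intervalIntegral.integral_interval_sub_left (hi _ _) (hi _ _),
    ← intervalIntegral.integral_const_mul]
  have := intervalIntegral.norm_integral_le_of_norm_le_const (a := t) (b := T) (C := M)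
    (f := fun s : ℝ => Complex.exp (-κ * t) * (Complex.exp (κ * s) * g s)) ?_
  · refine this.trans (mul_le_mul_of_nonneg_left ?_ hM0)
    rw [abs_of_nonneg (by linarith)]; linarith
  · intro s hs
    rw [uIoc_of_le htT] at hs
    rw [← mul_assoc, ← Complex.exp_add, norm_mul, Complex.norm_exp]
    refine (mul_le_of_le_one_left (norm_nonneg _) (Real.exp_le_one_iff.2 ?_)).trans (hM s)
    simp
    nlinarith [hs.1]

/-- Integration by parts; both endpoint terms vanish because the support lies in the open interval.
-/
lemma mul_tTransform_eq {g : ℝ → ℂ} {T : ℝ} (hg : ContDiff ℝ 1 g)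
    (hsupp : tsupport g ⊆ Ioo 0 T) (κ : ℂ) :
    κ * tTransform g κ T = -tTransform (deriv g) κ T := by
  have hz : ∀ s, s ∉ Ioo 0 T → g s = 0 := fun s hs =>
    image_eq_zero_of_notMem_tsupport fun h => hs (hsupp h)
  have hgc := hg.continuous
  have hdc := hg.continuous_deriv le_rfl
  have hftc := intervalIntegral.integral_eq_sub_of_hasDerivAt (a := 0) (b := T)
    (f := fun s : ℝ => Complex.exp (κ * s) * g s)
    (f' := fun s : ℝ => κ * (Complex.exp (κ * s) * g s) + Complex.exp (κ * s) * deriv g s)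
    (fun s _ => by
      have h1 : HasDerivAt (fun s : ℝ => κ * s) κ s := by
        simpa using (Complex.ofRealCLM.hasDerivAt (x := s)).const_mul κ
      refine (h1.cexp.mul (hg.differentiable (by simp) s).hasDerivAt).congr_deriv ?_
      ring) (Continuous.intervalIntegrable (by fun_prop) _ _)
  rw [intervalIntegral.integral_add (Continuous.intervalIntegrable (by fun_prop) _ _)
    (Continuous.intervalIntegrable (by fun_prop) _ _), intervalIntegral.integral_const_mul,
    hz 0 (fun h => lt_irrefl _ h.1), hz T (fun h => lt_irrefl _ h.2), mul_zero, mul_zero,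
    sub_zero] at hftc
  exact eq_neg_of_add_eq_zero_left hftc

lemma exists_norm_le {g : ℝ → ℂ} (hg : Continuous g) (hc : HasCompactSupport g) :
    ∃ M, ∀ s, ‖g s‖ ≤ M := hc.exists_bound_of_continuous hg

/-- Each integration by parts exchanges a factor `κ` for a derivative of `g`, and splitting off one
factor `1 + ‖κ‖` runs the induction. -/
lemma exists_tTransform_decay {T : ℝ} (hT : 0 < T) (n : ℕ) {g : ℝ → ℂ} (hg : ContDiff ℝ n g)
    (hc : HasCompactSupport g) (hsupp : tsupport g ⊆ Ioo 0 T) :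
    ∃ K, ∀ κ : ℂ, κ.re = 0 → (1 + ‖κ‖) ^ n * ‖tTransform g κ T‖ ≤ K := by
  induction n generalizing g with
  | zero =>
    obtain ⟨M, hM⟩ := exists_norm_le hg.continuous hc
    refine ⟨M * T, fun κ hκ => ?_⟩
    have := norm_exp_mul_tTransform_le hT.le hκ.ge (fun s _ => hM s)
    rw [norm_mul, Complex.norm_exp] at this
    simpa [hκ] using this
  | succ n ih =>
    obtain ⟨K₁, h₁⟩ := ih (hg.of_le (by exact_mod_cast n.le_succ)) hc hsupp
    have hd : ContDiff ℝ n (deriv g) := (contDiff_succ_iff_deriv.1 hg).2.2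
    obtain ⟨K₂, h₂⟩ := ih hd hc.deriv
      ((tsupport_deriv_subset (𝕜 := ℝ)).trans hsupp)
    refine ⟨K₁ + K₂, fun κ hκ => ?_⟩
    have h3 := congrArg norm (mul_tTransform_eq
      (hg.of_le (by exact_mod_cast Nat.succ_le_succ n.zero_le)) hsupp κ)
    rw [norm_mul, norm_neg] at h3
    calc (1 + ‖κ‖) ^ (n + 1) * ‖tTransform g κ T‖
        = (1 + ‖κ‖) ^ n * ‖tTransform g κ T‖ + (1 + ‖κ‖) ^ n * (‖κ‖ * ‖tTransform g κ T‖) := by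
          ring
      _ ≤ K₁ + K₂ := by rw [h3]; exact add_le_add (h₁ κ hκ) (h₂ κ hκ)

/-! ### Elimination of the unknown boundary values -/

/-- The kernel `G` with an unspecified root `ν` of `ν² = 1 - k²`. -/
noncomputable def rootG (g₀ g₁ : ℝ → ℂ) (ν k : ℂ) (t : ℝ) : ℂ :=
  -2 * Complex.I * k * (k + ν) * tTransform g₁ (w k) t
    - 2 * k * ν * (k + ν) * tTransform g₀ (w k) t

lemma w_neg (k : ℂ) : w (-k) = w k := by
  unfold w; ring

lemma w_of_sq_eq {ν k : ℂ} (h : ν ^ 2 = 1 - k ^ 2) : w ν = w k := by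
  rw [w, w, show ν ^ 4 = (ν ^ 2) ^ 2 by ring, h]; ring

/-- The unknown transforms enter at `k` as `A₃ + ik A₂`. The weights `p = (ν+k)/(ν-k)` and `q =
-2k/(ν-k)` at `-k` and `-ν` solve `p + q = 1` and `-kp - νq = k`, so that `A₃` and `A₂` both cancel;
the known terms combine to `-G`. -/
lemma boundaryTransform_eq_rootG (h : ℕ → ℝ → ℂ) {ν k : ℂ} (t : ℝ) (hν : ν ^ 2 = 1 - k ^ 2)
    (hne : ν - k ≠ 0) :
    boundaryTransform h k t = -rootG (h 0) (h 1) ν k t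
      + ((ν + k) / (ν - k) * boundaryTransform h (-k) t
        - 2 * k / (ν - k) * boundaryTransform h (-ν) t) := by
  unfold boundaryTransform rootG
  rw [w_neg, w_neg, w_of_sq_eq hν]
  generalize tTransform (h 0) (w k) t = A₀
  generalize tTransform (h 1) (w k) t = A₁
  generalize tTransform (h 2) (w k) t = A₂
  generalize tTransform (h 3) (w k) t = A₃
  rw [div_mul_eq_mul_div, div_mul_eq_mul_div, ← sub_div, ← sub_eq_iff_eq_add', eq_div_iff hne]
  linear_combination 2 * k * ν * (k ^ 2 - ν ^ 2) * A₀ * Complex.I_sq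

lemma tTransform_congr {T : ℝ} {g h : ℝ → ℂ} (hgh : ∀ s ∈ Ioo 0 T, h s = g s) (κ : ℂ) {t : ℝ}
    (ht : t ∈ Icc 0 T) : tTransform h κ t = tTransform g κ t := by
  rw [tTransform, tTransform, intervalIntegral.integral_of_le ht.1,
    intervalIntegral.integral_of_le ht.1, integral_Ioc_eq_integral_Ioo,
    integral_Ioc_eq_integral_Ioo]
  refine setIntegral_congr_fun measurableSet_Ioo fun s hs => ?_
  simp only [hgh s ⟨hs.1, hs.2.trans_le ht.2⟩]

/-- Cubic growth in `k`, the part that the regularizer has to absorb outside `D⁺`; the constant is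
`1 + 1 + 2 + 2`. -/
lemma norm_exp_mul_boundaryTransform_le {h : ℕ → ℝ → ℂ} {k : ℂ} {t M c : ℝ} (ht : 0 ≤ t)
    (hw : 0 ≤ (w k).re) (hM : ∀ j ≤ 3, ∀ s ∈ Icc 0 t, ‖h j s‖ ≤ M) (hc : 1 ≤ c)
    (hk : ‖k‖ ≤ c) :
    ‖Complex.exp (-w k * t) * boundaryTransform h k t‖ ≤ 6 * (M * t) * c ^ 3 := by
  set e := Complex.exp (-w k * t)
  have hM0 : 0 ≤ M := (norm_nonneg _).trans (hM 0 (by omega) 0 ⟨le_rfl, ht⟩)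
  have hB : 0 ≤ M * t := mul_nonneg hM0 ht
  have hb : ∀ j ≤ 3, ‖e * tTransform (h j) (w k) t‖ ≤ M * t := fun j hj =>
    norm_exp_mul_tTransform_le ht hw (hM j hj)
  have hexp : e * boundaryTransform h k t = Complex.I * (-(e * tTransform (h 3) (w k) t)
      - Complex.I * k * (e * tTransform (h 2) (w k) t)
      + (k ^ 2 - 1) * (e * tTransform (h 1) (w k) t)
      + Complex.I * k * (k ^ 2 - 1) * (e * tTransform (h 0) (w k) t)) := by
    unfold boundaryTransform; ring
  have hk2 : ‖k ^ 2 - 1‖ ≤ 2 * c ^ 2 := by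
    refine (norm_sub_le _ _).trans ?_
    rw [norm_pow, norm_one]
    nlinarith [pow_le_pow_left₀ (norm_nonneg k) hk 2, one_le_pow₀ hc (n := 2)]
  rw [hexp, norm_mul, Complex.norm_I, one_mul]
  have n3 : ‖-(e * tTransform (h 3) (w k) t)‖ ≤ M * t := by
    rw [norm_neg]; exact hb 3 le_rfl
  have n2 : ‖Complex.I * k * (e * tTransform (h 2) (w k) t)‖ ≤ c * (M * t) := by
    rw [norm_mul, norm_mul, Complex.norm_I, one_mul]
    exact mul_le_mul hk (hb 2 (by omega)) (norm_nonneg _) (by linarith)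
  have n1 : ‖(k ^ 2 - 1) * (e * tTransform (h 1) (w k) t)‖ ≤ 2 * c ^ 2 * (M * t) := by
    rw [norm_mul]
    exact mul_le_mul hk2 (hb 1 (by omega)) (norm_nonneg _) (by positivity)
  have n0 : ‖Complex.I * k * (k ^ 2 - 1) * (e * tTransform (h 0) (w k) t)‖
      ≤ c * (2 * c ^ 2) * (M * t) := by
    rw [norm_mul, norm_mul, norm_mul, Complex.norm_I, one_mul]
    exact mul_le_mul (mul_le_mul hk hk2 (norm_nonneg _) (by linarith)) (hb 0 (by omega))
      (norm_nonneg _) (by positivity)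
  have c2 : c ^ 2 ≤ c ^ 3 := pow_le_pow_right₀ hc (by norm_num)
  have c1 : c ≤ c ^ 3 := le_self_pow₀ hc (by norm_num)
  have c0 : 1 ≤ c ^ 3 := one_le_pow₀ hc
  calc _ ≤ M * t + c * (M * t) + 2 * c ^ 2 * (M * t) + c * (2 * c ^ 2) * (M * t) :=
        (norm_add_le _ _).trans (add_le_add ((norm_add_le _ _).trans (add_le_add
          ((norm_sub_le _ _).trans (add_le_add n3 n2)) n1)) n0)
    _ = (1 + c + 2 * c ^ 2 + 2 * c ^ 3) * (M * t) := by ring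
    _ ≤ (6 * c ^ 3) * (M * t) := mul_le_mul_of_nonneg_right (by linarith) hB
    _ = _ := by ring

lemma norm_rootG_le {g₀ g₁ : ℝ → ℂ} {ν k : ℂ} {t c B₀ B₁ : ℝ} (hk : ‖k‖ ≤ c) (hν : ‖ν‖ ≤ c)
    (h₀ : ‖tTransform g₀ (w k) t‖ ≤ B₀) (h₁ : ‖tTransform g₁ (w k) t‖ ≤ B₁) :
    ‖rootG g₀ g₁ ν k t‖ ≤ 4 * c ^ 2 * B₁ + 4 * c ^ 3 * B₀ := by
  have hc : 0 ≤ c := (norm_nonneg _).trans hk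
  have hs : ‖k + ν‖ ≤ 2 * c := (norm_add_le _ _).trans (by linarith)
  have n1 : ‖-2 * Complex.I * k * (k + ν) * tTransform g₁ (w k) t‖ ≤ 2 * c * (2 * c) * B₁ := by
    rw [norm_mul, norm_mul, norm_mul, norm_mul, Complex.norm_I, norm_neg, Complex.norm_ofNat,
      mul_one]
    gcongr
  have n0 : ‖2 * k * ν * (k + ν) * tTransform g₀ (w k) t‖ ≤ 2 * c * c * (2 * c) * B₀ := by
    rw [norm_mul, norm_mul, norm_mul, norm_mul, Complex.norm_ofNat]
    gcongr
  calc _ ≤ _ := (norm_sub_le _ _).trans (add_le_add n1 n0)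
    _ = _ := by ring

/-! ### The integrand on the contour -/

lemma continuousOn_nu_cosh {ε : ℝ} (h0 : 0 < ε) (h1 : ε < Real.pi / 2) :
    ContinuousOn (fun ζ => nu ε (Complex.cosh ζ)) dStrip := by
  refine ContinuousOn.union_of_isClosed ?_ ?_ (isClosed_strip _ _) (isClosed_strip _ _)
  · refine ContinuousOn.congr (f := fun ζ => ((1 : ℝ) : ℂ) * Complex.I * Complex.sinh ζ)
      (by fun_prop) fun ζ hζ => ?_
    have := nu_cosh_right h0 h1 hζ.1 hζ.2
    rwa [Complex.re_add_im] at this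
  · refine ContinuousOn.congr (f := fun ζ => ((-1 : ℝ) : ℂ) * Complex.I * Complex.sinh ζ)
      (by fun_prop) fun ζ hζ => ?_
    have := nu_cosh_left h0 h1 hζ.1 hζ.2
    rwa [Complex.re_add_im] at this

/-- Only `ν² = -sinh² ζ` is used, so no branch has to be identified. -/
lemma norm_nu_cosh_le (ε a b : ℝ) : ‖nu ε (Complex.cosh (a + b * Complex.I))‖ ≤ Real.cosh a := by
  have h : nu ε (Complex.cosh (a + b * Complex.I)) ^ 2
      = -Complex.sinh (a + b * Complex.I) ^ 2 := by
    rw [nu_sq, Complex.cosh_sq]; ring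
  have h2 := congrArg norm h
  rw [norm_neg, norm_pow, norm_pow] at h2
  rw [(pow_left_inj₀ (norm_nonneg _) (norm_nonneg _) two_ne_zero).1 h2]
  exact norm_sinh_le a b

lemma continuous_w : Continuous w := by unfold w; fun_prop

lemma continuousOn_integrand {ε : ℝ} (h0 : 0 < ε) (h1 : ε < Real.pi / 2) {g₀ g₁ : ℝ → ℂ}
    (hg₀ : Continuous g₀) (hg₁ : Continuous g₁) (x t T : ℝ) :
    ContinuousOn (fun ζ => E (Complex.cosh ζ) x t * G ε g₀ g₁ (Complex.cosh ζ) T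
      * Complex.sinh ζ) dStrip := by
  have hν := continuousOn_nu_cosh h0 h1
  have hcosh := Complex.continuous_cosh
  have hsinh := Complex.continuous_sinh
  have hw : Continuous fun ζ => w (Complex.cosh ζ) := continuous_w.comp hcosh
  have t0 : Continuous fun ζ => tTransform g₀ (w (Complex.cosh ζ)) T :=
    (differentiable_tTransform (hg₀.intervalIntegrable 0 T)).continuous.comp hw
  have t1 : Continuous fun ζ => tTransform g₁ (w (Complex.cosh ζ)) T :=
    (differentiable_tTransform (hg₁.intervalIntegrable 0 T)).continuous.comp hw
  unfold E G
  refine ContinuousOn.mul (ContinuousOn.mul ?_ ?_) hsinh.continuousOn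
  · exact (continuous_const.mul (((continuous_const.mul hcosh).mul continuous_const).sub
      (hw.mul continuous_const)).cexp).continuousOn
  · exact (((continuous_const.mul hcosh).continuousOn.mul (hcosh.continuousOn.add hν)).mul
      t1.continuousOn).sub ((((continuous_const.mul hcosh).continuousOn.mul hν).mul
      (hcosh.continuousOn.add hν)).mul t0.continuousOn)

lemma exists_cosh_pow_mul_exp_le {x : ℝ} (hx : 0 < x) :
    ∃ K, ∀ a : ℝ, 0 ≤ a → Real.cosh a ^ 5 * Real.exp (-(x * Real.sinh a / 2)) ≤ K := by
  -- From `cosh a ≤ 1 + sinh a` and `v⁵/5! ≤ e^v` at `v = x(1 + sinh a)/2`; the surplus `x/2` in the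
  -- exponent gives the last factor.
  refine ⟨120 * (2 / x) ^ 5 * Real.exp (x / 2), fun a ha => ?_⟩
  have hs := Real.sinh_nonneg_iff.2 ha
  have hc : Real.cosh a ≤ 1 + Real.sinh a := by
    refine abs_le_of_sq_le_sq' ?_ (by linarith) |>.2
    rw [Real.cosh_sq]; nlinarith
  set s := Real.sinh a
  have h1 := Real.pow_div_factorial_le_exp (x * (1 + s) / 2) (by positivity) 5
  have h2 : Real.exp (x * (1 + s) / 2) = Real.exp (x / 2) * Real.exp (x * s / 2) := by
    rw [← Real.exp_add]; congr 1; ring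
  rw [h2] at h1
  have h3 : Real.exp (x * s / 2) * Real.exp (-(x * s / 2)) = 1 := by
    rw [← Real.exp_add, add_neg_cancel, Real.exp_zero]
  have h4 : (1 + s) ^ 5 ≤ 120 * (2 / x) ^ 5 * (Real.exp (x / 2) * Real.exp (x * s / 2)) := by
    have : (1 + s) ^ 5 = 120 * (2 / x) ^ 5 * ((x * (1 + s) / 2) ^ 5 / (Nat.factorial 5 : ℕ)) := by
      simp [Nat.factorial]; field_simp
    rw [this]
    gcongr
  calc Real.cosh a ^ 5 * Real.exp (-(x * s / 2))
      ≤ (1 + s) ^ 5 * Real.exp (-(x * s / 2)) := by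
        have := (Real.cosh_pos a).le
        gcongr
    _ ≤ 120 * (2 / x) ^ 5 * (Real.exp (x / 2) * Real.exp (x * s / 2))
        * Real.exp (-(x * s / 2)) := by gcongr
    _ = 120 * (2 / x) ^ 5 * Real.exp (x / 2)
        * (Real.exp (x * s / 2) * Real.exp (-(x * s / 2))) := by ring
    _ = _ := by rw [h3, mul_one]

lemma norm_E_cosh {a b : ℝ} (x t : ℝ) (hw : (w (Complex.cosh (a + b * Complex.I))).re = 0) :
    ‖E (Complex.cosh (a + b * Complex.I)) x t‖
      = 1 / (2 * Real.pi) * Real.exp (-(x * (Real.sinh a * Real.sin b))) := by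
  rw [E, norm_mul, Complex.norm_exp]
  congr 1
  · rw [norm_neg, norm_div, norm_mul, Complex.norm_real, Real.norm_of_nonneg Real.pi_pos.le]
    simp
  · congr 1
    rw [Complex.sub_re, Complex.re_mul_ofReal, Complex.re_mul_ofReal, hw, Complex.I_mul_re,
      cosh_im]
    ring

lemma w_neg_cosh (a : ℝ) : ‖w (Complex.cosh (a + Real.pi * Complex.I))‖
    = Real.cosh a ^ 4 - Real.cosh a ^ 2 := by
  have h : Complex.cosh (a + Real.pi * Complex.I) = ((-Real.cosh a : ℝ) : ℂ) := by
    rw [cosh_add_mul_I]; simp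
  rw [h, w, norm_mul, norm_neg, Complex.norm_I, one_mul]
  have h2 : ((-Real.cosh a : ℝ) : ℂ) ^ 4 - ((-Real.cosh a : ℝ) : ℂ) ^ 2
      = ((Real.cosh a ^ 4 - Real.cosh a ^ 2 : ℝ) : ℂ) := by push_cast; ring
  rw [h2, Complex.norm_real, Real.norm_of_nonneg]
  exact sub_nonneg.2 (pow_le_pow_right₀ (Real.one_le_cosh a) (by norm_num))

/-- On `∂D⁺` the spectral input `w` is purely imaginary. -/
lemma w_contourPath_re (j : Fin 6) (s : ℝ) : (w (Complex.cosh (contourPath j s))).re = 0 := by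
  have e : ∀ b : ℝ, (b : ℂ) * Complex.I = (0 : ℝ) + b * Complex.I := fun b => by simp
  fin_cases j
  · change (w (Complex.cosh (s + (Real.pi / 4 : ℝ) * Complex.I))).re = 0
    rw [w_cosh_re, show 2 * (Real.pi / 4) = Real.pi / 2 by ring, Real.cos_pi_div_two]; ring
  · change (w (Complex.cosh (s + (Real.pi / 2 : ℝ) * Complex.I))).re = 0
    rw [w_cosh_re, Real.cos_pi_div_two]; ring
  · change (w (Complex.cosh (s + (3 * Real.pi / 4 : ℝ) * Complex.I))).re = 0
    rw [w_cosh_re, show 2 * (3 * Real.pi / 4) = Real.pi / 2 + Real.pi by ring, Real.cos_add_pi,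
      Real.cos_pi_div_two]; ring
  · change (w (Complex.cosh (s + (Real.pi : ℝ) * Complex.I))).re = 0
    rw [w_cosh_re, Real.sin_pi]; ring
  · change (w (Complex.cosh (s * Complex.I))).re = 0
    rw [e, w_cosh_re, Real.sinh_zero]; ring
  · change (w (Complex.cosh (s * Complex.I))).re = 0
    rw [e, w_cosh_re, Real.sinh_zero]; ring

/-- Gives absolute convergence and the dominating function for `r → ∞`. All pieces but the ray
`(-∞,-1]` need only bounded `t`-transforms; that ray is where smoothness of the data enters, since
`|e^{ikx}| = 1` on it. -/
lemma exists_integrand_bound {T x : ℝ} (hT : 0 < T) (hx : 0 < x) (ε t : ℝ) {g₀ g₁ : ℝ → ℂ}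
    (hg₀ : ContDiff ℝ 2 g₀) (hc₀ : HasCompactSupport g₀) (hs₀ : tsupport g₀ ⊆ Ioo 0 T)
    (hg₁ : ContDiff ℝ 1 g₁) (hc₁ : HasCompactSupport g₁) (hs₁ : tsupport g₁ ⊆ Ioo 0 T) :
    ∃ C, ∀ j, ∀ s ∈ contourInterval j,
      ‖E (Complex.cosh (contourPath j s)) x t * G ε g₀ g₁ (Complex.cosh (contourPath j s)) T
        * Complex.sinh (contourPath j s)‖ ≤ C / Real.cosh (contourPath j s).re := by
  have hpi := Real.pi_pos
  obtain ⟨K₀, hK₀⟩ := exists_tTransform_decay hT 2 (by exact_mod_cast hg₀) hc₀ hs₀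
  obtain ⟨K₁, hK₁⟩ := exists_tTransform_decay hT 1 (by exact_mod_cast hg₁) hc₁ hs₁
  obtain ⟨K, hK⟩ := exists_cosh_pow_mul_exp_le hx
  have hK0 : 0 ≤ K := le_trans (by positivity) (hK 0 le_rfl)
  have hK₀0 : 0 ≤ K₀ := le_trans (by positivity) (hK₀ 0 (by simp))
  have hK₁0 : 0 ≤ K₁ := le_trans (by positivity) (hK₁ 0 (by simp))
  have hE : ∀ e : ℝ, 0 ≤ e → 1 / (2 * Real.pi) * e ≤ e := fun e he => by
    refine mul_le_of_le_one_left he ?_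
    rw [div_le_one (by positivity)]
    linarith [Real.two_le_pi]
  have key : ∀ a b B₀ B₁ : ℝ, (w (Complex.cosh (a + b * Complex.I))).re = 0 →
      ‖tTransform g₀ (w (Complex.cosh (a + b * Complex.I))) T‖ ≤ B₀ →
      ‖tTransform g₁ (w (Complex.cosh (a + b * Complex.I))) T‖ ≤ B₁ →
      ‖E (Complex.cosh (a + b * Complex.I)) x t * G ε g₀ g₁ (Complex.cosh (a + b * Complex.I)) T
        * Complex.sinh (a + b * Complex.I)‖
      ≤ Real.exp (-(x * (Real.sinh a * Real.sin b))) *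
        (4 * Real.cosh a ^ 2 * B₁ + 4 * Real.cosh a ^ 3 * B₀) * Real.cosh a := by
    intro a b B₀ B₁ hw h₀ h₁
    have hG : ‖G ε g₀ g₁ (Complex.cosh (a + b * Complex.I)) T‖ ≤ _ :=
      norm_rootG_le (norm_cosh_le a b) (norm_nu_cosh_le ε a b) h₀ h₁
    rw [norm_mul, norm_mul, norm_E_cosh x t hw]
    have := (norm_nonneg _).trans hG
    have := (Real.cosh_pos a).le
    refine mul_le_mul (mul_le_mul (hE _ (Real.exp_pos _).le) hG (norm_nonneg _)
      (Real.exp_pos _).le) (norm_sinh_le a b) (norm_nonneg _) (by positivity)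
  have crude₀ : ∀ κ : ℂ, κ.re = 0 → ‖tTransform g₀ κ T‖ ≤ K₀ := fun κ hκ =>
    le_trans (le_mul_of_one_le_left (norm_nonneg _)
      (one_le_pow₀ (by linarith [norm_nonneg κ]))) (hK₀ κ hκ)
  have crude₁ : ∀ κ : ℂ, κ.re = 0 → ‖tTransform g₁ κ T‖ ≤ K₁ := fun κ hκ =>
    le_trans (le_mul_of_one_le_left (norm_nonneg _)
      (one_le_pow₀ (by linarith [norm_nonneg κ]))) (hK₁ κ hκ)
  -- At `b = π/4, π/2, 3π/4` one has `sin b ≥ 1/2`, so `|e^{ikx}| ≤ e^{-x sinh a / 2}`. Of the five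
  -- powers of `cosh a` to be absorbed, three come from the kernel, one from `dk` and one from the
  -- target bound.
  have ray : ∀ a b : ℝ, 0 ≤ a → 1 / 2 ≤ Real.sin b →
      (w (Complex.cosh (a + b * Complex.I))).re = 0 →
      ‖E (Complex.cosh (a + b * Complex.I)) x t * G ε g₀ g₁ (Complex.cosh (a + b * Complex.I)) T
        * Complex.sinh (a + b * Complex.I)‖ ≤ (4 * (K₁ + K₀) * K) / Real.cosh a := by
    intro a b ha hb hw
    refine (key a b K₀ K₁ hw (crude₀ _ hw) (crude₁ _ hw)).trans ?_
    have hc := Real.one_le_cosh a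
    have hs := Real.sinh_nonneg_iff.2 ha
    have h1 : Real.exp (-(x * (Real.sinh a * Real.sin b)))
        ≤ Real.exp (-(x * Real.sinh a / 2)) := by
      apply Real.exp_le_exp.2
      nlinarith [mul_nonneg hx.le hs]
    rw [le_div_iff₀ (Real.cosh_pos a)]
    have h2 : Real.cosh a ^ 2 ≤ Real.cosh a ^ 3 := pow_le_pow_right₀ hc (by norm_num)
    calc _ ≤ Real.exp (-(x * Real.sinh a / 2)) *
        (4 * Real.cosh a ^ 3 * K₁ + 4 * Real.cosh a ^ 3 * K₀) * Real.cosh a * Real.cosh a := by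
          gcongr
      _ = 4 * (K₁ + K₀) * (Real.cosh a ^ 5 * Real.exp (-(x * Real.sinh a / 2))) := by ring
      _ ≤ _ := by gcongr; exact hK a ha
  have side : ∀ b : ℝ, ‖E (Complex.cosh (b * Complex.I)) x t * G ε g₀ g₁
      (Complex.cosh (b * Complex.I)) T * Complex.sinh (b * Complex.I)‖ ≤ 4 * (K₁ + K₀) := by
    intro b
    have e : ((0 : ℝ) : ℂ) + b * Complex.I = b * Complex.I := by simp
    have hw : (w (Complex.cosh ((0 : ℝ) + b * Complex.I))).re = 0 := by
      rw [w_cosh_re]; simp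
    have := key 0 b K₀ K₁ hw (crude₀ _ hw) (crude₁ _ hw)
    rw [e] at this
    refine this.trans (le_of_eq ?_)
    simp; ring
  -- With `w` of order `cosh⁴ a`, one power of decay for `g₁` against `cosh³ a` leaves exactly `1 /
  -- cosh a`; two powers for `g₀` against `cosh⁴ a` leave more than enough.
  have last : ∀ a : ℝ, 0 ≤ a → ‖E (Complex.cosh (a + Real.pi * Complex.I)) x t * G ε g₀ g₁
      (Complex.cosh (a + Real.pi * Complex.I)) T * Complex.sinh (a + Real.pi * Complex.I)‖
      ≤ (4 * (4 / 3 * K₁ + 16 / 9 * K₀)) / Real.cosh a := by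
    intro a ha
    have hc := Real.one_le_cosh a
    have hcp := Real.cosh_pos a
    have hw : (w (Complex.cosh (a + Real.pi * Complex.I))).re = 0 := by
      rw [w_cosh_re]; simp
    -- Equivalent to `(cosh² a / 2 - 1)² ≥ 0`. The reciprocal `4/3` and its square `16/9` are the
    -- constants above.
    have hn : 3 / 4 * Real.cosh a ^ 4 ≤ 1 + ‖w (Complex.cosh (a + Real.pi * Complex.I))‖ := by
      rw [w_neg_cosh]; nlinarith [sq_nonneg (Real.cosh a ^ 2 / 2 - 1)]
    have b1 : ‖tTransform g₁ (w (Complex.cosh (a + Real.pi * Complex.I))) T‖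
        ≤ 4 / 3 * K₁ / Real.cosh a ^ 4 := by
      rw [le_div_iff₀ (by positivity)]
      have h1 := hK₁ _ hw
      rw [pow_one] at h1
      have h2 := mul_le_mul_of_nonneg_right hn
        (norm_nonneg (tTransform g₁ (w (Complex.cosh (a + Real.pi * Complex.I))) T))
      linarith
    have b0 : ‖tTransform g₀ (w (Complex.cosh (a + Real.pi * Complex.I))) T‖
        ≤ 16 / 9 * K₀ / Real.cosh a ^ 8 := by
      rw [le_div_iff₀ (by positivity)]
      have h1 := hK₀ _ hw
      have h2 := mul_le_mul_of_nonneg_right (pow_le_pow_left₀ (by positivity) hn 2)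
        (norm_nonneg (tTransform g₀ (w (Complex.cosh (a + Real.pi * Complex.I))) T))
      have h3 : (3 / 4 * Real.cosh a ^ 4) ^ 2 = 9 / 16 * Real.cosh a ^ 8 := by ring
      rw [h3] at h2
      linarith
    refine (key a Real.pi _ _ hw b0 b1).trans ?_
    rw [Real.sin_pi, mul_zero, mul_zero, neg_zero, Real.exp_zero, one_mul,
      le_div_iff₀ hcp]
    have e1 : (4 * Real.cosh a ^ 2 * (4 / 3 * K₁ / Real.cosh a ^ 4)
        + 4 * Real.cosh a ^ 3 * (16 / 9 * K₀ / Real.cosh a ^ 8)) * Real.cosh a * Real.cosh a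
        = 4 * (4 / 3 * K₁ + 16 / 9 * K₀ * (1 / Real.cosh a ^ 3)) := by
      field_simp
    rw [e1]
    have : 1 / Real.cosh a ^ 3 ≤ 1 := by
      rw [div_le_one (by positivity)]; exact one_le_pow₀ hc
    have := mul_le_of_le_one_right (by positivity : 0 ≤ 16 / 9 * K₀) this
    linarith
  have hsin : 1 / 2 ≤ 1 / Real.sqrt 2 := by
    have : Real.sqrt 2 ≤ 2 := Real.sqrt_le_iff.2 ⟨by norm_num, by norm_num⟩
    gcongr
  set C₁ := 4 * (K₁ + K₀) * K
  set C₂ := 4 * (4 / 3 * K₁ + 16 / 9 * K₀)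
  set C₃ := 4 * (K₁ + K₀)
  have h1 : 0 ≤ C₁ := by positivity
  have h2 : 0 ≤ C₂ := by positivity
  have h3 : 0 ≤ C₃ := by positivity
  have hre : ∀ a b : ℝ, (a + b * Complex.I : ℂ).re = a := fun a b => by simp
  refine ⟨C₁ + C₂ + C₃, fun j s hs => ?_⟩
  have d1 : C₁ / Real.cosh (contourPath j s).re
      ≤ (C₁ + C₂ + C₃) / Real.cosh (contourPath j s).re :=
    div_le_div_of_nonneg_right (by linarith) (Real.cosh_pos _).le
  have d2 : C₂ / Real.cosh (contourPath j s).re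
      ≤ (C₁ + C₂ + C₃) / Real.cosh (contourPath j s).re :=
    div_le_div_of_nonneg_right (by linarith) (Real.cosh_pos _).le
  have d3 : C₃ / Real.cosh (contourPath j s).re
      ≤ (C₁ + C₂ + C₃) / Real.cosh (contourPath j s).re :=
    div_le_div_of_nonneg_right (by linarith) (Real.cosh_pos _).le
  fin_cases j
  · refine le_trans ?_ d1
    change ‖E (Complex.cosh (s + (Real.pi / 4 : ℝ) * Complex.I)) x t * _ * _‖
      ≤ C₁ / Real.cosh (s + (Real.pi / 4 : ℝ) * Complex.I : ℂ).re
    rw [hre]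
    exact ray s _ (le_of_lt hs) (by rw [sin_pi_div_four_eq]; exact hsin) (w_contourPath_re 0 s)
  · refine le_trans ?_ d1
    change ‖E (Complex.cosh (s + (Real.pi / 2 : ℝ) * Complex.I)) x t * _ * _‖
      ≤ C₁ / Real.cosh (s + (Real.pi / 2 : ℝ) * Complex.I : ℂ).re
    rw [hre]
    exact ray s _ (le_of_lt hs) (by rw [Real.sin_pi_div_two]; norm_num) (w_contourPath_re 1 s)
  · refine le_trans ?_ d1
    change ‖E (Complex.cosh (s + (3 * Real.pi / 4 : ℝ) * Complex.I)) x t * _ * _‖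
      ≤ C₁ / Real.cosh (s + (3 * Real.pi / 4 : ℝ) * Complex.I : ℂ).re
    rw [hre]
    exact ray s _ (le_of_lt hs) (by rw [sin_three_pi_div_four]; exact hsin) (w_contourPath_re 2 s)
  · refine le_trans ?_ d2
    change ‖E (Complex.cosh (s + (Real.pi : ℝ) * Complex.I)) x t * _ * _‖
      ≤ C₂ / Real.cosh (s + (Real.pi : ℝ) * Complex.I : ℂ).re
    rw [hre]
    exact last s (le_of_lt hs)
  · refine le_trans ?_ d3
    change ‖E (Complex.cosh (s * Complex.I)) x t * G ε g₀ g₁ (Complex.cosh (s * Complex.I)) T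
      * Complex.sinh (s * Complex.I)‖ ≤ C₃ / Real.cosh (s * Complex.I : ℂ).re
    simpa using side s
  · refine le_trans ?_ d3
    change ‖E (Complex.cosh (s * Complex.I)) x t * G ε g₀ g₁ (Complex.cosh (s * Complex.I)) T
      * Complex.sinh (s * Complex.I)‖ ≤ C₃ / Real.cosh (s * Complex.I : ℂ).re
    simpa using side s

/-! ### Deformation of the inversion contour -/

lemma differentiable_w_cosh : Differentiable ℂ fun ζ => w (Complex.cosh ζ) := by
  unfold w
  exact (differentiable_const _).mul ((Complex.differentiable_cosh.pow 4).sub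
    (Complex.differentiable_cosh.pow 2))

lemma differentiable_tTransform_cosh {g : ℝ → ℂ} {t : ℝ} (hg : IntervalIntegrable g volume 0 t) :
    Differentiable ℂ fun ζ => tTransform g (w (Complex.cosh ζ)) t :=
  (differentiable_tTransform hg).comp differentiable_w_cosh

/-- The regularized inversion integrand in the uniformizing variable. -/
noncomputable def inversionIntegrand (h : ℕ → ℝ → ℂ) (r x t : ℝ) (k : ℂ) : ℂ :=
  Complex.exp (Complex.I * k * x) * regularizer r k *
    (Complex.exp (-w k * t) * boundaryTransform h k t)

lemma differentiableAt_regularizer_cosh {r : ℝ} (hr : 0 < r) {ζ : ℂ}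
    (hζ : 0 ≤ (Complex.cosh ζ).im) :
    DifferentiableAt ℂ (fun ζ => regularizer r (Complex.cosh ζ)) ζ :=
  (differentiableAt_regularizer hr hζ).comp ζ Complex.differentiableAt_cosh

lemma cosh_im_nonneg {ζ : ℂ} (hζ : 0 ≤ ζ.re) (hs : 0 ≤ Real.sin ζ.im) :
    0 ≤ (Complex.cosh ζ).im := by
  rw [← Complex.re_add_im ζ, cosh_im]
  exact mul_nonneg (Real.sinh_nonneg_iff.2 hζ) hs

lemma differentiableAt_inversionIntegrand {h : ℕ → ℝ → ℂ} {r x t : ℝ} (hr : 0 < r)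
    (hh : ∀ j ≤ 3, IntervalIntegrable (h j) volume 0 t) {ζ : ℂ}
    (hζ : 0 ≤ (Complex.cosh ζ).im) :
    DifferentiableAt ℂ
      (fun ζ => inversionIntegrand h r x t (Complex.cosh ζ) * Complex.sinh ζ) ζ := by
  have hc : DifferentiableAt ℂ Complex.cosh ζ := Complex.differentiableAt_cosh
  have hw := differentiable_w_cosh ζ
  have hR := differentiableAt_regularizer_cosh hr hζ
  have h0 := differentiable_tTransform_cosh (hh 0 (by omega)) ζ
  have h1 := differentiable_tTransform_cosh (hh 1 (by omega)) ζ
  have h2 := differentiable_tTransform_cosh (hh 2 (by omega)) ζ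
  have h3 := differentiable_tTransform_cosh (hh 3 (by omega)) ζ
  have e1 : DifferentiableAt ℂ (fun ζ => Complex.exp (Complex.I * Complex.cosh ζ * x)) ζ :=
    ((hc.const_mul _).mul_const _).cexp
  have e2 : DifferentiableAt ℂ (fun ζ => Complex.exp (-w (Complex.cosh ζ) * t)) ζ :=
    (hw.neg.mul_const _).cexp
  have hk2 : DifferentiableAt ℂ (fun ζ => Complex.cosh ζ ^ 2 - 1) ζ := (hc.pow 2).sub_const 1
  have hb : DifferentiableAt ℂ (fun ζ => boundaryTransform h (Complex.cosh ζ) t) ζ := by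
    unfold boundaryTransform
    exact (((h3.neg.sub ((hc.const_mul _).mul h2)).add (hk2.mul h1)).add
      (((hc.const_mul _).mul hk2).mul h0)).const_mul _
  exact ((e1.mul hR).mul (e2.mul hb)).mul Complex.differentiableAt_sinh

/-- Count of powers of `cosh a`: `-5` from the regularizer, `3` from the boundary transform, `1`
from `dk = sinh ζ dζ`. -/
lemma norm_inversionIntegrand_le {h : ℕ → ℝ → ℂ} {r x t M a b : ℝ} (hr : 1 ≤ r) (hx : 0 ≤ x)
    (ht : 0 ≤ t) (hM : ∀ j ≤ 3, ∀ s ∈ Icc 0 t, ‖h j s‖ ≤ M) (ha : 0 ≤ a) (hb : 0 ≤ Real.sin b)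
    (hw : 0 ≤ (w (Complex.cosh (a + b * Complex.I))).re) :
    ‖inversionIntegrand h r x t (Complex.cosh (a + b * Complex.I))
      * Complex.sinh (a + b * Complex.I)‖ ≤ (r ^ 5 * (6 * (M * t))) / Real.cosh a := by
  have hc := Real.cosh_pos a
  have him : 0 ≤ (Complex.cosh (a + b * Complex.I)).im := by
    rw [cosh_im]; exact mul_nonneg (Real.sinh_nonneg_iff.2 ha) hb
  have n1 := norm_exp_I_mul_le_one him hx
  have n2 := norm_regularizer_cosh_le hr ha hb
  have n3 := norm_exp_mul_boundaryTransform_le ht hw hM (Real.one_le_cosh a) (norm_cosh_le a b)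
  have n4 := norm_sinh_le a b
  rw [inversionIntegrand, norm_mul, norm_mul, norm_mul]
  have hM0 : 0 ≤ 6 * (M * t) * Real.cosh a ^ 3 := (norm_nonneg _).trans n3
  have hr0 : 0 ≤ r := by linarith
  calc _ ≤ 1 * (r ^ 5 / Real.cosh a ^ 5) * (6 * (M * t) * Real.cosh a ^ 3) * Real.cosh a := by
        gcongr
    _ = _ := by field_simp

/-- Deformation of the real line to `∂D⁺` for the regularized inversion integral. -/
lemma integral_inversionIntegrand_eq {h : ℕ → ℝ → ℂ} {r x t M : ℝ} (hr : 1 ≤ r) (hx : 0 ≤ x)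
    (ht : 0 ≤ t) (hM : ∀ j ≤ 3, ∀ s ∈ Icc 0 t, ‖h j s‖ ≤ M)
    (hh : ∀ j ≤ 3, IntervalIntegrable (h j) volume 0 t)
    (hint : Integrable fun k : ℝ => inversionIntegrand h r x t k) :
    ∫ k : ℝ, inversionIntegrand h r x t k
      = contourInt (fun ζ => inversionIntegrand h r x t (Complex.cosh ζ) * Complex.sinh ζ) := by
  have hpi := Real.pi_pos
  have hdiff : ∀ ζ ∈ strip 0 Real.pi, DifferentiableAt ℂ
      (fun ζ => inversionIntegrand h r x t (Complex.cosh ζ) * Complex.sinh ζ) ζ :=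
    fun ζ hζ => differentiableAt_inversionIntegrand (by linarith) hh
      (cosh_im_nonneg hζ.1 (Real.sin_nonneg_of_nonneg_of_le_pi hζ.2.1 hζ.2.2))
  rw [integral_real_eq hint]
  refine line_eq_contourInt (C := r ^ 5 * (6 * (M * t)))
    (fun ζ hζ => (hdiff ζ hζ).continuousAt.continuousWithinAt)
    (fun ζ hζ => (hdiff ζ ⟨hζ.1.le, hζ.2.1.le, hζ.2.2.le⟩).differentiableWithinAt)
    (fun a b ha hb => norm_inversionIntegrand_le hr hx ht hM ha ?_ (w_re_nonneg_of_mem ha hb))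
  rcases hb with hb | hb
  · exact Real.sin_nonneg_of_nonneg_of_le_pi hb.1 (by linarith [hb.2])
  · exact Real.sin_nonneg_of_nonneg_of_le_pi (by linarith [hb.1]) (by linarith [hb.2])

/-! ### Vanishing of the unknown contributions -/

/-- The difference of the inversion integrand and the regularized integrand of `W_b`, on a half
strip where `ν = σ i sinh ζ`. -/
noncomputable def residual (g₀ g₁ f : ℝ → ℂ) (σ r x t T : ℝ) (ζ : ℂ) : ℂ :=
  Complex.exp (Complex.I * Complex.cosh ζ * x) * regularizer r (Complex.cosh ζ) *
    (Complex.exp (-w (Complex.cosh ζ) * t) *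
        (rootG g₀ g₁ (σ * Complex.I * Complex.sinh ζ) (Complex.cosh ζ) T
          - rootG g₀ g₁ (σ * Complex.I * Complex.sinh ζ) (Complex.cosh ζ) t)
      + ((σ * Complex.I * Complex.sinh ζ + Complex.cosh ζ)
          / (σ * Complex.I * Complex.sinh ζ - Complex.cosh ζ) * halfFourier f (-Complex.cosh ζ)
        - 2 * Complex.cosh ζ / (σ * Complex.I * Complex.sinh ζ - Complex.cosh ζ)
          * halfFourier f (-(σ * Complex.I * Complex.sinh ζ))))
    * Complex.sinh ζ

lemma differentiable_rootG_cosh {g₀ g₁ : ℝ → ℂ} (hg₀ : Continuous g₀) (hg₁ : Continuous g₁)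
    (σ t : ℝ) : Differentiable ℂ fun ζ =>
      rootG g₀ g₁ (σ * Complex.I * Complex.sinh ζ) (Complex.cosh ζ) t := by
  have hc := Complex.differentiable_cosh
  have hs := Complex.differentiable_sinh
  have h0 := differentiable_tTransform_cosh (hg₀.intervalIntegrable 0 t)
  have h1 := differentiable_tTransform_cosh (hg₁.intervalIntegrable 0 t)
  have hν := hs.const_mul ((σ : ℂ) * Complex.I)
  unfold rootG
  exact (((hc.const_mul _).mul (hc.add hν)).mul h1).sub
    ((((hc.const_mul _).mul hν).mul (hc.add hν)).mul h0)

section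
variable {g₀ g₁ f : ℝ → ℂ} {σ r x t T C M b₁ b₂ : ℝ}

lemma nuStrip_im' (σ : ℝ) (ζ : ℂ) : (σ * Complex.I * Complex.sinh ζ).im
    = Real.sinh ζ.re * (σ * Real.cos ζ.im) := by
  rw [← nuStrip_im, Complex.re_add_im]

lemma nu_sub_ne_zero (hσ : σ ^ 2 = 1) {ζ : ℂ} (hb : 0 ≤ Real.sin ζ.im)
    (hb' : 0 ≤ σ * Real.cos ζ.im) : σ * Complex.I * Complex.sinh ζ - Complex.cosh ζ ≠ 0 := by
  have := cosh_le_norm_nu_sub (a := ζ.re) hσ hb hb'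
  rw [Complex.re_add_im] at this
  exact norm_pos_iff.1 ((Real.cosh_pos _).trans_le this)

/-- The sign conditions say `Im k ≥ 0` and `Im ν ≥ 0`, which keep `-k` and `-ν` in the closed half
plane where the transform is continuous. Strict signs in the open strip give holomorphy in the next
lemma. -/
lemma continuousOn_residual (hr : 0 < r) (hσ : σ ^ 2 = 1) (hg₀ : Continuous g₀)
    (hg₁ : Continuous g₁) (hf : ContinuousOn (halfFourier f) {k | k.im ≤ 0})
    (hb : ∀ b ∈ Icc b₁ b₂, 0 ≤ Real.sin b ∧ 0 ≤ σ * Real.cos b) :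
    ContinuousOn (residual g₀ g₁ f σ r x t T) (strip b₁ b₂) := by
  have hc := Complex.continuous_cosh.continuousOn (s := strip b₁ b₂)
  have hs := Complex.continuous_sinh.continuousOn (s := strip b₁ b₂)
  have hw := differentiable_w_cosh.continuous.continuousOn (s := strip b₁ b₂)
  have hν : ContinuousOn (fun ζ => (σ : ℂ) * Complex.I * Complex.sinh ζ) (strip b₁ b₂) :=
    continuousOn_const.mul hs
  have him : ∀ ζ ∈ strip b₁ b₂, 0 ≤ (Complex.cosh ζ).im := fun ζ hζ =>
    cosh_im_nonneg hζ.1 (hb _ hζ.2).1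
  have hR : ContinuousOn (fun ζ => regularizer r (Complex.cosh ζ)) (strip b₁ b₂) := fun ζ hζ =>
    (differentiableAt_regularizer_cosh hr (him ζ hζ)).continuousAt.continuousWithinAt
  have hα : ContinuousOn (fun ζ => halfFourier f (-Complex.cosh ζ)) (strip b₁ b₂) :=
    hf.comp hc.neg fun ζ hζ => by simpa using him ζ hζ
  have hβ : ContinuousOn (fun ζ => halfFourier f (-(σ * Complex.I * Complex.sinh ζ)))
      (strip b₁ b₂) := hf.comp hν.neg fun ζ hζ => by
    change (-(σ * Complex.I * Complex.sinh ζ)).im ≤ 0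
    rw [Complex.neg_im, nuStrip_im', neg_nonpos]
    exact mul_nonneg (Real.sinh_nonneg_iff.2 hζ.1) (hb _ hζ.2).2
  have hne : ∀ ζ ∈ strip b₁ b₂, σ * Complex.I * Complex.sinh ζ - Complex.cosh ζ ≠ 0 :=
    fun ζ hζ => nu_sub_ne_zero hσ (hb _ hζ.2).1 (hb _ hζ.2).2
  have e1 : ContinuousOn (fun ζ => Complex.exp (Complex.I * Complex.cosh ζ * x)) (strip b₁ b₂) :=
    ((continuousOn_const.mul hc).mul continuousOn_const).cexp
  have e2 : ContinuousOn (fun ζ => Complex.exp (-w (Complex.cosh ζ) * t)) (strip b₁ b₂) :=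
    (hw.neg.mul continuousOn_const).cexp
  exact ((e1.mul hR).mul ((e2.mul
    ((differentiable_rootG_cosh hg₀ hg₁ σ T).continuous.continuousOn.sub
      (differentiable_rootG_cosh hg₀ hg₁ σ t).continuous.continuousOn)).add
    ((((hν.add hc).div (hν.sub hc) hne).mul hα).sub
      (((continuousOn_const.mul hc).div (hν.sub hc) hne).mul hβ)))).mul hs

lemma differentiableOn_residual (hr : 0 < r) (hσ : σ ^ 2 = 1) (hg₀ : Continuous g₀)
    (hg₁ : Continuous g₁) (hf : DifferentiableOn ℂ (halfFourier f) {k | k.im < 0})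
    (hb : ∀ b ∈ Ioo b₁ b₂, 0 < Real.sin b ∧ 0 < σ * Real.cos b) :
    DifferentiableOn ℂ (residual g₀ g₁ f σ r x t T) {ζ | 0 < ζ.re ∧ ζ.im ∈ Ioo b₁ b₂} := by
  set S : Set ℂ := {ζ | 0 < ζ.re ∧ ζ.im ∈ Ioo b₁ b₂}
  have hc := Complex.differentiable_cosh.differentiableOn (s := S)
  have hs := Complex.differentiable_sinh.differentiableOn (s := S)
  have hw := differentiable_w_cosh.differentiableOn (s := S)
  have hν : DifferentiableOn ℂ (fun ζ => (σ : ℂ) * Complex.I * Complex.sinh ζ) S :=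
    hs.const_mul _
  have him : ∀ ζ ∈ S, 0 < (Complex.cosh ζ).im := fun ζ hζ => by
    rw [← Complex.re_add_im ζ, cosh_im]
    exact mul_pos (Real.sinh_pos_iff.2 hζ.1) (hb _ hζ.2).1
  have hR : DifferentiableOn ℂ (fun ζ => regularizer r (Complex.cosh ζ)) S := fun ζ hζ =>
    (differentiableAt_regularizer_cosh hr (him ζ hζ).le).differentiableWithinAt
  have hα : DifferentiableOn ℂ (fun ζ => halfFourier f (-Complex.cosh ζ)) S :=
    hf.comp hc.neg fun ζ hζ => by simpa using him ζ hζ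
  have hβ : DifferentiableOn ℂ (fun ζ => halfFourier f (-(σ * Complex.I * Complex.sinh ζ))) S :=
    hf.comp hν.neg fun ζ hζ => by
      change (-(σ * Complex.I * Complex.sinh ζ)).im < 0
      rw [Complex.neg_im, nuStrip_im', neg_lt_zero]
      exact mul_pos (Real.sinh_pos_iff.2 hζ.1) (hb _ hζ.2).2
  have hne : ∀ ζ ∈ S, σ * Complex.I * Complex.sinh ζ - Complex.cosh ζ ≠ 0 :=
    fun ζ hζ => nu_sub_ne_zero hσ (hb _ hζ.2).1.le (hb _ hζ.2).2.le
  have e1 : DifferentiableOn ℂ (fun ζ => Complex.exp (Complex.I * Complex.cosh ζ * x)) S :=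
    ((hc.const_mul _).mul_const _).cexp
  have e2 : DifferentiableOn ℂ (fun ζ => Complex.exp (-w (Complex.cosh ζ) * t)) S :=
    (hw.neg.mul_const _).cexp
  exact ((e1.mul hR).mul ((e2.mul
    ((differentiable_rootG_cosh hg₀ hg₁ σ T).differentiableOn.sub
      (differentiable_rootG_cosh hg₀ hg₁ σ t).differentiableOn)).add
    ((((hν.add hc).div (hν.sub hc) hne).mul hα).sub
      (((hc.const_mul _).div (hν.sub hc) hne).mul hβ)))).mul hs

/-- The kernel difference grows like `cosh³ a`, the transform terms are bounded because `|ν - k| ≥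
cosh a`, and the regularizer and `dk` bring the total down to `1 / cosh a`. -/
lemma norm_residual_le (hr : 1 ≤ r) (hx : 0 ≤ x) (ht : 0 ≤ t) (htT : t ≤ T) (hσ : σ ^ 2 = 1)
    (hg₀ : Continuous g₀) (hg₁ : Continuous g₁) (hM₀ : ∀ s, ‖g₀ s‖ ≤ M) (hM₁ : ∀ s, ‖g₁ s‖ ≤ M)
    (hf : ∀ k : ℂ, k.im ≤ 0 → ‖halfFourier f k‖ ≤ C) {a b : ℝ} (ha : 0 ≤ a)
    (hb : 0 ≤ Real.sin b) (hb' : 0 ≤ σ * Real.cos b)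
    (hw : (w (Complex.cosh (a + b * Complex.I))).re ≤ 0) :
    ‖residual g₀ g₁ f σ r x t T (a + b * Complex.I)‖
      ≤ (r ^ 5 * (8 * (M * T) + 4 * C)) / Real.cosh a := by
  have hcp := Real.cosh_pos a
  have hc1 := Real.one_le_cosh a
  have him : 0 ≤ (Complex.cosh (a + b * Complex.I)).im := by
    rw [cosh_im]; exact mul_nonneg (Real.sinh_nonneg_iff.2 ha) hb
  have n1 := norm_exp_I_mul_le_one him hx
  have n2 := norm_regularizer_cosh_le hr ha hb
  have n4 := norm_sinh_le a b
  have n5 := norm_cosh_le a b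
  have n6 := cosh_le_norm_nu_sub (a := a) hσ hb hb'
  have d0 := norm_exp_mul_tTransform_sub_le ht htT hw hg₀ hM₀
  have d1 := norm_exp_mul_tTransform_sub_le ht htT hw hg₁ hM₁
  have hα := hf (-Complex.cosh (a + b * Complex.I)) (by simpa using him)
  have hβ := hf (-(σ * Complex.I * Complex.sinh (a + b * Complex.I))) (by
    rw [Complex.neg_im, nuStrip_im, neg_nonpos]
    exact mul_nonneg (Real.sinh_nonneg_iff.2 ha) hb')
  have hC : 0 ≤ C := (norm_nonneg _).trans hα
  have hMT : 0 ≤ M * T := (norm_nonneg _).trans d0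
  have hr0 : 0 ≤ r := by linarith
  have nν : ‖σ * Complex.I * Complex.sinh (a + b * Complex.I)‖ ≤ Real.cosh a := by
    rw [norm_mul, norm_mul, Complex.norm_I, Complex.norm_real, Real.norm_eq_abs,
      (pow_eq_one_iff_of_nonneg (abs_nonneg σ) two_ne_zero).1 (by rw [sq_abs, hσ])]
    linarith
  rw [residual]
  generalize hk : Complex.cosh (a + b * Complex.I) = k at *
  generalize hν : σ * Complex.I * Complex.sinh (a + b * Complex.I) = ν at *
  have hs : ‖ν + k‖ ≤ 2 * Real.cosh a := (norm_add_le _ _).trans (by linarith)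
  have hs' : ‖k + ν‖ ≤ 2 * Real.cosh a := by rwa [add_comm]
  have x1 : ‖Complex.exp (-w k * t) * (rootG g₀ g₁ ν k T - rootG g₀ g₁ ν k t)‖
      ≤ 8 * (M * T) * Real.cosh a ^ 3 := by
    have e : Complex.exp (-w k * t) * (rootG g₀ g₁ ν k T - rootG g₀ g₁ ν k t)
        = -2 * Complex.I * k * (k + ν) *
          (Complex.exp (-w k * t) * (tTransform g₁ (w k) T - tTransform g₁ (w k) t))
        - 2 * k * ν * (k + ν) *
          (Complex.exp (-w k * t) * (tTransform g₀ (w k) T - tTransform g₀ (w k) t)) := by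
      unfold rootG; ring
    rw [e]
    have m1 : ‖-2 * Complex.I * k * (k + ν) *
        (Complex.exp (-w k * t) * (tTransform g₁ (w k) T - tTransform g₁ (w k) t))‖
        ≤ 2 * Real.cosh a * (2 * Real.cosh a) * (M * T) := by
      rw [norm_mul, norm_mul (-2 * Complex.I * k), norm_mul (-2 * Complex.I),
        norm_mul (-2 : ℂ), Complex.norm_I, norm_neg, Complex.norm_ofNat, mul_one]
      gcongr
    have m0 : ‖2 * k * ν * (k + ν) *
        (Complex.exp (-w k * t) * (tTransform g₀ (w k) T - tTransform g₀ (w k) t))‖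
        ≤ 2 * Real.cosh a * Real.cosh a * (2 * Real.cosh a) * (M * T) := by
      rw [norm_mul, norm_mul (2 * k * ν), norm_mul (2 * k), norm_mul (2 : ℂ),
        Complex.norm_ofNat]
      gcongr
    have h2 : Real.cosh a ^ 2 ≤ Real.cosh a ^ 3 := pow_le_pow_right₀ hc1 (by norm_num)
    calc _ ≤ _ := (norm_sub_le _ _).trans (add_le_add m1 m0)
      _ = (4 * Real.cosh a ^ 2 + 4 * Real.cosh a ^ 3) * (M * T) := by ring
      _ ≤ (8 * Real.cosh a ^ 3) * (M * T) := mul_le_mul_of_nonneg_right (by linarith) hMT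
      _ = _ := by ring
  have hpos : 0 < ‖ν - k‖ := hcp.trans_le n6
  have x2 : ‖(ν + k) / (ν - k) * halfFourier f (-k)‖ ≤ 2 * C := by
    rw [norm_mul, norm_div]
    refine mul_le_mul ?_ hα (norm_nonneg _) zero_le_two
    rw [div_le_iff₀ hpos]; linarith
  have x3 : ‖2 * k / (ν - k) * halfFourier f (-ν)‖ ≤ 2 * C := by
    rw [norm_mul, norm_div, norm_mul, Complex.norm_ofNat]
    refine mul_le_mul ?_ hβ (norm_nonneg _) zero_le_two
    rw [div_le_iff₀ hpos]; linarith
  have hc3 : 1 ≤ Real.cosh a ^ 3 := one_le_pow₀ hc1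
  have x4 : ‖Complex.exp (-w k * t) * (rootG g₀ g₁ ν k T - rootG g₀ g₁ ν k t)
      + ((ν + k) / (ν - k) * halfFourier f (-k) - 2 * k / (ν - k) * halfFourier f (-ν))‖
      ≤ (8 * (M * T) + 4 * C) * Real.cosh a ^ 3 := by
    refine (norm_add_le _ _).trans ((add_le_add x1 ((norm_sub_le _ _).trans
      (add_le_add x2 x3))).trans ?_)
    nlinarith [mul_le_mul_of_nonneg_left hc3 hC]
  rw [norm_mul, norm_mul, norm_mul]
  calc _ ≤ 1 * (r ^ 5 / Real.cosh a ^ 5) * ((8 * (M * T) + 4 * C) * Real.cosh a ^ 3)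
        * Real.cosh a := by gcongr
    _ = _ := by field_simp

end

/-- The regularized integrand of `W_b` in the uniformizing variable. -/
noncomputable def WbIntegrand (ε : ℝ) (g₀ g₁ : ℝ → ℂ) (r x t T : ℝ) (ζ : ℂ) : ℂ :=
  regularizer r (Complex.cosh ζ) *
    (E (Complex.cosh ζ) x t * G ε g₀ g₁ (Complex.cosh ζ) T * Complex.sinh ζ)

/-- The global relation at `-k` and `-ν` replaces the eliminated traces by `e^{wt} ŷ(-k)` and
`e^{wt} ŷ(-ν)`; multiplication by `e^{-wt}` removes the exponentials, so these terms need no bound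
on `e^{wt}`. -/
lemma inversionIntegrand_sub_eq_residual {ε : ℝ} {g₀ g₁ f : ℝ → ℂ} {h : ℕ → ℝ → ℂ}
    {σ r x t T : ℝ} (hσ : σ ^ 2 = 1) {ζ : ℂ} (hre : 0 ≤ ζ.re) (hb : 0 ≤ Real.sin ζ.im)
    (hb' : 0 ≤ σ * Real.cos ζ.im)
    (hν : nu ε (Complex.cosh ζ) = σ * Complex.I * Complex.sinh ζ)
    (h₀ : ∀ κ, tTransform (h 0) κ t = tTransform g₀ κ t)
    (h₁ : ∀ κ, tTransform (h 1) κ t = tTransform g₁ κ t)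
    (hglob : ∀ k : ℂ, k.im ≤ 0 →
      Complex.exp (w k * t) * halfFourier f k = boundaryTransform h k t) :
    inversionIntegrand h r x t (Complex.cosh ζ) * Complex.sinh ζ
      - 2 * Real.pi * WbIntegrand ε g₀ g₁ r x t T ζ = residual g₀ g₁ f σ r x t T ζ := by
  have hsq := nuStrip_sq hσ ζ
  have hne := nu_sub_ne_zero hσ hb hb'
  have gα := hglob (-Complex.cosh ζ) (by simpa using cosh_im_nonneg hre hb)
  have gβ := hglob (-(σ * Complex.I * Complex.sinh ζ)) (by
    rw [Complex.neg_im, nuStrip_im', neg_nonpos]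
    exact mul_nonneg (Real.sinh_nonneg_iff.2 hre) hb')
  rw [w_neg] at gα
  rw [w_neg, w_of_sq_eq hsq] at gβ
  have hG : G ε g₀ g₁ (Complex.cosh ζ) T
      = rootG g₀ g₁ (σ * Complex.I * Complex.sinh ζ) (Complex.cosh ζ) T := by rw [← hν]; rfl
  have hr : rootG (h 0) (h 1) (σ * Complex.I * Complex.sinh ζ) (Complex.cosh ζ) t
      = rootG g₀ g₁ (σ * Complex.I * Complex.sinh ζ) (Complex.cosh ζ) t := by
    unfold rootG; rw [h₀, h₁]
  have hexp : Complex.exp (-w (Complex.cosh ζ) * t) * Complex.exp (w (Complex.cosh ζ) * t) = 1 := by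
    rw [← Complex.exp_add, neg_mul, neg_add_cancel, Complex.exp_zero]
  have hE : 2 * Real.pi * E (Complex.cosh ζ) x t
      = -(Complex.exp (Complex.I * Complex.cosh ζ * x)
        * Complex.exp (-w (Complex.cosh ζ) * t)) := by
    have hpi : (Real.pi : ℂ) ≠ 0 := Complex.ofReal_ne_zero.2 Real.pi_ne_zero
    rw [E, ← Complex.exp_add, neg_mul (w _), ← sub_eq_add_neg]
    field_simp
  rw [inversionIntegrand, WbIntegrand, residual, boundaryTransform_eq_rootG h t hsq hne, hr, hG,
    ← gα, ← gβ]
  -- With all transcendental factors abstracted, the identity is algebraic and uses only `e^{-wt}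
  -- e^{wt} = 1` and the relation between `2πE` and the exponentials.
  generalize Complex.exp (w (Complex.cosh ζ) * t) = e at *
  generalize Complex.exp (-w (Complex.cosh ζ) * t) = e' at *
  generalize Complex.exp (Complex.I * Complex.cosh ζ * x) = ex at *
  generalize E (Complex.cosh ζ) x t = EE at *
  generalize halfFourier f (-Complex.cosh ζ) = α at *
  generalize halfFourier f (-(σ * Complex.I * Complex.sinh ζ)) = β at *
  generalize (σ * Complex.I * Complex.sinh ζ + Complex.cosh ζ)
    / (σ * Complex.I * Complex.sinh ζ - Complex.cosh ζ) = p at *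
  generalize 2 * Complex.cosh ζ / (σ * Complex.I * Complex.sinh ζ - Complex.cosh ζ) = q at *
  generalize regularizer r (Complex.cosh ζ) = R at *
  generalize rootG g₀ g₁ (σ * Complex.I * Complex.sinh ζ) (Complex.cosh ζ) T = GT at *
  linear_combination ex * R * Complex.sinh ζ * (p * α - q * β) * hexp
    - R * GT * Complex.sinh ζ * hE

/-- The integrals of the two integrands over `∂D⁺` agree. -/
lemma contourInt_inversionIntegrand_sub {ε : ℝ} (hε : 0 < ε) (hε' : ε < Real.pi / 2)
    {g₀ g₁ f : ℝ → ℂ} {h : ℕ → ℝ → ℂ} {r x t T C M : ℝ} (hr : 1 ≤ r) (hx : 0 ≤ x) (ht : 0 ≤ t)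
    (htT : t ≤ T) (hg₀ : Continuous g₀) (hg₁ : Continuous g₁) (hM₀ : ∀ s, ‖g₀ s‖ ≤ M)
    (hM₁ : ∀ s, ‖g₁ s‖ ≤ M) (hf : ∀ k : ℂ, k.im ≤ 0 → ‖halfFourier f k‖ ≤ C)
    (hfc : ContinuousOn (halfFourier f) {k | k.im ≤ 0})
    (hfd : DifferentiableOn ℂ (halfFourier f) {k | k.im < 0})
    (h₀ : ∀ κ, tTransform (h 0) κ t = tTransform g₀ κ t)
    (h₁ : ∀ κ, tTransform (h 1) κ t = tTransform g₁ κ t)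
    (hglob : ∀ k : ℂ, k.im ≤ 0 →
      Complex.exp (w k * t) * halfFourier f k = boundaryTransform h k t) :
    contourInt (fun ζ => inversionIntegrand h r x t (Complex.cosh ζ) * Complex.sinh ζ
      - 2 * Real.pi * WbIntegrand ε g₀ g₁ r x t T ζ) = 0 := by
  have hpi := Real.pi_pos
  have hr0 : 0 < r := by linarith
  refine contourInt_eq_zero (C := r ^ 5 * (8 * (M * T) + 4 * C)) fun b₁ b₂ hb => ?_
  -- `σ` is the sign of `cos b` on the strip, the choice for which `Im(σ i sinh ζ) ≥ 0`.
  obtain ⟨σ, hσ, hcl, hop, hneg, hν⟩ : ∃ σ : ℝ, σ ^ 2 = 1 ∧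
      (∀ b ∈ Icc b₁ b₂, 0 ≤ Real.sin b ∧ 0 ≤ σ * Real.cos b) ∧
      (∀ b ∈ Ioo b₁ b₂, 0 < Real.sin b ∧ 0 < σ * Real.cos b) ∧
      (∀ b ∈ Icc b₁ b₂, Real.sin b * Real.cos b * Real.cos (2 * b) ≤ 0) ∧
      ∀ a b : ℝ, 0 ≤ a → b ∈ Icc b₁ b₂ → nu ε (Complex.cosh (a + b * Complex.I))
        = σ * Complex.I * Complex.sinh (a + b * Complex.I) := by
    rcases hb with ⟨rfl, rfl⟩ | ⟨rfl, rfl⟩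
    · refine ⟨1, by norm_num, fun b hb => ⟨?_, ?_⟩, fun b hb => ⟨?_, ?_⟩, fun b hb => ?_,
        fun a b ha hb => nu_cosh_right hε hε' ha hb⟩
      · exact Real.sin_nonneg_of_nonneg_of_le_pi (by linarith [hb.1]) (by linarith [hb.2])
      · rw [one_mul]; exact Real.cos_nonneg_of_mem_Icc ⟨by linarith [hb.1], hb.2⟩
      · exact Real.sin_pos_of_pos_of_lt_pi (by linarith [hb.1]) (by linarith [hb.2])
      · rw [one_mul]; exact Real.cos_pos_of_mem_Ioo ⟨by linarith [hb.1], hb.2⟩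
      · exact mul_nonpos_of_nonneg_of_nonpos (mul_nonneg
          (Real.sin_nonneg_of_nonneg_of_le_pi (by linarith [hb.1]) (by linarith [hb.2]))
          (Real.cos_nonneg_of_mem_Icc ⟨by linarith [hb.1], hb.2⟩))
          (Real.cos_nonpos_of_pi_div_two_le_of_le (by linarith [hb.1]) (by linarith [hb.2]))
    · refine ⟨-1, by norm_num, fun b hb => ⟨?_, ?_⟩, fun b hb => ⟨?_, ?_⟩, fun b hb => ?_,
        fun a b ha hb => nu_cosh_left hε hε' ha hb⟩
      · exact Real.sin_nonneg_of_nonneg_of_le_pi (by linarith [hb.1]) hb.2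
      · have := Real.cos_nonpos_of_pi_div_two_le_of_le (x := b) (by linarith [hb.1])
          (by linarith [hb.2])
        linarith
      · exact Real.sin_pos_of_pos_of_lt_pi (by linarith [hb.1]) hb.2
      · have := Real.cos_neg_of_pi_div_two_lt_of_lt (x := b) (by linarith [hb.1])
          (by linarith [hb.2])
        linarith
      · refine mul_nonpos_of_nonpos_of_nonneg (mul_nonpos_of_nonneg_of_nonpos
          (Real.sin_nonneg_of_nonneg_of_le_pi (by linarith [hb.1]) hb.2)
          (Real.cos_nonpos_of_pi_div_two_le_of_le (by linarith [hb.1]) (by linarith [hb.2]))) ?_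
        rw [← Real.cos_sub_two_pi]
        exact Real.cos_nonneg_of_mem_Icc ⟨by linarith [hb.1], by linarith [hb.2]⟩
  have heq : EqOn (fun ζ => inversionIntegrand h r x t (Complex.cosh ζ) * Complex.sinh ζ
      - 2 * Real.pi * WbIntegrand ε g₀ g₁ r x t T ζ) (residual g₀ g₁ f σ r x t T)
      (strip b₁ b₂) := fun ζ hζ => by
    refine inversionIntegrand_sub_eq_residual hσ hζ.1 (hcl _ hζ.2).1 (hcl _ hζ.2).2 ?_ h₀ h₁ hglob
    have := hν ζ.re ζ.im hζ.1 hζ.2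
    rwa [Complex.re_add_im] at this
  refine ⟨(continuousOn_residual hr0 hσ hg₀ hg₁ hfc hcl).congr heq,
    (differentiableOn_residual hr0 hσ hg₀ hg₁ hfd hop).congr fun ζ hζ =>
      heq ⟨hζ.1.le, hζ.2.1.le, hζ.2.2.le⟩, fun a b ha hb => ?_⟩
  have hmem : (a + b * Complex.I : ℂ) ∈ strip b₁ b₂ := by
    simpa [strip] using ⟨ha, hb⟩
  have := heq hmem
  simp only at this
  rw [this]
  exact norm_residual_le hr hx ht htT hσ hg₀ hg₁ hM₀ hM₁ hf ha (hcl b hb).1 (hcl b hb).2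
    (w_cosh_re_nonpos ha (hneg b hb))

/-! ### Assembly of the regularized identity -/

lemma integrable_regularizer_mul_halfFourier {f : ℝ → ℂ} {C r : ℝ} (hr : 0 < r) (x : ℝ)
    (hfc : ContinuousOn (halfFourier f) {k | k.im ≤ 0})
    (hf : ∀ k : ℂ, k.im ≤ 0 → ‖halfFourier f k‖ ≤ C) :
    Integrable fun k : ℝ =>
      Complex.exp (Complex.I * k * x) * regularizer r k * halfFourier f k := by
  have hc : Continuous fun k : ℝ => halfFourier f k :=
    hfc.comp_continuous Complex.continuous_ofReal fun k => by simp
  have h1 : Integrable fun k : ℝ => Complex.exp (Complex.I * k * x) * halfFourier f k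
      * regularizer r k := by
    refine (integrable_regularizer hr).bdd_mul (c := C)
      (Continuous.aestronglyMeasurable (by fun_prop)) (Eventually.of_forall fun k => ?_)
    rw [norm_mul, Complex.norm_exp]
    simpa using hf k (by simp)
  exact h1.congr (Eventually.of_forall fun k => by simp only; ring)

lemma tendsto_regularizer (k : ℂ) :
    Tendsto (fun n : ℕ => regularizer (n + 1 : ℝ) k) atTop (𝓝 1) := by
  have h0 : Tendsto (fun n : ℕ => ((1 / ((n : ℝ) + 1) : ℝ) : ℂ)) atTop (𝓝 ((0 : ℝ) : ℂ)) :=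
    (Complex.continuous_ofReal.tendsto 0).comp tendsto_one_div_add_atTop_nhds_zero_nat
  have h1 := (((h0.const_mul (Complex.I * k)).const_sub 1).pow 5).inv₀ (by simp)
  simp only [Complex.ofReal_zero, mul_zero, sub_zero, one_pow, inv_one] at h1
  refine h1.congr fun n => ?_
  rw [regularizer]
  push_cast
  rw [mul_one_div]

lemma sin_nonneg_of_mem_dStrip {ζ : ℂ} (hζ : ζ ∈ dStrip) : 0 ≤ ζ.re ∧ 0 ≤ Real.sin ζ.im := by
  have hpi := Real.pi_pos
  rcases hζ with h | h
  · exact ⟨h.1, Real.sin_nonneg_of_nonneg_of_le_pi (by linarith [h.2.1]) (by linarith [h.2.2])⟩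
  · exact ⟨h.1, Real.sin_nonneg_of_nonneg_of_le_pi (by linarith [h.2.1]) h.2.2⟩

lemma contourPath_im {j : Fin 6} {s : ℝ} (hs : s ∈ contourInterval j) :
    0 ≤ (Complex.cosh (contourPath j s)).im :=
  cosh_im_nonneg (sin_nonneg_of_mem_dStrip (contourPath_mem hs)).1
    (sin_nonneg_of_mem_dStrip (contourPath_mem hs)).2

lemma continuousOn_regularizer_cosh {r : ℝ} (hr : 0 < r) :
    ContinuousOn (fun ζ => regularizer r (Complex.cosh ζ)) dStrip := fun _ hζ =>
  (differentiableAt_regularizer_cosh hr (cosh_im_nonneg (sin_nonneg_of_mem_dStrip hζ).1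
    (sin_nonneg_of_mem_dStrip hζ).2)).continuousAt.continuousWithinAt

/-- On `∂D⁺` one has `Re w = 0`, so the estimate made for `Re w ≥ 0` still applies; integrability
allows the difference of integrands to be split. -/
lemma integrableOn_contour_inversionIntegrand {h : ℕ → ℝ → ℂ} {r x t M : ℝ} (hr : 1 ≤ r)
    (hx : 0 ≤ x) (ht : 0 ≤ t) (hM : ∀ j ≤ 3, ∀ s ∈ Icc 0 t, ‖h j s‖ ≤ M)
    (hh : ∀ j ≤ 3, IntervalIntegrable (h j) volume 0 t) (j : Fin 6) :
    IntegrableOn (fun s => inversionIntegrand h r x t (Complex.cosh (contourPath j s))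
      * Complex.sinh (contourPath j s)) (contourInterval j) := by
  refine integrableOn_contour (C := r ^ 5 * (6 * (M * t)))
    (H := fun ζ => inversionIntegrand h r x t (Complex.cosh ζ) * Complex.sinh ζ)
    (fun ζ hζ => ?_) (fun j s hs => ?_) j
  · exact (differentiableAt_inversionIntegrand (by linarith) hh (cosh_im_nonneg
      (sin_nonneg_of_mem_dStrip hζ).1
      (sin_nonneg_of_mem_dStrip hζ).2)).continuousAt.continuousWithinAt
  · have hmem := sin_nonneg_of_mem_dStrip (contourPath_mem hs)
    have hw := w_contourPath_re j s
    generalize contourPath j s = ζ at *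
    have := norm_inversionIntegrand_le (h := h) hr hx ht hM hmem.1 hmem.2
      (by rw [Complex.re_add_im, hw])
    rwa [Complex.re_add_im] at this

section
variable {T : ℝ} {g₀ g₁ : ℝ → ℂ} {y : ℝ → ℝ → ℂ}

/-- The regularized form of the integral representation. -/
lemma integral_gammaDensity_mul_eq_contourInt {ε x t C M r : ℝ} (hT : 0 < T) (hε : 0 < ε)
    (hε' : ε < Real.pi / 2) (hy : IsSolution T g₀ g₁ y) (hsmooth : SmoothUpToBoundary T y)
    (hC : ∀ j : ℕ, j ≤ 4 → ∀ x t : ℝ, 0 < x → 0 ≤ t → t ≤ T →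
      ‖iteratedDeriv j (fun ξ => y ξ t) x‖ ≤ C / (1 + x) ^ 2)
    (hg₀ : Continuous g₀) (hg₁ : Continuous g₁) (hM₀ : ∀ s, ‖g₀ s‖ ≤ M)
    (hM₁ : ∀ s, ‖g₁ s‖ ≤ M) (hx : 0 < x) (ht : t ∈ Icc 0 T) (hr : 1 ≤ r)
    (hint : ∀ j, IntegrableOn (fun s => WbIntegrand ε g₀ g₁ r x t T (contourPath j s))
      (contourInterval j)) :
    ∫ ξ in Ioi 0, ((r * gammaDensity (r * (ξ - x)) : ℝ) : ℂ) * y ξ t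
      = contourInt (WbIntegrand ε g₀ g₁ r x t T) := by
  have hpi := Real.pi_pos
  have hr0 : 0 < r := by linarith
  set f : ℝ → ℂ := fun ξ => y ξ t with hf
  set h : ℕ → ℝ → ℂ := fun j s => jet T y j (0, s) with hh
  have hfcont : ContinuousOn f (Ici 0) :=
    continuousOn_jet_left hT hsmooth (j := 0) (by omega) ht
  have hfC : ∀ x, 0 ≤ x → ‖f x‖ ≤ C / (1 + x) ^ 2 := fun x hx =>
    norm_jet_le hT hsmooth hC (j := 0) (by omega) hx ht
  have hFC : ∀ k : ℂ, k.im ≤ 0 → ‖halfFourier f k‖ ≤ C := fun k hk => norm_halfFourier_le hfC hk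
  have hFc := continuousOn_halfFourier hfcont hfC
  have hFd := differentiableOn_halfFourier hfcont hfC
  have hglob : ∀ k : ℂ, k.im ≤ 0 →
      Complex.exp (w k * t) * halfFourier f k = boundaryTransform h k t := fun k hk =>
    exp_mul_halfFourier_eq hT hy hsmooth hC hk ht
  have hsub : Icc 0 t ⊆ Icc 0 T := Icc_subset_Icc_right ht.2
  have hhM : ∀ j ≤ 3, ∀ s ∈ Icc 0 t, ‖h j s‖ ≤ C := fun j hj s hs => by
    simpa using norm_jet_le hT hsmooth hC (j := j) (by omega) le_rfl (hsub hs)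
  have hhi : ∀ j ≤ 3, IntervalIntegrable (h j) volume 0 t := fun j hj => by
    refine ContinuousOn.intervalIntegrable ?_
    rw [uIcc_of_le ht.1]
    exact (continuousOn_jet_right hT hsmooth (by omega) le_rfl).mono hsub
  have h₀ : ∀ κ, tTransform (h 0) κ t = tTransform g₀ κ t := fun κ =>
    tTransform_congr (fun s hs => jet_zero_boundary hy hs) κ ht
  have h₁ : ∀ κ, tTransform (h 1) κ t = tTransform g₁ κ t := fun κ =>
    tTransform_congr (fun s hs => jet_one_boundary hT hy hsmooth hs) κ ht
  -- Real `k` also satisfy `Im k ≤ 0`, so the global relation undoes itself here and the inversion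
  -- integrand is the regularized transform of `y`.
  have hreal : ∀ k : ℝ, inversionIntegrand h r x t k
      = Complex.exp (Complex.I * k * x) * regularizer r k * halfFourier f k := fun k => by
    rw [inversionIntegrand, ← hglob k (by simp), ← mul_assoc (Complex.exp (-w k * t)),
      ← Complex.exp_add, neg_mul, neg_add_cancel, Complex.exp_zero, one_mul]
  have hinv : Integrable fun k : ℝ => inversionIntegrand h r x t k := by
    simp only [hreal]
    exact integrable_regularizer_mul_halfFourier hr0 x hFc hFC
  have e1 := integral_inversionIntegrand_eq hr hx.le ht.1 hhM hhi hinv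
  have hzero := contourInt_inversionIntegrand_sub hε hε' hr hx.le ht.1 ht.2 hg₀ hg₁ hM₀ hM₁ hFC
    hFc hFd h₀ h₁ hglob
  rw [contourInt_sub (H₁ := fun ζ => inversionIntegrand h r x t (Complex.cosh ζ) *
      Complex.sinh ζ) (H₂ := fun ζ => 2 * Real.pi * WbIntegrand ε g₀ g₁ r x t T ζ)
      (integrableOn_contour_inversionIntegrand hr hx.le ht.1 hhM hhi)
      (fun j => Integrable.const_mul (hint j) (2 * Real.pi : ℂ)), contourInt_const_mul, sub_eq_zero, ← e1] at hzero
  simp only [hreal] at hzero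
  rw [integral_regularizer_mul_halfFourier hr0
    (integrableOn_of_decay hfcont hfC)] at hzero
  exact mul_left_cancel₀ (by simp [hpi.ne']) hzero

end

end HalfLine

/-! ### Removal of the regularization -/

open HalfLine

theorem theorem2p1
    (T : ℝ) (hT : 0 < T)
    (ε : ℝ) (hε : 0 < ε) (hε' : ε < Real.pi / 2)
    (g₀ g₁ : ℝ → ℂ)
    (hg₀ : HasCompactSupport g₀) (hg₀' : tsupport g₀ ⊆ Set.Ioo 0 T)
    (hg₁ : HasCompactSupport g₁) (hg₁' : tsupport g₁ ⊆ Set.Ioo 0 T)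
    (y : ℝ → ℝ → ℂ)
    (hy : HalfLine.IsSolution T g₀ g₁ y)
    (hsmooth : HalfLine.SmoothUpToBoundary T y)
    (hdecay : HalfLine.DecaysAtInfinity T y)
    (x t : ℝ) (hx : 0 < x) (ht : 0 < t) (htT : t < T) :
    HalfLine.BdryIntegrable (fun k => HalfLine.E k x t * HalfLine.G ε g₀ g₁ k T) ∧
      y x t = HalfLine.Wb ε T g₀ g₁ x t := by
  obtain ⟨C, hC⟩ := hdecay
  have htI : t ∈ Icc 0 T := ⟨ht.le, htT.le⟩
  -- The smoothness of the data is inherited from the traces of `y`; two derivatives of `g₀` and one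
  -- of `g₁` are what the bound on the ray `(-∞,-1]` consumes.
  have d₀ : ContDiff ℝ 2 g₀ := contDiff_of_eqOn_Ioo hg₀'
    (contDiffOn_jet_boundary hT hsmooth 0 2 (by omega)) fun s hs => jet_zero_boundary hy hs
  have d₁ : ContDiff ℝ 1 g₁ := contDiff_of_eqOn_Ioo hg₁'
    (contDiffOn_jet_boundary hT hsmooth 1 1 (by omega)) fun s hs =>
      jet_one_boundary hT hy hsmooth hs
  obtain ⟨M₀, hM₀⟩ := exists_norm_le d₀.continuous hg₀
  obtain ⟨M₁, hM₁⟩ := exists_norm_le d₁.continuous hg₁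
  obtain ⟨K, hK⟩ := exists_integrand_bound hT hx ε t d₀ hg₀ hg₀' d₁ hg₁ hg₁'
  have hcont := continuousOn_integrand hε hε' d₀.continuous d₁.continuous x t T
  obtain ⟨hbi, hbe⟩ := bdryIntegral_eq_contourInt (f := fun k => E k x t * G ε g₀ g₁ k T)
    (integrableOn_contour hcont hK)
  refine ⟨hbi, ?_⟩
  rw [Wb, hbe]
  have hr0 : ∀ n : ℕ, (0 : ℝ) < n + 1 := fun n => by positivity
  have hWc : ∀ n : ℕ, ContinuousOn (WbIntegrand ε g₀ g₁ (n + 1 : ℝ) x t T) dStrip := fun n =>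
    (continuousOn_regularizer_cosh (hr0 n)).mul hcont
  have hWb : ∀ (n : ℕ) j, ∀ s ∈ contourInterval j,
      ‖WbIntegrand ε g₀ g₁ (n + 1 : ℝ) x t T (contourPath j s)‖
        ≤ K / Real.cosh (contourPath j s).re := fun n j s hs => by
    rw [WbIntegrand, norm_mul]
    exact (mul_le_of_le_one_left (norm_nonneg _)
      (norm_regularizer_le_one (hr0 n) (contourPath_im hs))).trans (hK j s hs)
  have hlim := tendsto_contourInt hWc hWb (H' := fun ζ => E (Complex.cosh ζ) x t *
    G ε g₀ g₁ (Complex.cosh ζ) T * Complex.sinh ζ) fun ζ => by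
      simpa [WbIntegrand] using (tendsto_regularizer (Complex.cosh ζ)).mul_const
        (E (Complex.cosh ζ) x t * G ε g₀ g₁ (Complex.cosh ζ) T * Complex.sinh ζ)
  have hlim' := tendsto_integral_gammaDensity (f := fun ξ => y ξ t) (C := C)
    ((continuousOn_jet_left hT hsmooth (j := 0) (by omega) htI).mono Ioi_subset_Ici_self)
    (fun ξ hξ => by
      have h1 := norm_jet_le hT hsmooth hC (j := 0) (by omega) hξ.le htI
      have hC0 : 0 ≤ C := by
        have := (norm_nonneg _).trans (norm_jet_le hT hsmooth hC (j := 0) (by omega) le_rfl htI)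
        simpa using this
      exact h1.trans (div_le_self hC0 (one_le_pow₀ (by linarith)))) hx
  -- The regularized identities with `r = n + 1` equate the two sequences term by term, so their
  -- limits `y x t` and the contour integral coincide.
  refine tendsto_nhds_unique hlim' (hlim.congr fun n => ?_)
  exact (integral_gammaDensity_mul_eq_contourInt hT hε hε' hy hsmooth hC d₀.continuous
    d₁.continuous (M := max M₀ M₁) (fun s => (hM₀ s).trans (le_max_left _ _))
    (fun s => (hM₁ s).trans (le_max_right _ _)) hx htI
    (by linarith [n.cast_nonneg (α := ℝ)]) (integrableOn_contour (hWc n) (hWb n))).symm
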